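/- **Random order secretary problem with $p$-sampling (ROS$p$).** There are $n\ge 1$ elements with distinct real values $\alpha_1,\dots,\alpha_n$, unknown to us. Each element is sampled independently with probability $p\in[0,1]$; $S$ is the set of sampled elements and $V$ the set of the remaining (online) elements. The values of $S$ are known from the start, and the elements of $V$ are then revealed one by one in uniformly random order. A (possibly randomized) algorithm, which may know $n$ and $p$, decides at each revealed element whether to stop with it, on the basis of the sampled values and the online values revealed so far. It wins if it stops with the maximum of $V$; if $V=\emptyset$ it wins by convention. Its success guarantee is the infimum, over all $n\ge1$ and all distinct $\alpha_1,\dots,\alpha_n$, of the probability that it wins. **The algorithms $ALG_t$.** Let $t=(t_k)_{k\ge1}$ satisfy $0\le t_1<t_2<\cdots<1$. Give the elements independent uniform arrival times $\tau_i\in[0,1]$; element $i$ is sampled if $\tau_i<p$, and the others are revealed in the order of their arrival times. (This induces the same law of samples and order as above.) When an online value $\alpha_i$ is revealed with $t_k\le\tau_i<t_{k+1}$ for some $k\ge1$, $ALG_t$ accepts it if it is the largest online value seen so far and is greater than the $k$-th largest sampled value (which is $-\infty$ if $|S|<k$). It accepts nothing at times outside $\bigcup_{k\ge1}[t_k,t_{k+1})$.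 **Theorem.** There is a sequence $t^*$ with $0\le t^*_1<t^*_2<\cdots<1$, independent of $p$ and $n$, such that for every $p\in[0,1]$, $ALG_{t^*}$ can be realized by a randomized algorithm for ROS$p$ (with the same winning probability on every instance), and its success guarantee is the largest success guarantee of any algorithm for ROS$p$. For $p=0$ this guarantee equals $1/e$. As $p\to1^-$ it tends to $\gamma\approx0.5801$, the optimal success guarantee in the full-information secretary problem, i.e. the infimum over $n\ge1$ of the best probability with which a stopping time selects the maximum of $n$ independent uniform values on $[0,1]$ that are revealed one by one. Explicitly, $$\gamma=e^{-c}+(e^{c}-1-c)\int_1^\infty x^{-1}e^{-cx}\,dx,\qquad\text{where } c>0 \text{ solves } \int_0^1\frac{e^{cx}-1}{x}\,dx=1 .$$ -/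

import Mathlib

open MeasureTheory

namespace ROSp

/-! ### The random order secretary problem with `p`-sampling -/

/-- A (randomized) algorithm. `A n S [v₁, …, v_j]` is the probability with which it stops at the
`j`-th online value `v_j`, when there are `n` elements in total, `S` is the set of the values of
the sampled elements, `v₁, …, v_j` are the online values revealed so far, in order of arrival, and
it has not stopped before. No restriction is made: the decision may depend on `n` and on the actual
values, and not only on their relative order. -/
abbrev Algorithm : Type := ℕ → Finset ℝ → List ℝ → unitInterval

/-- The values of the online elements (those that are not in `S`), in the order `σ` of arrival:
`σ k` is the element in position `k`. -/
def onlineValues {n : ℕ} (α : Fin n ↪ ℝ) (S : Finset (Fin n)) (σ : Equiv.Perm (Fin n)) : List ℝ :=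
  ((List.ofFn σ).filter (fun i => i ∉ S)).map α

open Classical in
/-- The probability of stopping at the maximum of the list `L` of online values, for an algorithm
that stops at the last value of the prefix `L'` of `L` with (conditional) probability `q L'`.
An empty list counts as a win. -/
noncomputable def winProbOnList (q : List ℝ → unitInterval) (L : List ℝ) : ℝ :=
  if L = [] then 1 else
    ∑ j : Fin L.length,
      if ∀ y ∈ L, y ≤ L[j] then
        (∏ i ∈ Finset.range j, (1 - (q (L.take (i + 1)) : ℝ))) * (q (L.take (j + 1)) : ℝ)
      else 0

/-- The probability that the algorithm `A` stops with the maximum online value on the instance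
`α 0, …, α (n - 1)`: every element is sampled independently with probability `p`, and the order is
an independent uniformly random permutation. -/
noncomputable def winProb (p : ℝ) (A : Algorithm) {n : ℕ} (α : Fin n ↪ ℝ) : ℝ :=
  ∑ S : Finset (Fin n), p ^ S.card * (1 - p) ^ (n - S.card) *
    ((∑ σ : Equiv.Perm (Fin n), winProbOnList (A n (S.map α)) (onlineValues α S σ)) /
      (n.factorial : ℝ))

/-- The success probability for `n` elements: the infimum over all (distinct) values. -/
noncomputable def successProb (p : ℝ) (A : Algorithm) (n : ℕ) : ℝ :=
  ⨅ α : Fin n ↪ ℝ, winProb p A α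

/-- The success guarantee: the infimum of the success probability over all `n ≥ 1`. -/
noncomputable def guarantee (p : ℝ) (A : Algorithm) : ℝ :=
  ⨅ n : ℕ+, successProb p A n

/-! ### The algorithm given by a sequence of time thresholds

The element `i` arrives at time `τ i`, where the `τ i` are independent and uniform on `[0, 1]`; it
is sampled if `τ i < p` and online otherwise. Sequences are indexed from `0`: the entry `t k` is
the usual `t_{k+1}`. -/

/-- `0 ≤ t_1 < t_2 < ⋯ < 1`. -/
def IsThresholdSeq (t : ℕ → ℝ) : Prop :=
  0 ≤ t 0 ∧ StrictMono t ∧ ∀ k, t k < 1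

open Classical in
/-- The values of the sampled elements. -/
noncomputable def sampleValues (p : ℝ) {n : ℕ} (α : Fin n ↪ ℝ) (τ : Fin n → unitInterval) :
    Finset ℝ :=
  (Finset.univ.filter (fun i => (τ i : ℝ) < p)).map α

/-- The `(k + 1)`-st largest element of `S`, or `-∞` if `S` has at most `k` elements. -/
noncomputable def nthLargest (S : Finset ℝ) (k : ℕ) : WithBot ℝ :=
  match (S.sort (· ≥ ·))[k]? with
  | some v => (v : WithBot ℝ)
  | none => ⊥

/-- `ALG_t` would accept the element `i` if it has not stopped before: `i` is online, its value is
the largest among the online values seen so far, and it is greater than the `(k+1)`-st largest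
sampled value, for the index `k` with `t k ≤ τ i < t (k + 1)`. -/
def Acceptable (t : ℕ → ℝ) (p : ℝ) {n : ℕ} (α : Fin n ↪ ℝ) (τ : Fin n → unitInterval)
    (i : Fin n) : Prop :=
  p ≤ τ i ∧ (∀ j, p ≤ τ j → τ j < τ i → α j < α i) ∧
    ∃ k, t k ≤ τ i ∧ τ i < t (k + 1) ∧ nthLargest (sampleValues p α τ) k < (α i : WithBot ℝ)

/-- `ALG_t` stops with the element `i`, the first acceptable one. -/
def Picks (t : ℕ → ℝ) (p : ℝ) {n : ℕ} (α : Fin n ↪ ℝ) (τ : Fin n → unitInterval)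
    (i : Fin n) : Prop :=
  Acceptable t p α τ i ∧ ∀ j, τ j < τ i → ¬ Acceptable t p α τ j

/-- `ALG_t` wins: there are no online elements, or it stops with the maximum of them. -/
def Wins (t : ℕ → ℝ) (p : ℝ) {n : ℕ} (α : Fin n ↪ ℝ) (τ : Fin n → unitInterval) : Prop :=
  (∀ i, (τ i : ℝ) < p) ∨ ∃ i, Picks t p α τ i ∧ ∀ j, p ≤ τ j → α j ≤ α i

/-- The probability that `ALG_t` wins on the instance `α`. -/
noncomputable def algWinProb (t : ℕ → ℝ) (p : ℝ) {n : ℕ} (α : Fin n ↪ ℝ) : ℝ :=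
  (volume : Measure (Fin n → unitInterval)).real {τ | Wins t p α τ}

/-- The success probability of `ALG_t` for `n` elements. -/
noncomputable def algSuccessProb (t : ℕ → ℝ) (p : ℝ) (n : ℕ) : ℝ :=
  ⨅ α : Fin n ↪ ℝ, algWinProb t p α

/-- The success guarantee of `ALG_t`. -/
noncomputable def algGuarantee (t : ℕ → ℝ) (p : ℝ) : ℝ :=
  ⨅ n : ℕ+, algSuccessProb t p n

/-! ### The full-information secretary problem

The values are independent and uniformly distributed on `[0, 1]`, and this is known. -/

/-- The best probability of stopping at the maximum of `n` values, over all stopping times for the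
filtration generated by the values (`⊤` means that the rule never stops). -/
noncomputable def fullInfoValue (n : ℕ) : ℝ :=
  ⨆ T : {T : (Fin n → unitInterval) → WithTop (Fin n) //
      IsStoppingTime (Filtration.piLE (X := fun _ : Fin n => unitInterval)) T},
    (volume : Measure (Fin n → unitInterval)).real
      {x | ∃ i : Fin n, T.1 x = (i : WithTop (Fin n)) ∧ ∀ j, x j ≤ x i}

/-- The optimal success guarantee in the full-information secretary problem. -/
noncomputable def fullInfoGuarantee : ℝ :=
  ⨅ n : ℕ+, fullInfoValue n

/-- Samuels' expression `e^{-c} + (e^c - 1 - c) ∫_1^∞ x⁻¹ e^{-cx} dx`. -/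
noncomputable def samuelsExpr (c : ℝ) : ℝ :=
  Real.exp (-c) + (Real.exp c - 1 - c) * ∫ x in Set.Ioi (1 : ℝ), x⁻¹ * Real.exp (-c * x)

end ROSp

namespace ROSp
open Set

/-! ### The function `(e^u - 1) / u` and its primitive -/

/-- The function `(e^u - 1) / u`, with value `1` at `0`. -/
noncomputable def expSlope (u : ℝ) : ℝ := dslope Real.exp 0 u

/-- The primitive `∫_0^z (e^u - 1) / u du`. -/
noncomputable def Ein (z : ℝ) : ℝ := ∫ u in (0 : ℝ)..z, expSlope u

theorem expSlope_zero : expSlope 0 = 1 := by simp [expSlope]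

theorem mul_expSlope (u : ℝ) : u * expSlope u = Real.exp u - 1 := by
  have h := sub_smul_dslope Real.exp 0 u
  simpa [expSlope] using h

theorem expSlope_of_ne {u : ℝ} (hu : u ≠ 0) : expSlope u = (Real.exp u - 1) / u := by
  rw [eq_div_iff hu, mul_comm, mul_expSlope]

theorem continuous_expSlope : Continuous expSlope := by
  rw [← continuousOn_univ]
  exact (continuousOn_dslope Filter.univ_mem).2
    ⟨Real.continuous_exp.continuousOn, Real.differentiable_exp.differentiableAt⟩

theorem one_le_expSlope {u : ℝ} (hu : 0 ≤ u) : 1 ≤ expSlope u := by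
  rcases hu.eq_or_lt with rfl | h
  · rw [expSlope_zero]
  · rw [expSlope_of_ne h.ne', le_div_iff₀ h]
    linarith [Real.add_one_le_exp u]

theorem monotoneOn_expSlope : MonotoneOn expSlope (Ici 0) := by
  intro u hu v hv huv
  rcases (show (0:ℝ) ≤ u from hu).eq_or_lt with rfl | h
  · rw [expSlope_zero]; exact one_le_expSlope hv
  · have hv0 : 0 < v := h.trans_le huv
    rw [expSlope_of_ne h.ne', expSlope_of_ne hv0.ne']
    have := convexOn_exp.secant_mono (a := 0) (x := u) (y := v) trivial trivial trivial h.ne' hv0.ne'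
      huv
    simpa using this

theorem hasDerivAt_Ein (z : ℝ) : HasDerivAt Ein (expSlope z) z :=
  intervalIntegral.integral_hasDerivAt_right (continuous_expSlope.intervalIntegrable _ _)
    (continuous_expSlope.stronglyMeasurableAtFilter _ _) continuous_expSlope.continuousAt

theorem continuous_Ein : Continuous Ein :=
  continuous_iff_continuousAt.2 fun z => (hasDerivAt_Ein z).continuousAt

theorem Ein_zero : Ein 0 = 0 := by simp [Ein]

theorem Ein_sub (a b : ℝ) : Ein b - Ein a = ∫ u in a..b, expSlope u := by
  rw [Ein, Ein, intervalIntegral.integral_interval_sub_left] <;>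
    exact continuous_expSlope.intervalIntegrable _ _

theorem sub_le_Ein_sub {a b : ℝ} (ha : 0 ≤ a) (hab : a ≤ b) : b - a ≤ Ein b - Ein a := by
  rw [Ein_sub]
  have h : ∫ _ in a..b, (1 : ℝ) ≤ ∫ u in a..b, expSlope u :=
    intervalIntegral.integral_mono_on hab (by simp)
      (continuous_expSlope.intervalIntegrable _ _) fun u hu => one_le_expSlope (ha.trans hu.1)
  simpa using h

theorem Ein_mono {a b : ℝ} (ha : 0 ≤ a) (hab : a ≤ b) : Ein a ≤ Ein b := by
  linarith [sub_le_Ein_sub ha hab]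

theorem le_Ein {z : ℝ} (hz : 0 ≤ z) : z ≤ Ein z := by
  have := sub_le_Ein_sub le_rfl hz
  rw [Ein_zero] at this; linarith

theorem exists_Ein_eq_one : ∃ c : ℝ, 0 < c ∧ c ≤ 1 ∧ Ein c = 1 := by
  obtain ⟨c, hc, h⟩ := intermediate_value_Icc (zero_le_one (α := ℝ)) continuous_Ein.continuousOn
    (show (1 : ℝ) ∈ Icc (Ein 0) (Ein 1) from ⟨by rw [Ein_zero]; norm_num, le_Ein zero_le_one⟩)
  refine ⟨c, hc.1.lt_of_ne ?_, hc.2, h⟩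
  rintro rfl
  rw [Ein_zero] at h; norm_num at h

theorem integral_exp_mul_sub_one_div (c : ℝ) :
    ∫ x in (0 : ℝ)..1, (Real.exp (c * x) - 1) / x = Ein c := by
  have h : ∫ x in (0 : ℝ)..1, (Real.exp (c * x) - 1) / x =
      ∫ x in (0 : ℝ)..1, c * expSlope (c * x) := by
    refine intervalIntegral.integral_congr_ae (Filter.Eventually.of_forall fun x hx => ?_)
    rw [uIoc_of_le zero_le_one] at hx
    rw [div_eq_iff hx.1.ne', ← mul_expSlope]; ring
  rw [h, intervalIntegral.integral_const_mul, intervalIntegral.mul_integral_comp_mul_left]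
  simp [Ein]

theorem integral_one_sub_Ein (x : ℝ) :
    ∫ v in (0 : ℝ)..x, (1 - Ein v) = Real.exp x - 1 - x * Ein x := by
  have h : ∀ v ∈ uIcc 0 x, HasDerivAt (fun v => Real.exp v - v * Ein v) (1 - Ein v) v := by
    intro v _
    have h1 := (Real.hasDerivAt_exp v).sub ((hasDerivAt_id v).mul (hasDerivAt_Ein v))
    refine h1.congr_deriv ?_
    have := mul_expSlope v
    simp only [id]; linarith
  rw [intervalIntegral.integral_eq_sub_of_hasDerivAt h
    ((continuous_const.sub continuous_Ein).intervalIntegrable _ _)]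
  simp; ring

/-! ### The limit value -/

/-- The average over `w ∈ [0, 1]` of the positive part of `1 - Ein (x w)`. -/
noncomputable def gainAvg (x : ℝ) : ℝ := ∫ w in (0 : ℝ)..1, max (1 - Ein (x * w)) 0

/-- The limit value of the full-information problem. -/
noncomputable def limitValue : ℝ := ∫ x in Ioi (0 : ℝ), Real.exp (-x) * gainAvg x

theorem continuous_gainAvg : Continuous gainAvg := by
  refine intervalIntegral.continuous_parametric_intervalIntegral_of_continuous' ?_ _ _
  have := continuous_Ein
  fun_prop

theorem continuous_posPart_one_sub_Ein : Continuous fun v => max (1 - Ein v) 0 := by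
  have := continuous_Ein
  fun_prop

theorem gainAvg_nonneg (x : ℝ) : 0 ≤ gainAvg x :=
  intervalIntegral.integral_nonneg zero_le_one fun _ _ => le_max_right _ _

theorem gainAvg_le_one {x : ℝ} (hx : 0 ≤ x) : gainAvg x ≤ 1 := by
  have h : gainAvg x ≤ ∫ _ in (0 : ℝ)..1, (1 : ℝ) := by
    refine intervalIntegral.integral_mono_on zero_le_one ?_ (by simp) fun w hw => ?_
    · exact (continuous_posPart_one_sub_Ein.comp (continuous_const.mul continuous_id)).intervalIntegrable _ _
    · refine max_le ?_ zero_le_one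
      have := le_Ein (mul_nonneg hx hw.1)
      linarith [mul_nonneg hx hw.1]
  simpa using h

theorem mul_gainAvg (x : ℝ) : x * gainAvg x = ∫ v in (0 : ℝ)..x, max (1 - Ein v) 0 := by
  rw [gainAvg, intervalIntegral.mul_integral_comp_mul_left (f := fun v => max (1 - Ein v) 0)]
  simp

theorem integrableOn_exp_neg_mul_gainAvg :
    IntegrableOn (fun x => Real.exp (-x) * gainAvg x) (Ioi 0) := by
  have h1 : IntegrableOn (fun x : ℝ => Real.exp (-x)) (Ioi 0) := integrableOn_exp_neg_Ioi 0
  refine h1.mono' ?_ ?_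
  · exact ((Real.continuous_exp.comp continuous_neg).mul continuous_gainAvg).aestronglyMeasurable
  · refine (ae_restrict_iff' measurableSet_Ioi).2 (Filter.Eventually.of_forall fun x hx => ?_)
    rw [Real.norm_of_nonneg (mul_nonneg (Real.exp_pos _).le (gainAvg_nonneg x))]
    exact mul_le_of_le_one_right (Real.exp_pos _).le (gainAvg_le_one (le_of_lt hx))

theorem gainAvg_of_le {c : ℝ} (hc : Ein c = 1) {x : ℝ} (hx : 0 < x) (hxc : x ≤ c) :
    gainAvg x = expSlope x - Ein x := by
  have h : x * gainAvg x = x * (expSlope x - Ein x) := by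
    rw [mul_gainAvg, mul_sub, mul_expSlope, ← integral_one_sub_Ein]
    refine intervalIntegral.integral_congr fun v hv => ?_
    rw [uIcc_of_le hx.le] at hv
    have := Ein_mono hv.1 (hv.2.trans hxc)
    exact max_eq_left (by linarith)
  exact mul_left_cancel₀ hx.ne' h

theorem gainAvg_of_ge {c : ℝ} (hc0 : 0 < c) (hc : Ein c = 1) {x : ℝ} (hxc : c ≤ x) :
    gainAvg x = (Real.exp c - 1 - c) * x⁻¹ := by
  have hx : 0 < x := hc0.trans_le hxc
  have h : x * gainAvg x = Real.exp c - 1 - c := by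
    have hi := fun a b => continuous_posPart_one_sub_Ein.intervalIntegrable (μ := volume) a b
    rw [mul_gainAvg, ← intervalIntegral.integral_add_adjacent_intervals (hi 0 c) (hi c x)]
    have h2 : ∫ v in c..x, max (1 - Ein v) 0 = 0 := by
      rw [intervalIntegral.integral_congr (g := fun _ => (0 : ℝ)) fun v hv => ?_]
      · simp
      · rw [uIcc_of_le hxc] at hv
        have := Ein_mono hc0.le hv.1
        exact max_eq_right (by linarith)
    rw [h2, add_zero, ← mul_gainAvg, gainAvg_of_le hc hc0 le_rfl, mul_sub, mul_expSlope, hc, mul_one]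
  rw [← h]; field_simp

theorem limitValue_eq_samuelsExpr {c : ℝ} (hc0 : 0 < c) (hc : Ein c = 1) :
    limitValue = samuelsExpr c := by
  have hI := integrableOn_exp_neg_mul_gainAvg
  have h1 : ∫ x in Ioc 0 c, Real.exp (-x) * gainAvg x = Real.exp (-c) := by
    have hd : ∀ x ∈ uIcc 0 c, HasDerivAt (fun x => Real.exp (-x) * Ein x)
        (Real.exp (-x) * (expSlope x - Ein x)) x := by
      intro x _
      have := ((hasDerivAt_neg x).exp).mul (hasDerivAt_Ein x)
      refine this.congr_deriv ?_
      ring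
    have hcont : Continuous fun x => Real.exp (-x) * (expSlope x - Ein x) := by
      have := continuous_Ein
      have := continuous_expSlope
      fun_prop
    have := intervalIntegral.integral_eq_sub_of_hasDerivAt hd (hcont.intervalIntegrable _ _)
    rw [intervalIntegral.integral_of_le hc0.le] at this
    rw [setIntegral_congr_fun (g := fun x => Real.exp (-x) * (expSlope x - Ein x))
      measurableSet_Ioc (fun x hx => by simp only [gainAvg_of_le hc hx.1 hx.2]), this, hc, Ein_zero]
    simp
  have h2 : ∫ x in Ioi c, Real.exp (-x) * gainAvg x =
      (Real.exp c - 1 - c) * ∫ x in Ioi (1 : ℝ), x⁻¹ * Real.exp (-c * x) := by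
    have := integral_comp_mul_left_Ioi (fun x => x⁻¹ * Real.exp (-x)) 1 hc0
    rw [setIntegral_congr_fun (g := fun x => (Real.exp c - 1 - c) * (x⁻¹ * Real.exp (-x)))
      measurableSet_Ioi (fun x hx => by
        simp only [gainAvg_of_ge hc0 hc (le_of_lt hx)]; ring), integral_const_mul]
    congr 1
    rw [mul_one, smul_eq_mul, inv_mul_eq_div, eq_div_iff hc0.ne'] at this
    rw [← this, mul_comm, ← integral_const_mul]
    refine setIntegral_congr_fun measurableSet_Ioi fun x hx => ?_
    have : x ≠ 0 := (zero_lt_one.trans hx).ne'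
    simp only [neg_mul]
    field_simp
  rw [limitValue, ← Ioc_union_Ioi_eq_Ioi hc0.le, setIntegral_union (Ioc_disjoint_Ioi le_rfl)
    measurableSet_Ioi (hI.mono_set Ioc_subset_Ioi_self)
    (hI.mono_set (Ioi_subset_Ioi hc0.le)), h1, h2, samuelsExpr]

end ROSp
namespace ROSp
open Set

/-! ### One-step look-ahead functions and thresholds -/

/-- The sum `∑_{j ≤ L} (x^{-j} - 1) / j`. -/
noncomputable def invPowSum (L : ℕ) (x : ℝ) : ℝ :=
  ∑ j ∈ Finset.range L, ((x⁻¹) ^ (j + 1) - 1) / (j + 1)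

/-- The function `-log t + ∑_{j ≤ k} (t^{-j} - 1) / j`. -/
noncomputable def lookahead (k : ℕ) (t : ℝ) : ℝ := -Real.log t + invPowSum k t

theorem invPowSum_zero (x : ℝ) : invPowSum 0 x = 0 := by simp [invPowSum]

theorem invPowSum_succ (L : ℕ) (x : ℝ) :
    invPowSum (L + 1) x = invPowSum L x + ((x⁻¹) ^ (L + 1) - 1) / (L + 1) := by
  simp [invPowSum, Finset.sum_range_succ]

theorem invPowSum_one (L : ℕ) : invPowSum L 1 = 0 := by simp [invPowSum]

theorem lookahead_one (k : ℕ) : lookahead k 1 = 0 := by simp [lookahead, invPowSum_one]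

theorem invPowSum_anti {L : ℕ} {x y : ℝ} (hx : 0 < x) (hxy : x ≤ y) :
    invPowSum L y ≤ invPowSum L x := by
  refine Finset.sum_le_sum fun j _ => ?_
  have : 0 < y := hx.trans_le hxy
  gcongr

theorem invPowSum_mono_left {L M : ℕ} (h : L ≤ M) {x : ℝ} (hx : 0 < x) (hx1 : x ≤ 1) :
    invPowSum L x ≤ invPowSum M x := by
  refine Finset.sum_le_sum_of_subset_of_nonneg (Finset.range_mono h) fun j _ _ => ?_
  have : (1 : ℝ) ≤ (x⁻¹) ^ (j + 1) := one_le_pow₀ ((one_le_inv₀ hx).2 hx1)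
  have : (0 : ℝ) ≤ (x⁻¹) ^ (j + 1) - 1 := by linarith
  positivity

theorem invPowSum_nonneg (L : ℕ) {x : ℝ} (hx : 0 < x) (hx1 : x ≤ 1) : 0 ≤ invPowSum L x := by
  simpa [invPowSum_zero] using invPowSum_mono_left (Nat.zero_le L) hx hx1

theorem lookahead_strictAnti (k : ℕ) {x y : ℝ} (hx : 0 < x) (hxy : x < y) :
    lookahead k y < lookahead k x := by
  have := Real.log_lt_log hx hxy
  have := invPowSum_anti (L := k) hx hxy.le
  unfold lookahead; linarith

theorem lookahead_strictMono {k l : ℕ} (h : k < l) {x : ℝ} (hx : 0 < x) (hx1 : x < 1) :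
    lookahead k x < lookahead l x := by
  have h1 := invPowSum_mono_left (show k + 1 ≤ l from h) hx hx1.le
  have h2 : (1 : ℝ) < (x⁻¹) ^ (k + 1) := one_lt_pow₀ ((one_lt_inv₀ hx).2 hx1) (by simp)
  have h3 : (0 : ℝ) < ((x⁻¹) ^ (k + 1) - 1) / (k + 1) := by
    have : (0 : ℝ) < (x⁻¹) ^ (k + 1) - 1 := by linarith
    positivity
  rw [invPowSum_succ] at h1
  unfold lookahead; linarith

theorem lookahead_nonneg (k : ℕ) {x : ℝ} (hx : 0 < x) (hx1 : x ≤ 1) : 0 ≤ lookahead k x := by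
  have := Real.log_nonpos hx.le hx1
  have := invPowSum_nonneg k hx hx1
  unfold lookahead; linarith

theorem le_lookahead (k : ℕ) {x : ℝ} (hx : 0 < x) (hx1 : x ≤ 1) :
    k * (x⁻¹ - 1) ≤ lookahead k x := by
  have h1 : (1 : ℝ) ≤ x⁻¹ := (one_le_inv₀ hx).2 hx1
  have h2 : (k : ℝ) * (x⁻¹ - 1) ≤ invPowSum k x := by
    have : ∀ j ∈ Finset.range k, x⁻¹ - 1 ≤ ((x⁻¹) ^ (j + 1) - 1) / ((j : ℝ) + 1) := by
      intro j _
      rw [le_div_iff₀ (by positivity)]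
      have := one_add_mul_le_pow (a := x⁻¹ - 1) (by linarith) (j + 1)
      push_cast at this
      rw [add_sub_cancel] at this
      linarith
    have := Finset.sum_le_sum this
    rwa [Finset.sum_const, Finset.card_range, nsmul_eq_mul] at this
  have := Real.log_nonpos hx.le hx1
  unfold lookahead; linarith

theorem hasDerivAt_lookahead (k : ℕ) {x : ℝ} (hx : 0 < x) :
    HasDerivAt (lookahead k) (-∑ l ∈ Finset.range (k + 1), (x⁻¹) ^ (l + 1)) x := by
  have hs : HasDerivAt (invPowSum k) (∑ l ∈ Finset.range k, -(x⁻¹) ^ (l + 2)) x := by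
    unfold invPowSum
    refine HasDerivAt.fun_sum fun l _ => ?_
    have := (((hasDerivAt_inv hx.ne').fun_pow (l + 1)).sub_const 1).div_const ((l : ℝ) + 1)
    refine this.congr_deriv ?_
    have : (l : ℝ) + 1 ≠ 0 := by positivity
    push_cast
    field_simp
    simp
    field_simp
    ring
  have := (Real.hasDerivAt_log hx.ne').neg.add hs
  refine this.congr_deriv ?_
  rw [Finset.sum_range_succ', Finset.sum_neg_distrib]
  simp

theorem continuousOn_lookahead (k : ℕ) : ContinuousOn (lookahead k) (Ioi 0) := fun _ hx =>
  (hasDerivAt_lookahead k hx).continuousAt.continuousWithinAt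

theorem exists_lookahead_eq_one (k : ℕ) : ∃ t : ℝ, 0 < t ∧ t < 1 ∧ lookahead k t = 1 := by
  have he : Real.exp (-1) ≤ 1 := Real.exp_le_one_iff.2 (by norm_num)
  have hb : 1 ≤ lookahead k (Real.exp (-1)) := by
    have := invPowSum_nonneg k (Real.exp_pos (-1)) he
    simp only [lookahead, Real.log_exp]; linarith
  obtain ⟨t, ht, h⟩ := intermediate_value_Icc' he
    ((continuousOn_lookahead k).mono fun s hs => (Real.exp_pos _).trans_le hs.1)
    (show (1 : ℝ) ∈ Icc (lookahead k 1) (lookahead k (Real.exp (-1))) from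
      ⟨by rw [lookahead_one]; norm_num, hb⟩)
  refine ⟨t, (Real.exp_pos _).trans_le ht.1, ht.2.lt_of_ne ?_, h⟩
  rintro rfl
  rw [lookahead_one] at h; norm_num at h

/-- The optimal thresholds. -/
noncomputable def threshold (k : ℕ) : ℝ := (exists_lookahead_eq_one k).choose

theorem threshold_pos (k : ℕ) : 0 < threshold k := (exists_lookahead_eq_one k).choose_spec.1

theorem threshold_lt_one (k : ℕ) : threshold k < 1 := (exists_lookahead_eq_one k).choose_spec.2.1

theorem lookahead_threshold (k : ℕ) : lookahead k (threshold k) = 1 :=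
  (exists_lookahead_eq_one k).choose_spec.2.2

theorem lookahead_le_one_iff (k : ℕ) {x : ℝ} (hx : 0 < x) :
    lookahead k x ≤ 1 ↔ threshold k ≤ x := by
  constructor
  · intro h
    by_contra! hlt
    have := lookahead_strictAnti k hx hlt
    rw [lookahead_threshold] at this; linarith
  · intro h
    rcases h.eq_or_lt with h | h
    · rw [← h, lookahead_threshold]
    · rw [← lookahead_threshold k]; exact (lookahead_strictAnti k (threshold_pos k) h).le

theorem threshold_strictMono : StrictMono threshold := by
  intro k l h
  by_contra! hle
  have h1 := lookahead_strictMono h (threshold_pos l) (threshold_lt_one l)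
  have h2 := (lookahead_le_one_iff l (threshold_pos k)).2 hle
  have h3 := lookahead_strictMono h (threshold_pos k) (threshold_lt_one k)
  rw [lookahead_threshold] at h3; linarith

theorem exists_lt_threshold {x : ℝ} (hx1 : x < 1) : ∃ k, x < threshold k := by
  rcases le_or_gt x 0 with hx | hx
  · exact ⟨0, hx.trans_lt (threshold_pos 0)⟩
  have h1 : 0 < x⁻¹ - 1 := by have := (one_lt_inv₀ hx).2 hx1; linarith
  obtain ⟨k, hk⟩ := exists_nat_gt (1 / (x⁻¹ - 1))
  refine ⟨k, ?_⟩
  by_contra! h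
  have h2 := (lookahead_le_one_iff k hx).2 h
  have h3 := le_lookahead k hx hx1.le
  rw [div_lt_iff₀ h1] at hk
  linarith

theorem isThresholdSeq_threshold : IsThresholdSeq threshold :=
  ⟨(threshold_pos 0).le, threshold_strictMono, threshold_lt_one⟩

/-- The positive part of `1 - lookahead k τ`, for `τ ≤ 1`, and `1` for `τ ≥ 1`. -/
noncomputable def gain (k : ℕ) (τ : ℝ) : ℝ := max (1 - lookahead k (min τ 1)) 0

theorem gain_nonneg (k : ℕ) (τ : ℝ) : 0 ≤ gain k τ := le_max_right _ _

theorem gain_le_one (k : ℕ) {τ : ℝ} (h : 0 < τ) : gain k τ ≤ 1 := by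
  refine max_le ?_ zero_le_one
  have := lookahead_nonneg k (lt_min h one_pos) (min_le_right τ 1)
  linarith

theorem gain_mono (k : ℕ) {σ τ : ℝ} (h : 0 < σ) (hστ : σ ≤ τ) : gain k σ ≤ gain k τ := by
  refine max_le_max_right _ (sub_le_sub_left ?_ _)
  rcases (min_le_min_right 1 hστ).eq_or_lt with h1 | h1
  · rw [h1]
  · exact (lookahead_strictAnti k (lt_min h one_pos) h1).le

theorem gain_of_threshold_le (k : ℕ) {τ : ℝ} (h : threshold k ≤ τ) (h1 : τ ≤ 1) :
    gain k τ = 1 - lookahead k τ := by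
  rw [gain, min_eq_left h1, max_eq_left]
  linarith [(lookahead_le_one_iff k ((threshold_pos k).trans_le h)).2 h]

theorem gain_of_le_threshold (k : ℕ) {τ : ℝ} (h0 : 0 < τ) (h : τ ≤ threshold k) :
    gain k τ = 0 := by
  rw [gain, min_eq_left (h.trans (threshold_lt_one k).le), max_eq_right]
  rcases h.eq_or_lt with rfl | h
  · rw [lookahead_threshold, sub_self]
  · have := lookahead_strictAnti k h0 h
    rw [lookahead_threshold] at this; linarith

theorem continuousOn_gain (k : ℕ) : ContinuousOn (gain k) (Ioi 0) := by
  have h : ContinuousOn (fun τ : ℝ => lookahead k (min τ 1)) (Ioi 0) :=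
    (continuousOn_lookahead k).comp (by fun_prop) fun τ hτ => mem_Ioi.2 (lt_min hτ one_pos)
  exact (continuousOn_const.sub h).sup continuousOn_const

end ROSp
namespace ROSp
open Set

/-! ### The value functions of the full-information problem -/

/-- The probability that exactly the first one of the values exceeding `x`, among `L` further
independent uniform values, is their maximum (and that there is such a value). -/
noncomputable def nextBest : ℕ → ℝ → ℝ
  | 0, _ => 0
  | L + 1, x => x * nextBest L x + (1 - x ^ (L + 1)) / (L + 1)

/-- The density of the expected sum of the one-step gains at the records with value `x`. -/
noncomputable def gainDensity : ℕ → ℝ → ℝ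
  | 0, _ => 0
  | L + 1, x => x * gainDensity L x + max (x ^ L - nextBest L x) 0

/-- The optimal probability of winning in the full-information problem, with `L` values still to
come, when the current maximum is `m`. -/
noncomputable def fullInfoDP (L : ℕ) (m : ℝ) : ℝ := ∫ x in m..1, gainDensity L x

theorem continuous_nextBest (L : ℕ) : Continuous (nextBest L) := by
  induction L with
  | zero => exact continuous_const
  | succ L ih =>
    change Continuous fun x => x * nextBest L x + (1 - x ^ (L + 1)) / ((L : ℝ) + 1)
    fun_prop

theorem continuous_gainDensity (L : ℕ) : Continuous (gainDensity L) := by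
  induction L with
  | zero => exact continuous_const
  | succ L ih =>
    have := continuous_nextBest L
    change Continuous fun x => x * gainDensity L x + max (x ^ L - nextBest L x) 0
    fun_prop

theorem gainDensity_nonneg (L : ℕ) {x : ℝ} (hx : 0 ≤ x) : 0 ≤ gainDensity L x := by
  induction L with
  | zero => exact le_rfl
  | succ L ih => exact add_nonneg (mul_nonneg hx ih) (le_max_right _ _)

theorem nextBest_one (L : ℕ) : nextBest L 1 = 0 := by
  induction L with
  | zero => rfl
  | succ L ih => simp [nextBest, ih]

theorem nextBest_eq (L : ℕ) {x : ℝ} (hx : 0 < x) : nextBest L x = x ^ L * invPowSum L x := by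
  induction L with
  | zero => simp [nextBest, invPowSum_zero]
  | succ L ih =>
    have h : x ^ (L + 1) * (x⁻¹) ^ (L + 1) = 1 := by
      rw [← mul_pow, mul_inv_cancel₀ hx.ne', one_pow]
    rw [nextBest, ih, invPowSum_succ, mul_add, mul_div_assoc', mul_sub, h]
    ring

theorem nextBest_le_pow_iff (L : ℕ) {x : ℝ} (hx : 0 < x) :
    nextBest L x ≤ x ^ L ↔ invPowSum L x ≤ 1 := by
  rw [nextBest_eq L hx]
  exact mul_le_iff_le_one_right (by positivity)

theorem gainDensity_eq (L : ℕ) {x : ℝ} (hx : 0 < x) :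
    gainDensity L x = x ^ (L - 1) * ∑ l ∈ Finset.range L, max (1 - invPowSum l x) 0 := by
  induction L with
  | zero => simp [gainDensity]
  | succ L ih =>
    have h : max (x ^ L - nextBest L x) 0 = x ^ L * max (1 - invPowSum L x) 0 := by
      rw [nextBest_eq L hx, mul_max_of_nonneg _ _ (by positivity)]; ring_nf
    rw [gainDensity, ih, h, Finset.sum_range_succ, mul_add, Nat.add_sub_cancel, ← mul_assoc]
    rcases L with _ | L
    · simp
    · rw [Nat.add_sub_cancel, ← pow_succ']

theorem hasDerivAt_nextBest (L : ℕ) {x : ℝ} (hx : 0 < x) (hx1 : x ≤ 1) (h : invPowSum L x ≤ 1) :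
    HasDerivAt (nextBest L) (-gainDensity L x) x := by
  induction L with
  | zero =>
    change HasDerivAt (fun _ => (0 : ℝ)) (-0) x
    rw [neg_zero]; exact hasDerivAt_const x 0
  | succ L ih =>
    have hL : invPowSum L x ≤ 1 := (invPowSum_mono_left (Nat.le_succ L) hx hx1).trans h
    have h1 := ((hasDerivAt_id x).mul (ih hL)).add
      (((hasDerivAt_pow (L + 1) x).const_sub 1).div_const ((L : ℝ) + 1))
    refine h1.congr_deriv ?_
    have h2 := (nextBest_le_pow_iff L hx).2 hL
    rw [gainDensity, max_eq_left (by linarith)]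
    have : (L : ℝ) + 1 ≠ 0 := by positivity
    simp only [id, Nat.add_sub_cancel]
    push_cast
    field_simp
    ring

theorem hasDerivAt_fullInfoDP (L : ℕ) (m : ℝ) :
    HasDerivAt (fullInfoDP L) (-gainDensity L m) m :=
  intervalIntegral.integral_hasDerivAt_left ((continuous_gainDensity L).intervalIntegrable _ _)
    ((continuous_gainDensity L).stronglyMeasurableAtFilter _ _)
    (continuous_gainDensity L).continuousAt

theorem continuous_fullInfoDP (L : ℕ) : Continuous (fullInfoDP L) :=
  continuous_iff_continuousAt.2 fun m => (hasDerivAt_fullInfoDP L m).continuousAt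

theorem fullInfoDP_one (L : ℕ) : fullInfoDP L 1 = 0 := by simp [fullInfoDP]

theorem fullInfoDP_zero (m : ℝ) : fullInfoDP 0 m = 0 := by simp [fullInfoDP, gainDensity]

theorem fullInfoDP_anti (L : ℕ) {x y : ℝ} (hx : 0 ≤ x) (hxy : x ≤ y) :
    fullInfoDP L y ≤ fullInfoDP L x := by
  have hi := fun a b => (continuous_gainDensity L).intervalIntegrable (μ := volume) a b
  have h := intervalIntegral.integral_add_adjacent_intervals (hi x y) (hi y 1)
  have h2 : 0 ≤ ∫ u in x..y, gainDensity L u :=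
    intervalIntegral.integral_nonneg hxy fun u hu => gainDensity_nonneg L (hx.trans hu.1)
  unfold fullInfoDP; linarith

theorem fullInfoDP_nonneg (L : ℕ) {x : ℝ} (hx : 0 ≤ x) (hx1 : x ≤ 1) : 0 ≤ fullInfoDP L x :=
  (fullInfoDP_one L).symm.le.trans (fullInfoDP_anti L hx hx1)

theorem fullInfoDP_of_nextBest_le {L : ℕ} {x : ℝ} (hx : 0 ≤ x) (hx1 : x ≤ 1)
    (h : nextBest L x ≤ x ^ L) : fullInfoDP L x = nextBest L x := by
  rcases hx.eq_or_lt with rfl | hx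
  · rcases L with _ | L
    · rw [fullInfoDP_zero, nextBest]
    · simp only [nextBest, zero_mul, ne_eq, Nat.add_eq_zero_iff, one_ne_zero, and_false,
        not_false_eq_true, zero_pow, sub_zero, zero_add] at h
      have : (0 : ℝ) < 1 / ((L : ℝ) + 1) := by positivity
      linarith
  · rw [nextBest_le_pow_iff L hx] at h
    have h1 : ∫ u in x..1, -gainDensity L u = nextBest L 1 - nextBest L x := by
      refine intervalIntegral.integral_eq_sub_of_hasDerivAt (fun u hu => ?_)
        ((continuous_gainDensity L).neg.intervalIntegrable _ _)
      rw [uIcc_of_le hx1] at hu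
      exact hasDerivAt_nextBest L (hx.trans_le hu.1) hu.2 ((invPowSum_anti hx hu.1).trans h)
    rw [intervalIntegral.integral_neg, nextBest_one] at h1
    rw [fullInfoDP]; linarith

theorem pow_le_fullInfoDP {L : ℕ} {x : ℝ} (hx : 0 ≤ x) (hx1 : x ≤ 1)
    (h : x ^ L ≤ nextBest L x) : x ^ L ≤ fullInfoDP L x := by
  have hc : ContinuousOn (fun u => u ^ L - nextBest L u) (Icc x 1) := by
    have := continuous_nextBest L
    fun_prop
  obtain ⟨d, hd, hd0⟩ := intermediate_value_Icc hx1 hc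
    (show (0 : ℝ) ∈ Icc (x ^ L - nextBest L x) (1 ^ L - nextBest L 1) from
      ⟨by linarith, by rw [nextBest_one]; norm_num⟩)
  have hd0 : d ^ L - nextBest L d = 0 := hd0
  have h1 := fullInfoDP_of_nextBest_le (hx.trans hd.1) hd.2 (by linarith)
  have h2 := fullInfoDP_anti L hx hd.1
  have h3 := pow_le_pow_left₀ hx hd.1 L
  linarith

theorem fullInfoDP_add_eq_max {L : ℕ} {x : ℝ} (hx : 0 ≤ x) (hx1 : x ≤ 1) :
    fullInfoDP L x + max (x ^ L - nextBest L x) 0 = max (x ^ L) (fullInfoDP L x) := by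
  rcases le_total (nextBest L x) (x ^ L) with h | h
  · rw [fullInfoDP_of_nextBest_le hx hx1 h, max_eq_left (by linarith), max_eq_left h]; ring
  · rw [max_eq_right (by linarith), max_eq_right (pow_le_fullInfoDP hx hx1 h), add_zero]

theorem fullInfoDP_succ (L : ℕ) {m : ℝ} (hm : 0 ≤ m) (hm1 : m ≤ 1) :
    fullInfoDP (L + 1) m =
      m * fullInfoDP L m + ∫ x in m..1, max (x ^ L) (fullInfoDP L x) := by
  have hg := continuous_gainDensity L
  have hF := continuous_fullInfoDP L
  have hn := continuous_nextBest L
  have h1 : ∫ x in m..1, (fullInfoDP L x + x * -gainDensity L x) =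
      1 * fullInfoDP L 1 - m * fullInfoDP L m := by
    refine intervalIntegral.integral_eq_sub_of_hasDerivAt (f := fun x => x * fullInfoDP L x)
      (fun x _ => ?_) (Continuous.intervalIntegrable (by fun_prop) _ _)
    have := (hasDerivAt_id x).mul (hasDerivAt_fullInfoDP L x)
    exact this.congr_deriv (by simp)
  have h2 : ∫ x in m..1, max (x ^ L) (fullInfoDP L x) =
      ∫ x in m..1, (fullInfoDP L x + x * -gainDensity L x) + gainDensity (L + 1) x := by
    refine intervalIntegral.integral_congr fun x hx => ?_
    rw [uIcc_of_le hm1] at hx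
    simp only [gainDensity]
    rw [← fullInfoDP_add_eq_max (hm.trans hx.1) hx.2]; ring
  rw [h2, intervalIntegral.integral_add, h1, fullInfoDP_one]
  · simp [fullInfoDP]
  · exact Continuous.intervalIntegrable (by fun_prop) _ _
  · exact (continuous_gainDensity _).intervalIntegrable _ _

end ROSp
namespace ROSp
open Set
open scoped unitInterval

/-! ### Integration over the unit cube -/

theorem volume_eq_lintegral_insertNth {n : ℕ} (i : Fin (n + 1)) {s : Set (Fin (n + 1) → I)}
    (hs : MeasurableSet s) :
    volume s = ∫⁻ a : I, volume {y : Fin n → I | i.insertNth a y ∈ s} := by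
  have h := (volume_preserving_piFinSuccAbove (fun _ : Fin (n + 1) => I) i).symm
  rw [← h.measure_preimage hs.nullMeasurableSet, Measure.volume_eq_prod, Measure.prod_apply
    ((MeasurableEquiv.measurable _) hs)]
  rfl

theorem measurable_insertNth {n : ℕ} (i : Fin (n + 1)) (a : I) :
    Measurable fun y : Fin n → I => (i.insertNth a y : Fin (n + 1) → I) :=
  (MeasurableEquiv.piFinSuccAbove (fun _ : Fin (n + 1) => I) i).symm.measurable.comp
    measurable_prodMk_left

theorem lintegral_unitInterval (g : ℝ → ENNReal) :
    ∫⁻ a : I, g a = ∫⁻ x in Icc (0 : ℝ) 1, g x :=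
  lintegral_subtype_comap measurableSet_Icc g

theorem lintegral_unitInterval_ofReal {g : ℝ → ℝ} (hg : IntervalIntegrable g volume 0 1)
    (h0 : ∀ x ∈ Icc (0 : ℝ) 1, 0 ≤ g x) :
    ∫⁻ a : I, ENNReal.ofReal (g a) = ENNReal.ofReal (∫ x in (0 : ℝ)..1, g x) := by
  rw [lintegral_unitInterval (fun x => ENNReal.ofReal (g x)),
    intervalIntegral.integral_of_le zero_le_one, ← integral_Icc_eq_integral_Ioc,
    ofReal_integral_eq_lintegral_ofReal]
  · rwa [intervalIntegrable_iff_integrableOn_Icc_of_le zero_le_one] at hg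
  · exact (ae_restrict_iff' measurableSet_Icc).2 (Filter.Eventually.of_forall h0)

theorem integral_ite_lt {m A : ℝ} (hm : 0 ≤ m) (hm1 : m ≤ 1) {B : ℝ → ℝ} (hB : Continuous B) :
    IntervalIntegrable (fun x => if x < m then A else B x) volume 0 1 ∧
    ∫ x in (0 : ℝ)..1, (if x < m then A else B x) = m * A + ∫ x in m..1, B x := by
  have e1 : ∀ x ∈ uIoo 0 m, A = if x < m then A else B x := fun x hx => by
    rw [uIoo_of_le hm] at hx; exact (if_pos hx.2).symm
  have e2 : ∀ x ∈ uIoc m 1, B x = if x < m then A else B x := fun x hx => by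
    rw [uIoc_of_le hm1] at hx; exact (if_neg (not_lt.2 hx.1.le)).symm
  have i1 : IntervalIntegrable (fun x => if x < m then A else B x) volume 0 m :=
    (intervalIntegrable_const (c := A)).congr_uIoo e1
  have i2 : IntervalIntegrable (fun x => if x < m then A else B x) volume m 1 :=
    (hB.intervalIntegrable m 1).congr e2
  refine ⟨i1.trans i2, ?_⟩
  rw [← intervalIntegral.integral_add_adjacent_intervals i1 i2]
  congr 1
  · rw [← intervalIntegral.integral_congr_uIoo e1]; simp
  · exact (intervalIntegral.integral_congr_ae (Filter.Eventually.of_forall e2)).symm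

theorem volume_forall_le {n : ℕ} (a : I) :
    volume {y : Fin n → I | ∀ j, y j ≤ a} = ENNReal.ofReal ((a : ℝ) ^ n) := by
  have : {y : Fin n → I | ∀ j, y j ≤ a} = univ.pi fun _ => Iic a := by
    ext; simp [Pi.le_def]
  rw [this, volume_pi_pi]
  simp [ENNReal.ofReal_pow a.2.1]

/-! ### The full-information problem -/

/-- The event that a stopping rule, given by the events `E i` of stopping at time `i`, stops at the
maximum, and that this maximum is at least `m`. -/
def maxChosen {n : ℕ} (E : Fin n → Set (Fin n → I)) (m : I) : Set (Fin n → I) :=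
  {x | ∃ i, x ∈ E i ∧ m ≤ x i ∧ ∀ j, x j ≤ x i}

theorem measurableSet_maxChosen {n : ℕ} {E : Fin n → Set (Fin n → I)}
    (hE : ∀ i, MeasurableSet (E i)) (m : I) : MeasurableSet (maxChosen E m) := by
  have : maxChosen E m = ⋃ i, E i ∩ ({x | m ≤ x i} ∩ ⋂ j, {x | x j ≤ x i}) := by
    ext; simp [maxChosen]
  rw [this]
  refine MeasurableSet.iUnion fun i => (hE i).inter (MeasurableSet.inter ?_ ?_)
  · exact measurableSet_le measurable_const (measurable_pi_apply i)
  · exact MeasurableSet.iInter fun j =>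
      measurableSet_le (measurable_pi_apply j) (measurable_pi_apply i)

/-- The continuation of a stopping rule after the first value `a`. -/
def ruleTail {n : ℕ} (E : Fin (n + 1) → Set (Fin (n + 1) → I)) (a : I) (i : Fin n) :
    Set (Fin n → I) := {y | (0 : Fin (n + 1)).insertNth a y ∈ E i.succ}

theorem insertNth_mem_maxChosen_iff {n : ℕ} {E : Fin (n + 1) → Set (Fin (n + 1) → I)} {m a : I}
    {y : Fin n → I} (h0 : (0 : Fin (n + 1)).insertNth a y ∉ E 0) :
    (0 : Fin (n + 1)).insertNth a y ∈ maxChosen E m ↔ y ∈ maxChosen (ruleTail E a) (max m a) := by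
  rw [Fin.insertNth_zero'] at h0 ⊢
  simp only [maxChosen, ruleTail, mem_ofPred_eq, Fin.exists_fin_succ, h0, false_and, false_or,
    Fin.insertNth_zero', Fin.forall_fin_succ, Fin.cons_zero, Fin.cons_succ, max_le_iff]
  exact exists_congr fun i => by tauto

theorem insertNth_mem_maxChosen_iff' {n : ℕ} {E : Fin (n + 1) → Set (Fin (n + 1) → I)} {m a : I}
    {y : Fin n → I} (h0 : (0 : Fin (n + 1)).insertNth a y ∈ E 0)
    (hd : ∀ x i j, x ∈ E i → x ∈ E j → i = j) :
    (0 : Fin (n + 1)).insertNth a y ∈ maxChosen E m ↔ m ≤ a ∧ ∀ j, y j ≤ a := by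
  have : ∀ i : Fin n, (0 : Fin (n + 1)).insertNth a y ∉ E i.succ := fun i hi =>
    (Fin.succ_ne_zero i) (hd _ _ _ hi h0)
  rw [Fin.insertNth_zero'] at this h0
  simp [maxChosen, Fin.exists_fin_succ, this, h0, Fin.forall_fin_succ]

theorem volume_maxChosen_le {n : ℕ} (E : Fin n → Set (Fin n → I))
    (hE : ∀ i, MeasurableSet (E i)) (hdep : ∀ i, ∀ x ∈ E i, ∀ y, (∀ j ≤ i, x j = y j) → y ∈ E i)
    (hd : ∀ x i j, x ∈ E i → x ∈ E j → i = j) (m : I) :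
    volume (maxChosen E m) ≤ ENNReal.ofReal (fullInfoDP n m) := by
  induction n generalizing m with
  | zero =>
    have : maxChosen E m = ∅ := by ext x; simp [maxChosen]
    simp [this]
  | succ n ih =>
    rw [volume_eq_lintegral_insertNth 0 (measurableSet_maxChosen hE m)]
    have hB : Continuous fun x => max (x ^ n) (fullInfoDP n x) := by
      have := continuous_fullInfoDP n
      fun_prop
    obtain ⟨hi, he⟩ := integral_ite_lt (A := fullInfoDP n m) m.2.1 m.2.2 hB
    rw [fullInfoDP_succ n m.2.1 m.2.2, ← he, ← lintegral_unitInterval_ofReal hi ?_]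
    swap
    · intro x hx
      split_ifs
      · exact fullInfoDP_nonneg n m.2.1 m.2.2
      · exact (pow_nonneg hx.1 n).trans (le_max_left _ _)
    refine lintegral_mono fun a => ?_
    by_cases h0 : ∃ y : Fin n → I, (0 : Fin (n + 1)).insertNth a y ∈ E 0
    · obtain ⟨y0, hy0⟩ := h0
      have h0 : ∀ y : Fin n → I, (0 : Fin (n + 1)).insertNth a y ∈ E 0 := fun y =>
        hdep 0 _ hy0 _ fun j hj => by
          rw [Fin.le_zero_iff.1 hj, Fin.insertNth_apply_same, Fin.insertNth_apply_same]
      simp only [insertNth_mem_maxChosen_iff' (h0 _) hd]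
      split_ifs with h
      · have : ¬ m ≤ a := not_le.2 h
        simp [this]
      · have : m ≤ a := not_lt.1 h
        simp only [this, true_and, volume_forall_le]
        exact ENNReal.ofReal_le_ofReal (le_max_left _ _)
    · push Not at h0
      simp only [insertNth_mem_maxChosen_iff (h0 _)]
      have := ih (ruleTail E a) (fun i => measurable_insertNth 0 a (hE _))
        (fun i y hy z hz => hdep _ _ hy _ fun j hj => by
          rw [Fin.insertNth_zero']
          refine Fin.cases ?_ (fun j hj => ?_) j hj
          · intro; rfl
          · simpa using hz j (Fin.succ_le_succ_iff.1 hj))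
        (fun y i j hi hj => Fin.succ_injective _ (hd _ _ _ hi hj)) (max m a)
      refine this.trans (ENNReal.ofReal_le_ofReal ?_)
      split_ifs with h
      · rw [max_eq_left (show a ≤ m from le_of_lt h)]
      · rw [max_eq_right (show m ≤ a from not_lt.1 h)]; exact le_max_right _ _

/-- The condition of the optimal rule for accepting the value with index `i`. -/
def OptAccept {n : ℕ} (m : I) (x : Fin n → I) (i : Fin n) : Prop :=
  m ≤ x i ∧ (∀ j < i, x j ≤ x i) ∧ nextBest (n - 1 - i) (x i) ≤ (x i : ℝ) ^ (n - 1 - (i : ℕ))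

/-- The events of the optimal rule. -/
def optRule (n : ℕ) (m : I) (i : Fin n) : Set (Fin n → I) :=
  {x | OptAccept m x i ∧ ∀ j < i, ¬ OptAccept m x j}

theorem measurableSet_optAccept {n : ℕ} (m : I) (i : Fin n) :
    MeasurableSet {x | OptAccept m x i} := by
  have h0 : MeasurableSet {x : Fin n → I | m ≤ x i} :=
    measurableSet_le measurable_const (measurable_pi_apply i)
  refine h0.inter (MeasurableSet.inter ?_ ?_)
  · have : {x : Fin n → I | ∀ j < i, x j ≤ x i} = ⋂ j, ⋂ (_ : j < i), {x | x j ≤ x i} := by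
      ext; simp
    change MeasurableSet {x : Fin n → I | ∀ j < i, x j ≤ x i}
    rw [this]
    exact MeasurableSet.iInter fun j => MeasurableSet.iInter fun _ =>
      measurableSet_le (measurable_pi_apply j) (measurable_pi_apply i)
  · have h := (measurable_subtype_coe (p := (· ∈ Icc (0 : ℝ) 1))).comp
      (measurable_pi_apply (X := fun _ : Fin n => I) i)
    exact measurableSet_le ((continuous_nextBest _).measurable.comp h) (h.pow_const _)

theorem measurableSet_optRule {n : ℕ} (m : I) (i : Fin n) : MeasurableSet (optRule n m i) := by
  have : optRule n m i = {x | OptAccept m x i} ∩ ⋂ j, ⋂ (_ : j < i), {x | OptAccept m x j}ᶜ := by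
    ext; simp [optRule]
  rw [this]
  exact (measurableSet_optAccept m i).inter (MeasurableSet.iInter fun j =>
    MeasurableSet.iInter fun _ => (measurableSet_optAccept m j).compl)

theorem optAccept_congr {n : ℕ} {m : I} {x y : Fin n → I} {i : Fin n} (h : ∀ j ≤ i, x j = y j) :
    OptAccept m x i ↔ OptAccept m y i := by
  unfold OptAccept
  rw [h i le_rfl]
  refine and_congr_right fun _ => and_congr_left fun _ => forall_congr' fun j => ?_
  refine imp_congr_right fun hj => ?_
  rw [h j hj.le]

theorem optRule_congr {n : ℕ} {m : I} {x y : Fin n → I} {i : Fin n} (h : ∀ j ≤ i, x j = y j) :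
    x ∈ optRule n m i ↔ y ∈ optRule n m i := by
  refine and_congr (optAccept_congr h) (forall_congr' fun j => imp_congr_right fun hj =>
    not_congr (optAccept_congr fun k hk => h k (hk.trans hj.le)))

theorem optRule_disjoint {n : ℕ} (m : I) (x : Fin n → I) (i j : Fin n)
    (hi : x ∈ optRule n m i) (hj : x ∈ optRule n m j) : i = j := by
  rcases lt_trichotomy i j with h | h | h
  · exact absurd hi.1 (hj.2 i h)
  · exact h
  · exact absurd hj.1 (hi.2 j h)

theorem optAccept_insertNth_succ {n : ℕ} {m a : I} {y : Fin n → I} {i : Fin n} :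
    OptAccept m ((0 : Fin (n + 1)).insertNth a y : Fin (n + 1) → I) i.succ ↔
      OptAccept (max m a) y i := by
  have h : n + 1 - 1 - (i.succ : ℕ) = n - 1 - i := by simp; omega
  simp only [OptAccept, Fin.insertNth_zero', Fin.cons_succ, Fin.forall_fin_succ, Fin.cons_zero,
    Fin.succ_lt_succ_iff, Fin.succ_pos, forall_true_left, max_le_iff, h]
  tauto

theorem le_volume_maxChosen_optRule {n : ℕ} (m : I) :
    ENNReal.ofReal (fullInfoDP n m) ≤ volume (maxChosen (optRule n m) m) := by
  induction n generalizing m with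
  | zero => simp [fullInfoDP_zero]
  | succ n ih =>
    rw [volume_eq_lintegral_insertNth 0 (measurableSet_maxChosen (measurableSet_optRule m) m)]
    have hB : Continuous fun x => max (x ^ n) (fullInfoDP n x) := by
      have := continuous_fullInfoDP n
      fun_prop
    obtain ⟨hi, he⟩ := integral_ite_lt (A := fullInfoDP n m) m.2.1 m.2.2 hB
    rw [fullInfoDP_succ n m.2.1 m.2.2, ← he, ← lintegral_unitInterval_ofReal hi ?_]
    swap
    · intro x hx
      split_ifs
      · exact fullInfoDP_nonneg n m.2.1 m.2.2
      · exact (pow_nonneg hx.1 n).trans (le_max_left _ _)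
    refine lintegral_mono fun a => ?_
    have hacc : ∀ y : Fin n → I, (0 : Fin (n + 1)).insertNth a y ∈ optRule (n + 1) m 0 ↔
        m ≤ a ∧ nextBest n a ≤ (a : ℝ) ^ n := fun y => by
      simp [optRule, OptAccept]
    by_cases h0 : m ≤ a ∧ nextBest n a ≤ (a : ℝ) ^ n
    · simp only [insertNth_mem_maxChosen_iff' ((hacc _).2 h0) (optRule_disjoint m), h0.1, true_and,
        volume_forall_le]
      refine ENNReal.ofReal_le_ofReal ?_
      rw [if_neg (not_lt.2 (show (m : ℝ) ≤ a from h0.1)),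
        fullInfoDP_of_nextBest_le a.2.1 a.2.2 h0.2, max_eq_left h0.2]
    · simp only [insertNth_mem_maxChosen_iff (fun h => h0 ((hacc _).1 h))]
      have ht : ruleTail (optRule (n + 1) m) a = optRule n (max m a) := by
        funext i
        ext y
        have hn : ¬ OptAccept m ((0 : Fin (n + 1)).insertNth a y : Fin (n + 1) → I) 0 := by
          intro h
          exact h0 ((hacc y).1 ⟨h, by simp⟩)
        simp only [ruleTail, optRule, mem_ofPred_eq, Fin.forall_fin_succ,
          optAccept_insertNth_succ, hn, Fin.succ_lt_succ_iff]
        simp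
      rw [ht]
      refine le_trans (ENNReal.ofReal_le_ofReal ?_) (ih (max m a))
      split_ifs with h
      · rw [max_eq_left (show a ≤ m from le_of_lt h)]
      · have hma : m ≤ a := not_lt.1 h
        rw [max_eq_right hma]
        have : ¬ nextBest n a ≤ (a : ℝ) ^ n := fun h' => h0 ⟨hma, h'⟩
        exact max_le (pow_le_fullInfoDP a.2.1 a.2.2 (le_of_not_ge this)) le_rfl

theorem measurableSet_piLE_of_dependsOn {n : ℕ} {i : Fin n} {s : Set (Fin n → I)}
    (hs : MeasurableSet s) (h : ∀ x ∈ s, ∀ y, (∀ j ≤ i, x j = y j) → y ∈ s) :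
    MeasurableSet[Filtration.piLE (X := fun _ : Fin n => I) i] s := by
  classical
  let r : (Iic i → I) → (Fin n → I) := fun z j => if hj : j ≤ i then z ⟨j, hj⟩ else 0
  have hr : Measurable r := by
    refine measurable_pi_lambda _ fun j => ?_
    by_cases hj : j ≤ i
    · simp only [r, hj, dif_pos]; exact measurable_pi_apply _
    · simp only [r, hj, dif_neg, not_false_eq_true]; exact measurable_const
  refine ⟨r ⁻¹' s, hr hs, ?_⟩
  ext x
  have hx : ∀ j ≤ i, r (Preorder.restrictLe i x) j = x j := fun j hj => by
    simp [r, hj, Preorder.restrictLe]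
  exact ⟨fun h1 => h _ h1 _ hx, fun h1 => h _ h1 _ fun j hj => (hx j hj).symm⟩

theorem dependsOn_of_measurableSet_piLE {n : ℕ} {i : Fin n} {s : Set (Fin n → I)}
    (h : MeasurableSet[Filtration.piLE (X := fun _ : Fin n => I) i] s) :
    ∀ x ∈ s, ∀ y, (∀ j ≤ i, x j = y j) → y ∈ s := by
  obtain ⟨s', -, rfl⟩ := h
  intro x hx y hxy
  have : Preorder.restrictLe (π := fun _ : Fin n => I) i x = Preorder.restrictLe i y := by
    funext j; exact hxy j j.2
  change Preorder.restrictLe i y ∈ s'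
  rw [← this]; exact hx

theorem fullInfoValue_eq (n : ℕ) : fullInfoValue n = fullInfoDP n 0 := by
  have hnn := fullInfoDP_nonneg n le_rfl (zero_le_one (α := ℝ))
  have hz : ((0 : I) : ℝ) = 0 := rfl
  have hup : ∀ T : {T : (Fin n → I) → WithTop (Fin n) //
      IsStoppingTime (Filtration.piLE (X := fun _ : Fin n => I)) T},
      (volume : Measure (Fin n → I)).real
        {x | ∃ i : Fin n, T.1 x = (i : WithTop (Fin n)) ∧ ∀ j, x j ≤ x i} ≤ fullInfoDP n 0 := by
    rintro ⟨T, hT⟩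
    have hEm : ∀ i, MeasurableSet[Filtration.piLE (X := fun _ : Fin n => I) i]
        {x | T x = (i : WithTop (Fin n))} := fun i => by
      exact hT.measurableSet_eq i
    have h := volume_maxChosen_le (fun i => {x | T x = (i : WithTop (Fin n))})
      (fun i => Filtration.le _ i _ (hEm i)) (fun i => dependsOn_of_measurableSet_piLE (hEm i))
      (fun x i j hi hj => WithTop.coe_injective (hi.symm.trans hj)) 0
    refine ENNReal.toReal_le_of_le_ofReal hnn (le_trans (measure_mono ?_) h)
    rintro x ⟨i, h1, h2⟩
    exact ⟨i, h1, unitInterval.nonneg', h2⟩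
  refine le_antisymm (Real.iSup_le hup hnn) ?_
  classical
  let T : (Fin n → I) → WithTop (Fin n) := fun x =>
    if h : ∃ i, x ∈ optRule n 0 i then (h.choose : WithTop (Fin n)) else ⊤
  have hTeq : ∀ x i, x ∈ optRule n 0 i → T x = (i : WithTop (Fin n)) := fun x i hi => by
    have h : ∃ i, x ∈ optRule n 0 i := ⟨i, hi⟩
    simp only [T, dif_pos h]
    rw [optRule_disjoint 0 x _ _ h.choose_spec hi]
  have hT : IsStoppingTime (Filtration.piLE (X := fun _ : Fin n => I)) T := by
    intro i
    have hset : {x | T x ≤ (i : WithTop (Fin n))} = ⋃ j, ⋃ (_ : j ≤ i), optRule n 0 j := by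
      ext x
      simp only [mem_ofPred_eq, mem_iUnion, exists_prop]
      constructor
      · intro h
        by_cases hx : ∃ i, x ∈ optRule n 0 i
        · obtain ⟨j, hj⟩ := hx
          rw [hTeq x j hj, WithTop.coe_le_coe] at h
          exact ⟨j, h, hj⟩
        · simp [T, dif_neg hx] at h
      · rintro ⟨j, hji, hj⟩
        rw [hTeq x j hj, WithTop.coe_le_coe]
        exact hji
    rw [hset]
    refine MeasurableSet.iUnion fun j => MeasurableSet.iUnion fun hj => ?_
    exact measurableSet_piLE_of_dependsOn (measurableSet_optRule 0 j) fun x hx y hxy =>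
      (optRule_congr fun k hk => hxy k (hk.trans hj)).1 hx
  have hlow := le_volume_maxChosen_optRule (n := n) 0
  rw [hz] at hlow
  refine le_trans ?_ (le_ciSup ⟨fullInfoDP n 0, by rintro _ ⟨T, rfl⟩; exact hup T⟩ ⟨T, hT⟩)
  refine (ENNReal.ofReal_le_iff_le_toReal (measure_ne_top _ _)).1 (hlow.trans (measure_mono ?_))
  rintro x ⟨i, h1, -, h2⟩
  exact ⟨i, hTeq x i h1, h2⟩

end ROSp
namespace ROSp
open Set

/-! ### The limit of the full-information problem -/

theorem Ein_sub_le {a b : ℝ} (ha : 0 ≤ a) (hab : a ≤ b) :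
    Ein b - Ein a ≤ (b - a) * expSlope b := by
  rw [Ein_sub]
  have h : ∫ u in a..b, expSlope u ≤ ∫ _ in a..b, expSlope b :=
    intervalIntegral.integral_mono_on hab (continuous_expSlope.intervalIntegrable _ _) (by simp)
      fun u hu => monotoneOn_expSlope (ha.trans hu.1) (ha.trans hab) hu.2
  simpa using h

theorem le_Ein_sub {a b : ℝ} (ha : 0 ≤ a) (hab : a ≤ b) :
    (b - a) * expSlope a ≤ Ein b - Ein a := by
  rw [Ein_sub]
  have h : ∫ _ in a..b, expSlope a ≤ ∫ u in a..b, expSlope u :=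
    intervalIntegral.integral_mono_on hab (by simp) (continuous_expSlope.intervalIntegrable _ _)
      fun u hu => monotoneOn_expSlope ha (ha.trans hu.1) hu.1
  simpa using h

theorem invPowSum_exp_neg_succ (L : ℕ) (y : ℝ) :
    invPowSum (L + 1) (Real.exp (-y)) =
      invPowSum L (Real.exp (-y)) + y * expSlope (y * (L + 1 : ℕ)) := by
  have h1 : (L : ℝ) + 1 ≠ 0 := by positivity
  have h2 := mul_expSlope (y * (L + 1 : ℕ))
  rw [invPowSum_succ, Real.exp_neg, inv_inv, ← Real.exp_nat_mul, mul_comm _ y, ← h2]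
  push_cast
  field_simp

theorem Ein_le_invPowSum (L : ℕ) {y : ℝ} (hy : 0 ≤ y) :
    Ein (y * L) ≤ invPowSum L (Real.exp (-y)) := by
  induction L with
  | zero => simp [Ein_zero, invPowSum_zero]
  | succ L ih =>
    rw [invPowSum_exp_neg_succ]
    have h := Ein_sub_le (a := y * L) (b := y * (L + 1 : ℕ)) (by positivity) (by gcongr; simp)
    have : y * ((L + 1 : ℕ) : ℝ) - y * L = y := by push_cast; ring
    rw [this] at h; linarith

theorem invPowSum_le_Ein_add (L : ℕ) {y : ℝ} (hy : 0 ≤ y) :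
    invPowSum L (Real.exp (-y)) ≤ Ein (y * L) + (y * expSlope (y * L) - y) := by
  induction L with
  | zero => simp [Ein_zero, invPowSum_zero, expSlope_zero]
  | succ L ih =>
    rw [invPowSum_exp_neg_succ]
    have h := le_Ein_sub (a := y * L) (b := y * (L + 1 : ℕ)) (by positivity) (by gcongr; simp)
    have : y * ((L + 1 : ℕ) : ℝ) - y * L = y := by push_cast; ring
    rw [this] at h; linarith

theorem continuous_posPart_one_sub_Ein_mul (y : ℝ) :
    Continuous fun l => max (1 - Ein (y * l)) 0 :=
  continuous_posPart_one_sub_Ein.comp (continuous_const.mul continuous_id)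

theorem antitoneOn_posPart {y : ℝ} (hy : 0 ≤ y) :
    AntitoneOn (fun l => max (1 - Ein (y * l)) 0) (Ici 0) := fun _ ha _ _ hab =>
  max_le_max_right _ (sub_le_sub_left (Ein_mono (mul_nonneg hy ha)
    (mul_le_mul_of_nonneg_left hab hy)) _)

theorem integral_posPart_eq (y a : ℝ) :
    ∫ l in (0 : ℝ)..a, max (1 - Ein (y * l)) 0 = a * gainAvg (y * a) := by
  rw [gainAvg]
  have := intervalIntegral.mul_integral_comp_mul_left (a := 0) (b := 1) (c := a)
    (f := fun l => max (1 - Ein (y * l)) 0)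
  simp only [mul_zero, mul_one] at this
  rw [← this]
  simp only [mul_assoc]

theorem integral_posPart_le {a b c y : ℝ} (hy : 0 ≤ y) (ha : 0 ≤ a) (hab : a ≤ b)
    (hc : Ein c = 1) (hb : y * b ≤ c) :
    ∫ l in a..b, max (1 - Ein (y * l)) 0 ≤
      (b - a) * (1 - Ein (y * a)) - (b - a) ^ 2 / 2 * (y * expSlope (y * a)) := by
  have h : ∫ l in a..b, (1 - Ein (y * a) - (l - a) * (y * expSlope (y * a))) =
      (b - a) * (1 - Ein (y * a)) - (b - a) ^ 2 / 2 * (y * expSlope (y * a)) := by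
    rw [intervalIntegral.integral_sub (by simp) (Continuous.intervalIntegrable (by fun_prop) _ _),
      intervalIntegral.integral_const, intervalIntegral.integral_mul_const,
      intervalIntegral.integral_sub (by simp) (by simp), integral_id,
      intervalIntegral.integral_const]
    simp only [smul_eq_mul]; ring
  rw [← h]
  refine intervalIntegral.integral_mono_on hab
    ((continuous_posPart_one_sub_Ein_mul y).intervalIntegrable _ _)
    (Continuous.intervalIntegrable (by fun_prop) _ _) fun l hl => ?_
  have h1 := le_Ein_sub (mul_nonneg hy ha) (mul_le_mul_of_nonneg_left hl.1 hy)
  have h2 := Ein_mono (mul_nonneg hy (ha.trans hl.1))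
    ((mul_le_mul_of_nonneg_left hl.2 hy).trans hb)
  rw [max_eq_left (by linarith)]
  nlinarith

theorem expSlope_le {u c : ℝ} (hu : 0 ≤ u) (huc : u ≤ c) (hc1 : c ≤ 1) : expSlope u ≤ 2 := by
  have h := monotoneOn_expSlope (show u ∈ Ici 0 from hu) (show (1 : ℝ) ∈ Ici 0 by simp)
    (huc.trans hc1)
  rw [expSlope_of_ne one_ne_zero] at h
  have := Real.exp_one_lt_d9
  linarith

theorem integral_posPart_le_sum {c y : ℝ} (hy : 0 ≤ y) (hc1 : c ≤ 1) (hc : Ein c = 1)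
    (M : ℕ) (hM : y * M ≤ c) :
    (∫ l in (0 : ℝ)..M, max (1 - Ein (y * l)) 0) + (if M = 0 then 0 else y / 2) ≤
      ∑ L ∈ Finset.range M, (1 - invPowSum L (Real.exp (-y))) := by
  have hi := fun a b => (continuous_posPart_one_sub_Ein_mul y).intervalIntegrable (μ := volume) a b
  induction M with
  | zero => simp
  | succ M ih =>
    have hM' : y * M ≤ c := le_trans (by gcongr; simp) hM
    have h1 := ih hM'
    have h2 := integral_posPart_le hy (Nat.cast_nonneg M) (b := (M + 1 : ℕ)) (by simp) hc hM
    have h3 := invPowSum_le_Ein_add M hy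
    rw [Finset.sum_range_succ, ← intervalIntegral.integral_add_adjacent_intervals (hi 0 M) (hi M _),
      if_neg (Nat.succ_ne_zero M)]
    have h4 : ((M + 1 : ℕ) : ℝ) - M = 1 := by push_cast; ring
    rw [h4] at h2
    by_cases h0 : M = 0
    · subst h0
      simp only [CharP.cast_eq_zero, mul_zero, Ein_zero, expSlope_zero, zero_add, Nat.cast_one,
        Finset.range_zero, Finset.sum_empty, intervalIntegral.integral_same, invPowSum_zero] at h2 ⊢
      linarith
    · rw [if_neg h0] at h1
      have h5 := expSlope_le (mul_nonneg hy (Nat.cast_nonneg M)) hM' hc1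
      have h6 := mul_le_mul_of_nonneg_left h5 hy
      linarith

theorem gainAvg_le_avg {c z : ℝ} (hc0 : 0 < c) (hc1 : c ≤ 1) (hc : Ein c = 1) {n : ℕ} (hn : 0 < n)
    (hz : 0 < z) :
    gainAvg z ≤ (∑ L ∈ Finset.range n, max (1 - invPowSum L (Real.exp (-(z / n)))) 0) / n := by
  have hn' : (0 : ℝ) < n := Nat.cast_pos.2 hn
  set y := z / n with hydef
  have hy : 0 < y := div_pos hz hn'
  have hz' : z = y * n := by rw [hydef]; field_simp
  rw [le_div_iff₀ hn', mul_comm, hz', ← integral_posPart_eq]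
  have hsub : ∀ M ≤ n, ∑ L ∈ Finset.range M, (1 - invPowSum L (Real.exp (-y))) ≤
      ∑ L ∈ Finset.range M, max (1 - invPowSum L (Real.exp (-y))) 0 := fun M _ =>
    Finset.sum_le_sum fun L _ => le_max_left _ _
  rcases le_or_gt (y * n) c with hnc | hnc
  · have h := integral_posPart_le_sum hy.le hc1 hc n hnc
    rw [if_neg hn.ne'] at h
    linarith [hsub n le_rfl]
  · obtain ⟨M, δ, hδ0, hδ1, hM⟩ : ∃ (M : ℕ) (δ : ℝ), 0 ≤ δ ∧ δ < 1 ∧ c / y = M + δ :=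
      ⟨⌊c / y⌋₊, c / y - ⌊c / y⌋₊, by linarith [Nat.floor_le (div_pos hc0 hy).le],
        by linarith [Nat.lt_floor_add_one (c / y)], by ring⟩
    have hMc : c = y * (M + δ) := by rw [← hM]; field_simp
    have hMn : M < n := by
      have : y * M < y * n := lt_of_le_of_lt (by rw [hMc]; gcongr; linarith) hnc
      exact_mod_cast lt_of_mul_lt_mul_left this hy.le
    have hMc' : y * M ≤ c := by rw [hMc]; gcongr; linarith
    have hln : (M : ℝ) + δ ≤ n := by rw [hMc] at hnc; exact (lt_of_mul_lt_mul_left hnc hy.le).le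
    have hi := fun a b =>
      (continuous_posPart_one_sub_Ein_mul y).intervalIntegrable (μ := volume) a b
    have h1 := integral_posPart_le_sum hy.le hc1 hc M hMc'
    have h2 := integral_posPart_le hy.le (Nat.cast_nonneg M) (b := M + δ) (by linarith) hc hMc.ge
    have h3 : ∫ l in (M + δ : ℝ)..n, max (1 - Ein (y * l)) 0 = 0 := by
      rw [intervalIntegral.integral_congr (g := fun _ => (0 : ℝ)) fun l hl => ?_]
      · simp
      · rw [uIcc_of_le hln] at hl
        have := Ein_mono hc0.le (show c ≤ y * l by rw [hMc]; gcongr; exact hl.1)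
        exact max_eq_right (by linarith)
    have h4 : ∑ L ∈ Finset.range (M + 1), max (1 - invPowSum L (Real.exp (-y))) 0 ≤
        ∑ L ∈ Finset.range n, max (1 - invPowSum L (Real.exp (-y))) 0 :=
      Finset.sum_le_sum_of_subset_of_nonneg (Finset.range_mono hMn) fun _ _ _ => le_max_right _ _
    have h5 : δ * (1 - invPowSum M (Real.exp (-y))) ≤ max (1 - invPowSum M (Real.exp (-y))) 0 := by
      refine le_trans ?_ (mul_le_of_le_one_left (le_max_right _ _) hδ1.le)
      exact mul_le_mul_of_nonneg_left (le_max_left _ _) hδ0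
    have h6 := invPowSum_le_Ein_add M hy.le
    have h7 := hsub M hMn.le
    rw [Finset.sum_range_succ] at h4
    rw [← intervalIntegral.integral_add_adjacent_intervals (hi 0 (M + δ)) (hi _ n), h3, add_zero,
      ← intervalIntegral.integral_add_adjacent_intervals (hi 0 M) (hi M (M + δ))]
    have h8 := mul_le_mul_of_nonneg_left h6 hδ0
    rw [add_sub_cancel_left] at h2
    by_cases h0 : M = 0
    · subst h0
      simp only [CharP.cast_eq_zero, mul_zero, Ein_zero, expSlope_zero, if_true] at *
      nlinarith [mul_nonneg (sq_nonneg δ) hy.le]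
    · rw [if_neg h0] at h1
      have hs1 := one_le_expSlope (u := y * M) (by positivity)
      have hs2 := expSlope_le (u := y * M) (by positivity) hMc' hc1
      set s := expSlope (y * M)
      have h9 : 0 ≤ y * (1 / 2 - δ * (s - 1) + δ ^ 2 * s / 2) := by
        refine mul_nonneg hy.le ?_
        nlinarith [sq_nonneg (δ - 1), sq_nonneg (s * δ - (s - 1)), mul_nonneg hδ0 (sub_nonneg.2 hs1),
          mul_nonneg (sub_nonneg.2 hδ1.le) (sub_nonneg.2 hs2), sq_nonneg δ]
      nlinarith

theorem avg_le_gainAvg {z : ℝ} {n : ℕ} (hn : 0 < n) (hz : 0 < z) :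
    (∑ L ∈ Finset.range n, max (1 - invPowSum L (Real.exp (-(z / n)))) 0) / n ≤
      gainAvg z + 1 / n := by
  have hn' : (0 : ℝ) < n := Nat.cast_pos.2 hn
  set y := z / n with hydef
  have hy : 0 < y := div_pos hz hn'
  have hz' : z = y * n := by rw [hydef]; field_simp
  have h1 : ∑ L ∈ Finset.range n, max (1 - invPowSum L (Real.exp (-y))) 0 ≤
      ∑ L ∈ Finset.range (n + 1), max (1 - Ein (y * L)) 0 := by
    rw [Finset.sum_range_succ]
    refine le_add_of_le_of_nonneg (Finset.sum_le_sum fun L _ => ?_) (le_max_right _ _)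
    exact max_le_max_right _ (sub_le_sub_left (Ein_le_invPowSum L hy.le) _)
  have h2 := ((antitoneOn_posPart hy.le).mono Icc_subset_Ici_self).sum_le_integral (x₀ := 0)
    (a := n)
  simp only [zero_add] at h2
  rw [integral_posPart_eq, ← hz'] at h2
  rw [Finset.sum_range_succ'] at h1
  have h3 : max (1 - Ein (y * (0 : ℕ))) 0 = 1 := by simp [Ein_zero]
  rw [div_le_iff₀ hn', add_mul, div_mul_cancel₀ _ hn'.ne']
  linarith

theorem fullInfoDP_zero_eq {n : ℕ} (hn : 0 < n) :
    IntegrableOn (fun z => Real.exp (-z) *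
      ((∑ L ∈ Finset.range n, max (1 - invPowSum L (Real.exp (-(z / n)))) 0) / n)) (Ioi 0) ∧
    fullInfoDP n 0 = ∫ z in Ioi (0 : ℝ), Real.exp (-z) *
      ((∑ L ∈ Finset.range n, max (1 - invPowSum L (Real.exp (-(z / n)))) 0) / n) := by
  have hn' : (0 : ℝ) < n := Nat.cast_pos.2 hn
  have himg : (fun z : ℝ => Real.exp (-(z / n))) '' Ioi 0 = Ioo 0 1 := by
    ext x
    constructor
    · rintro ⟨z, hz, rfl⟩
      have : 0 < z / n := div_pos hz hn'
      exact ⟨Real.exp_pos _, Real.exp_lt_one_iff.2 (by linarith)⟩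
    · rintro ⟨h0, h1⟩
      refine ⟨-(n * Real.log x), ?_, ?_⟩
      · have := Real.log_neg h0 h1
        simp only [mem_Ioi]; nlinarith
      · simp only
        rw [neg_div, neg_neg, mul_div_cancel_left₀ _ hn'.ne', Real.exp_log h0]
  have hd : ∀ z ∈ Ioi (0 : ℝ), HasDerivWithinAt (fun z : ℝ => Real.exp (-(z / n)))
      (Real.exp (-(z / n)) * (-(1 / n))) (Ioi 0) z := fun z _ =>
    (((hasDerivAt_id z).div_const (n : ℝ)).neg.exp).hasDerivWithinAt
  have hinj : InjOn (fun z : ℝ => Real.exp (-(z / n))) (Ioi 0) := by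
    intro a _ b _ h
    have := Real.exp_injective h
    field_simp at this
    linarith
  have heq : ∀ z ∈ Ioi (0 : ℝ),
      |Real.exp (-(z / n)) * (-(1 / n))| • gainDensity n (Real.exp (-(z / n))) =
      Real.exp (-z) *
      ((∑ L ∈ Finset.range n, max (1 - invPowSum L (Real.exp (-(z / n)))) 0) / n) := by
    intro z _
    have h1 : Real.exp (-(z / n)) * Real.exp (-(z / n)) ^ (n - 1) = Real.exp (-z) := by
      rw [← pow_succ', Nat.sub_add_cancel hn, ← Real.exp_nat_mul]
      congr 1; field_simp
    rw [gainDensity_eq n (Real.exp_pos _), ← h1, abs_mul, abs_neg,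
      abs_of_pos (Real.exp_pos _), abs_of_pos (by positivity), smul_eq_mul]
    ring
  have h1 : fullInfoDP n 0 = ∫ x in Ioo 0 1, gainDensity n x := by
    rw [fullInfoDP, intervalIntegral.integral_of_le zero_le_one, integral_Ioc_eq_integral_Ioo]
  have h2 : IntegrableOn (gainDensity n) (Ioo 0 1) :=
    ((continuous_gainDensity n).integrableOn_Icc (a := 0) (b := 1)).mono_set Ioo_subset_Icc_self
  rw [← himg] at h1 h2
  constructor
  · rw [integrableOn_image_iff_integrableOn_abs_deriv_smul measurableSet_Ioi hd hinj] at h2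
    exact h2.congr_fun heq measurableSet_Ioi
  · rw [h1, integral_image_eq_integral_abs_deriv_smul measurableSet_Ioi hd hinj]
    exact setIntegral_congr_fun measurableSet_Ioi heq

theorem limitValue_le_fullInfoValue {n : ℕ} (hn : 0 < n) : limitValue ≤ fullInfoValue n := by
  obtain ⟨c, hc0, hc1, hc⟩ := exists_Ein_eq_one
  obtain ⟨h1, h2⟩ := fullInfoDP_zero_eq hn
  rw [fullInfoValue_eq, h2]
  refine setIntegral_mono_on integrableOn_exp_neg_mul_gainAvg h1 measurableSet_Ioi fun z hz => ?_
  exact mul_le_mul_of_nonneg_left (gainAvg_le_avg hc0 hc1 hc hn hz) (Real.exp_pos _).le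

theorem fullInfoValue_le {n : ℕ} (hn : 0 < n) : fullInfoValue n ≤ limitValue + 1 / n := by
  obtain ⟨h1, h2⟩ := fullInfoDP_zero_eq hn
  have h3 : IntegrableOn (fun x : ℝ => Real.exp (-x) * (1 / n)) (Ioi 0) :=
    (integrableOn_exp_neg_Ioi 0).mul_const _
  have h4 : ∫ x in Ioi (0 : ℝ), Real.exp (-x) * (1 / n) = 1 / n := by
    rw [integral_mul_const, integral_exp_neg_Ioi_zero, one_mul]
  rw [fullInfoValue_eq, h2, limitValue, ← h4, ← integral_add integrableOn_exp_neg_mul_gainAvg h3]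
  refine setIntegral_mono_on h1 (integrableOn_exp_neg_mul_gainAvg.add h3) measurableSet_Ioi
    fun z hz => ?_
  rw [← mul_add]
  exact mul_le_mul_of_nonneg_left (avg_le_gainAvg hn hz) (Real.exp_pos _).le

theorem fullInfoGuarantee_eq : fullInfoGuarantee = limitValue := by
  have hb : BddBelow (range fun n : ℕ+ => fullInfoValue n) :=
    ⟨limitValue, by rintro _ ⟨n, rfl⟩; exact limitValue_le_fullInfoValue n.2⟩
  refine le_antisymm ?_ (le_ciInf fun n => limitValue_le_fullInfoValue n.2)
  refine le_of_forall_pos_le_add fun ε hε => ?_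
  obtain ⟨n, hn⟩ := exists_nat_one_div_lt hε
  refine (ciInf_le hb ⟨n + 1, n.succ_pos⟩).trans ((fullInfoValue_le n.succ_pos).trans ?_)
  push_cast
  linarith

end ROSp
namespace ROSp
open Set

/-! ### The optimal guarantee and its limit -/

/-- The optimal success guarantee, for `p < 1`. -/
noncomputable def optValue (p : ℝ) : ℝ := ∑' k : ℕ, p ^ k * ∫ τ in p..1, gain k τ

theorem gain_intervalIntegrable (k : ℕ) {a b : ℝ} (ha : 0 ≤ a) (hab : a ≤ b) :
    IntervalIntegrable (gain k) volume a b := by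
  rw [intervalIntegrable_iff_integrableOn_Ioc_of_le hab]
  have hsub : Ioc a b ⊆ Ioi 0 := fun x hx => ha.trans_lt hx.1
  refine Integrable.mono' (g := fun _ => (1 : ℝ)) (integrable_const _)
    (((continuousOn_gain k).mono hsub).aestronglyMeasurable measurableSet_Ioc) ?_
  refine (ae_restrict_iff' measurableSet_Ioc).2 (Filter.Eventually.of_forall fun x hx => ?_)
  rw [Real.norm_of_nonneg (gain_nonneg k x)]
  exact gain_le_one k (hsub hx)

theorem integral_gain_nonneg (k : ℕ) {a b : ℝ} (hab : a ≤ b) : 0 ≤ ∫ τ in a..b, gain k τ :=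
  intervalIntegral.integral_nonneg hab fun _ _ => gain_nonneg k _

theorem integral_gain_le (k : ℕ) {a b : ℝ} (ha : 0 ≤ a) (hab : a ≤ b) :
    ∫ τ in a..b, gain k τ ≤ b - a := by
  have h : ∫ τ in a..b, gain k τ ≤ ∫ _ in a..b, (1 : ℝ) := by
    refine intervalIntegral.integral_mono_ae_restrict hab (gain_intervalIntegrable k ha hab)
      (by simp) ?_
    rw [← restrict_Ioc_eq_restrict_Icc]
    refine (ae_restrict_iff' measurableSet_Ioc).2 (Filter.Eventually.of_forall fun x hx => ?_)
    exact gain_le_one k (ha.trans_lt hx.1)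
  simpa using h

theorem summable_optValue {p : ℝ} (hp : 0 ≤ p) (hp1 : p < 1) {c : ℕ → ℝ} (h0 : ∀ k, 0 ≤ c k)
    (h1 : ∀ k, c k ≤ 1) : Summable fun k : ℕ => p ^ k * c k :=
  (summable_geometric_of_lt_one hp hp1).of_nonneg_of_le
    (fun k => mul_nonneg (pow_nonneg hp k) (h0 k))
    (fun k => mul_le_of_le_one_right (pow_nonneg hp k) (h1 k))

theorem summable_integral_gain {p : ℝ} (hp : 0 ≤ p) (hp1 : p < 1) :
    Summable fun k : ℕ => p ^ k * ∫ τ in p..1, gain k τ :=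
  summable_optValue hp hp1 (fun k => integral_gain_nonneg k hp1.le)
    fun k => (integral_gain_le k hp hp1.le).trans (by linarith)

theorem integral_gain_eq_exp (k : ℕ) (η : ℝ) :
    ∫ τ in Real.exp (-η)..1, gain k τ =
      ∫ y in (0 : ℝ)..η, Real.exp (-y) * gain k (Real.exp (-y)) := by
  have h := intervalIntegral.integral_comp_mul_deriv' (a := 0) (b := η)
    (f := fun y => Real.exp (-y)) (f' := fun y => -Real.exp (-y)) (g := gain k)
    (fun y _ => by simpa using (hasDerivAt_neg y).exp)
    (by fun_prop) ((continuousOn_gain k).mono (by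
      rintro _ ⟨y, -, rfl⟩; exact Real.exp_pos _))
  rw [neg_zero, Real.exp_zero] at h
  rw [intervalIntegral.integral_symm, ← h, ← intervalIntegral.integral_neg]
  congr 1
  funext y
  simp only [Function.comp]; ring

theorem continuous_exp_mul_gain (k : ℕ) :
    Continuous fun y => Real.exp (-y) * gain k (Real.exp (-y)) := by
  refine (by fun_prop : Continuous fun y : ℝ => Real.exp (-y)).mul ?_
  exact (continuousOn_gain k).comp_continuous (by fun_prop) fun y => Real.exp_pos _

theorem integral_gain_exp_le (k : ℕ) {η : ℝ} (hη : 0 ≤ η) :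
    ∫ τ in Real.exp (-η)..1, gain k τ ≤ η * gainAvg (k * η) := by
  rw [integral_gain_eq_exp k η, ← integral_posPart_eq]
  refine intervalIntegral.integral_mono_on hη ((continuous_exp_mul_gain k).intervalIntegrable _ _)
    ((continuous_posPart_one_sub_Ein_mul k).intervalIntegrable _ _) fun y hy => ?_
  refine (mul_le_of_le_one_left (gain_nonneg _ _) (Real.exp_le_one_iff.2 (by linarith [hy.1]))).trans ?_
  rw [gain, min_eq_left (Real.exp_le_one_iff.2 (by linarith [hy.1]))]
  refine max_le_max_right _ (sub_le_sub_left ?_ _)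
  have := Ein_le_invPowSum k hy.1
  rw [lookahead, Real.log_exp, mul_comm]; linarith [hy.1]

theorem le_integral_gain_exp (k : ℕ) {η : ℝ} (hη : 0 ≤ η) :
    Real.exp (-η) * (η * gainAvg ((k + 1 : ℕ) * η)) ≤ ∫ τ in Real.exp (-η)..1, gain k τ := by
  rw [integral_gain_eq_exp k η, ← integral_posPart_eq, ← intervalIntegral.integral_const_mul]
  refine intervalIntegral.integral_mono_on hη
    (((continuous_posPart_one_sub_Ein_mul _).intervalIntegrable _ _).const_mul _)
    ((continuous_exp_mul_gain k).intervalIntegrable _ _) fun y hy => ?_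
  have hy0 : 0 ≤ y := hy.1
  refine mul_le_mul (Real.exp_le_exp.2 (by linarith [hy.2])) ?_ (le_max_right _ _)
    (Real.exp_pos _).le
  rw [gain, min_eq_left (Real.exp_le_one_iff.2 (by linarith))]
  refine max_le_max_right _ (sub_le_sub_left ?_ _)
  have h1 := invPowSum_le_Ein_add k hy0
  have h2 := le_Ein_sub (a := y * k) (b := y * (k + 1 : ℕ)) (by positivity) (by gcongr; simp)
  have h3 : y * ((k + 1 : ℕ) : ℝ) - y * k = y := by push_cast; ring
  rw [h3] at h2
  rw [lookahead, Real.log_exp, mul_comm ((k + 1 : ℕ) : ℝ)]; linarith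

theorem gainAvg_anti {a b : ℝ} (ha : 0 ≤ a) (hab : a ≤ b) : gainAvg b ≤ gainAvg a := by
  refine intervalIntegral.integral_mono_on zero_le_one
    ((continuous_posPart_one_sub_Ein_mul b).intervalIntegrable _ _)
    ((continuous_posPart_one_sub_Ein_mul a).intervalIntegrable _ _) fun w hw => ?_
  exact max_le_max_right _ (sub_le_sub_left (Ein_mono (mul_nonneg ha hw.1)
    (mul_le_mul_of_nonneg_right hab hw.1)) _)

theorem antitoneOn_exp_mul_gainAvg {η : ℝ} (hη : 0 ≤ η) :
    AntitoneOn (fun l => Real.exp (-(l * η)) * gainAvg (l * η)) (Ici 0) := by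
  intro a ha b hb hab
  have h : a * η ≤ b * η := mul_le_mul_of_nonneg_right hab hη
  exact mul_le_mul (Real.exp_le_exp.2 (by linarith)) (gainAvg_anti (mul_nonneg ha hη) h)
    (gainAvg_nonneg _) (Real.exp_pos _).le

theorem mul_integral_exp_mul_gainAvg (η : ℝ) (N : ℕ) :
    η * ∫ l in (0 : ℝ)..N, Real.exp (-(l * η)) * gainAvg (l * η) =
      ∫ x in (0 : ℝ)..(N * η), Real.exp (-x) * gainAvg x := by
  have := intervalIntegral.mul_integral_comp_mul_right (a := 0) (b := N) (c := η)
    (f := fun x => Real.exp (-x) * gainAvg x)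
  simpa using this

theorem integral_exp_mul_gainAvg_le {a : ℝ} (ha : 0 ≤ a) :
    ∫ x in (0 : ℝ)..a, Real.exp (-x) * gainAvg x ≤ limitValue := by
  rw [intervalIntegral.integral_of_le ha]
  refine setIntegral_mono_set integrableOn_exp_neg_mul_gainAvg ?_ Ioc_subset_Ioi_self.eventuallyLE
  exact (ae_restrict_iff' measurableSet_Ioi).2 (Filter.Eventually.of_forall fun x _ =>
    mul_nonneg (Real.exp_pos _).le (gainAvg_nonneg x))

theorem optValue_exp_le {η : ℝ} (hη : 0 < η) : optValue (Real.exp (-η)) ≤ limitValue + η := by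
  have hp1 : Real.exp (-η) < 1 := Real.exp_lt_one_iff.2 (by linarith)
  refine Real.tsum_le_of_sum_range_le (fun k => mul_nonneg (pow_nonneg (Real.exp_pos _).le k)
    (integral_gain_nonneg k hp1.le)) fun N => ?_
  have h1 : ∀ k : ℕ, Real.exp (-η) ^ k * ∫ τ in Real.exp (-η)..1, gain k τ ≤
      η * (Real.exp (-(k * η)) * gainAvg (k * η)) := fun k => by
    have := mul_le_mul_of_nonneg_left (integral_gain_exp_le k hη.le)
      (pow_nonneg (Real.exp_pos (-η)).le k)
    rw [← Real.exp_nat_mul, mul_neg] at this ⊢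
    linarith
  have h2 := ((antitoneOn_exp_mul_gainAvg hη.le).mono Icc_subset_Ici_self).sum_le_integral
    (x₀ := 0) (a := N)
  simp only [zero_add] at h2
  have h3 := mul_le_mul_of_nonneg_left h2 hη.le
  rw [mul_integral_exp_mul_gainAvg] at h3
  have h4 := integral_exp_mul_gainAvg_le (a := N * η) (by positivity)
  have h5 : ∑ k ∈ Finset.range N, Real.exp (-η) ^ k * ∫ τ in Real.exp (-η)..1, gain k τ ≤
      ∑ k ∈ Finset.range (N + 1), η * (Real.exp (-(k * η)) * gainAvg (k * η)) := by
    rw [Finset.sum_range_succ]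
    exact le_add_of_le_of_nonneg (Finset.sum_le_sum fun k _ => h1 k)
      (mul_nonneg hη.le (mul_nonneg (Real.exp_pos _).le (gainAvg_nonneg _)))
  rw [Finset.sum_range_succ', ← Finset.mul_sum] at h5
  have h6 : η * (Real.exp (-((0 : ℕ) * η)) * gainAvg ((0 : ℕ) * η)) ≤ η := by
    have := gainAvg_le_one (le_refl (0 : ℝ))
    simp only [CharP.cast_eq_zero, zero_mul, neg_zero, Real.exp_zero, one_mul]
    exact mul_le_of_le_one_right hη.le this
  linarith

theorem le_optValue_exp {η : ℝ} (hη : 0 < η) :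
    Real.exp (-η) * (limitValue - η) ≤ optValue (Real.exp (-η)) := by
  have hp1 : Real.exp (-η) < 1 := Real.exp_lt_one_iff.2 (by linarith)
  have hN : ∀ N : ℕ, Real.exp (-η) * ((∫ x in (0 : ℝ)..(N * η), Real.exp (-x) * gainAvg x) - η) ≤
      optValue (Real.exp (-η)) := fun N => by
    refine le_trans ?_ ((summable_integral_gain (Real.exp_pos _).le hp1).sum_le_tsum
      (Finset.range N) fun k _ => mul_nonneg (pow_nonneg (Real.exp_pos _).le k)
      (integral_gain_nonneg k hp1.le))
    have h1 : ∀ k : ℕ, Real.exp (-η) * (η * (Real.exp (-((k + 1 : ℕ) * η)) *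
        gainAvg ((k + 1 : ℕ) * η))) ≤ Real.exp (-η) ^ k * ∫ τ in Real.exp (-η)..1, gain k τ :=
      fun k => by
        have := mul_le_mul_of_nonneg_left (le_integral_gain_exp k hη.le)
          (pow_nonneg (Real.exp_pos (-η)).le k)
        refine le_trans ?_ this
        rw [← Real.exp_nat_mul, mul_neg]
        have h : Real.exp (-((k + 1 : ℕ) * η)) ≤ Real.exp (-(k * η)) := by
          refine Real.exp_le_exp.2 ?_
          push_cast; linarith
        have h' : 0 ≤ Real.exp (-η) * (η * gainAvg ((k + 1 : ℕ) * η)) :=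
          mul_nonneg (Real.exp_pos _).le (mul_nonneg hη.le (gainAvg_nonneg _))
        have := mul_le_mul_of_nonneg_right h h'
        linarith
    have h2 := ((antitoneOn_exp_mul_gainAvg hη.le).mono Icc_subset_Ici_self).integral_le_sum
      (x₀ := 0) (a := N)
    simp only [zero_add] at h2
    have h3 := mul_le_mul_of_nonneg_left h2 hη.le
    rw [mul_integral_exp_mul_gainAvg] at h3
    have h4 := Finset.sum_range_succ (fun k : ℕ => Real.exp (-(k * η)) * gainAvg (k * η)) N
    rw [Finset.sum_range_succ'] at h4
    have h5 : 0 ≤ Real.exp (-(N * η)) * gainAvg (N * η) :=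
      mul_nonneg (Real.exp_pos _).le (gainAvg_nonneg _)
    have h6 : Real.exp (-((0 : ℕ) * η)) * gainAvg ((0 : ℕ) * η) ≤ 1 := by
      simpa using gainAvg_le_one (le_refl (0 : ℝ))
    refine le_trans ?_ (Finset.sum_le_sum fun k _ => h1 k)
    rw [← Finset.mul_sum, ← Finset.mul_sum]
    refine mul_le_mul_of_nonneg_left ?_ (Real.exp_pos _).le
    have h7 : ∑ k ∈ Finset.range N, Real.exp (-(k * η)) * gainAvg (k * η) - 1 ≤
      ∑ k ∈ Finset.range N, Real.exp (-((k + 1 : ℕ) * η)) * gainAvg ((k + 1 : ℕ) * η) := by linarith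
    have h8 := mul_le_mul_of_nonneg_left h7 hη.le
    linarith
  have hlim := intervalIntegral_tendsto_integral_Ioi 0 integrableOn_exp_neg_mul_gainAvg
    (Filter.Tendsto.atTop_mul_const hη tendsto_natCast_atTop_atTop)
  exact le_of_tendsto ((hlim.sub_const η).const_mul _) (Filter.Eventually.of_forall hN)

theorem tendsto_optValue :
    Filter.Tendsto optValue (nhdsWithin 1 (Iio 1)) (nhds limitValue) := by
  have hlog : Filter.Tendsto Real.log (nhdsWithin 1 (Iio 1)) (nhds 0) := by
    have := (Real.continuousAt_log one_ne_zero).tendsto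
    rw [Real.log_one] at this
    exact this.mono_left nhdsWithin_le_nhds
  have hid : Filter.Tendsto (fun p : ℝ => p) (nhdsWithin 1 (Iio 1)) (nhds 1) :=
    nhdsWithin_le_nhds
  have h1 := hid.mul (hlog.const_add limitValue)
  have h2 := hlog.const_sub limitValue
  rw [one_mul, add_zero] at h1
  rw [sub_zero] at h2
  have hev : ∀ᶠ p in nhdsWithin (1 : ℝ) (Iio 1), 0 < p ∧ p < 1 := by
    filter_upwards [self_mem_nhdsWithin, nhdsWithin_le_nhds (Ioi_mem_nhds one_pos)] with p h1 h0
    exact ⟨h0, h1⟩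
  refine tendsto_of_tendsto_of_tendsto_of_le_of_le' h1 h2 ?_ ?_
  · filter_upwards [hev] with p hp
    have := le_optValue_exp (η := -Real.log p) (by linarith [Real.log_neg hp.1 hp.2])
    rwa [neg_neg, Real.exp_log hp.1, sub_neg_eq_add] at this
  · filter_upwards [hev] with p hp
    have := optValue_exp_le (η := -Real.log p) (by linarith [Real.log_neg hp.1 hp.2])
    rwa [neg_neg, Real.exp_log hp.1, ← sub_eq_add_neg] at this

theorem optValue_zero : optValue 0 = 1 / Real.exp 1 := by
  rw [optValue, tsum_eq_single 0 (fun k hk => by simp [hk])]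
  have he : threshold 0 = Real.exp (-1) := by
    have := lookahead_threshold 0
    rw [lookahead, invPowSum_zero, add_zero] at this
    rw [← Real.exp_log (threshold_pos 0)]; congr 1; linarith
  have ht0 := threshold_pos 0
  have ht1 := (threshold_lt_one 0).le
  rw [← intervalIntegral.integral_add_adjacent_intervals
    (gain_intervalIntegrable 0 le_rfl ht0.le) (gain_intervalIntegrable 0 ht0.le ht1)]
  have h1 : ∫ τ in (0 : ℝ)..threshold 0, gain 0 τ = 0 := by
    rw [intervalIntegral.integral_congr_ae (g := fun _ => (0 : ℝ))]
    · simp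
    · refine Filter.Eventually.of_forall fun x hx => ?_
      rw [uIoc_of_le ht0.le] at hx
      exact gain_of_le_threshold 0 hx.1 hx.2
  have h2 : ∫ τ in threshold 0..1, gain 0 τ = ∫ τ in threshold 0..1, (1 + Real.log τ) := by
    refine intervalIntegral.integral_congr fun x hx => ?_
    rw [uIcc_of_le ht1] at hx
    rw [gain_of_threshold_le 0 hx.1 hx.2, lookahead, invPowSum_zero]
    ring
  rw [h1, h2, intervalIntegral.integral_add (by simp) intervalIntegral.intervalIntegrable_log',
    integral_log, he, Real.log_exp]
  simp [Real.exp_neg]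

end ROSp
namespace ROSp
open Set
open scoped unitInterval

/-! ### The winning probability of the threshold algorithm: a lower bound -/

/-- The number of sampled elements that are larger than the element `i`. -/
noncomputable def countAbove (p : ℝ) {n : ℕ} (α : Fin n → ℝ) (τ : Fin n → I) (i : Fin n) : ℕ :=
  open Classical in ∑ j, if (τ j : ℝ) < p ∧ α i < α j then 1 else 0

/-- The maximal online element arrives after its threshold, or there are no online elements. -/
def LastGood (t : ℕ → ℝ) (p : ℝ) (κ : ℕ) {n : ℕ} (α : Fin n → ℝ) (τ : Fin n → I) : Prop :=
  (∀ i, (τ i : ℝ) < p) ∨ ∃ i, p ≤ τ i ∧ (∀ j, p ≤ τ j → α j ≤ α i) ∧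
    t (κ + countAbove p α τ i) ≤ τ i

/-- The maximal element among the online elements that arrive before the time `s` arrives after its
threshold. -/
def BeforeGood (t : ℕ → ℝ) (p : ℝ) (κ : ℕ) (s : ℝ) {n : ℕ} (α : Fin n → ℝ) (τ : Fin n → I) :
    Prop :=
  ∃ i, p ≤ τ i ∧ (τ i : ℝ) < s ∧ (∀ j, p ≤ τ j → (τ j : ℝ) < s → α j ≤ α i) ∧
    t (κ + countAbove p α τ i) ≤ τ i

/-- The maximal element among the online elements that arrive before the maximal online element
arrives after its threshold. -/
def SecondGood (t : ℕ → ℝ) (p : ℝ) (κ : ℕ) {n : ℕ} (α : Fin n → ℝ) (τ : Fin n → I) : Prop :=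
  ∃ i, p ≤ τ i ∧ (∀ j, p ≤ τ j → α j ≤ α i) ∧ BeforeGood t p κ (τ i) α τ

section Measurability

variable (t : ℕ → ℝ) (p : ℝ) (κ : ℕ) {n : ℕ} (α : Fin n → ℝ)

theorem measurable_coe_apply (i : Fin n) : Measurable fun τ : Fin n → I => (τ i : ℝ) :=
  measurable_subtype_coe.comp (measurable_pi_apply i)

theorem measurable_countAbove (i : Fin n) : Measurable fun τ => countAbove p α τ i := by
  classical
  unfold countAbove
  refine Finset.measurable_sum _ fun j _ => Measurable.ite ?_ measurable_const measurable_const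
  by_cases h : α i < α j
  · simp only [h, and_true]
    exact measurableSet_lt (measurable_coe_apply j) measurable_const
  · simp [h]

theorem measurableSet_threshold_le (i : Fin n) :
    MeasurableSet {τ : Fin n → I | t (κ + countAbove p α τ i) ≤ τ i} :=
  measurableSet_le ((measurable_from_nat (f := fun k => t (κ + k))).comp
    (measurable_countAbove p α i)) (measurable_coe_apply i)

theorem measurable_le_coe (i : Fin n) : Measurable fun τ : Fin n → I => p ≤ (τ i : ℝ) :=
  measurableSet_setOfPred.1 (measurableSet_le measurable_const (measurable_coe_apply i))

theorem measurableSet_lastGood : MeasurableSet {τ | LastGood t p κ α τ} := by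
  refine measurableSet_setOfPred.2 (Measurable.or (Measurable.forall fun i => ?_)
    (Measurable.exists fun i => (measurable_le_coe p i).and (Measurable.and
      (Measurable.forall fun j => (measurable_le_coe p j).imp measurable_const)
      (measurableSet_setOfPred.1 (measurableSet_threshold_le t p κ α i)))))
  exact measurableSet_setOfPred.1 (measurableSet_lt (measurable_coe_apply i) measurable_const)

theorem measurable_beforeGood {s : (Fin n → I) → ℝ} (hs : Measurable s) :
    Measurable fun τ => BeforeGood t p κ (s τ) α τ := by
  have h2 : ∀ i, Measurable fun τ : Fin n → I => (τ i : ℝ) < s τ := fun i =>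
    measurableSet_setOfPred.1 (measurableSet_lt (measurable_coe_apply i) hs)
  exact Measurable.exists fun i => (measurable_le_coe p i).and ((h2 i).and (Measurable.and
    (Measurable.forall fun j => (measurable_le_coe p j).imp ((h2 j).imp measurable_const))
    (measurableSet_setOfPred.1 (measurableSet_threshold_le t p κ α i))))

theorem measurableSet_secondGood : MeasurableSet {τ | SecondGood t p κ α τ} := by
  exact measurableSet_setOfPred.2 (Measurable.exists fun i => (measurable_le_coe p i).and
    (Measurable.and (Measurable.forall fun j => (measurable_le_coe p j).imp measurable_const)
    (measurable_beforeGood t p κ α (measurable_coe_apply i))))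

end Measurability

section Peel

variable {t : ℕ → ℝ} {p : ℝ} {κ n : ℕ} {α : Fin (n + 1) → ℝ} {i₀ : Fin (n + 1)} {x : I}
  {y : Fin n → I}

theorem exists_forall_lt {n : ℕ} {α : Fin (n + 1) → ℝ} (hα : Function.Injective α) :
    ∃ i₀, ∀ j, α (Fin.succAbove i₀ j) < α i₀ := by
  obtain ⟨i₀, h⟩ := Finite.exists_max α
  exact ⟨i₀, fun j => (h _).lt_of_ne fun e => Fin.succAbove_ne i₀ j (hα e)⟩

theorem countAbove_insertNth_self (hi : ∀ j, α (i₀.succAbove j) < α i₀) :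
    countAbove p α (i₀.insertNth x y : Fin (n + 1) → I) i₀ = 0 := by
  classical
  refine Finset.sum_eq_zero fun j _ => if_neg fun h => ?_
  rcases Fin.eq_self_or_eq_succAbove i₀ j with rfl | ⟨k, rfl⟩
  · exact lt_irrefl _ h.2
  · exact lt_asymm h.2 (hi k)

theorem countAbove_insertNth_of_lt (hi : ∀ j, α (i₀.succAbove j) < α i₀) (hx : (x : ℝ) < p)
    (k : Fin n) :
    countAbove p α (i₀.insertNth x y : Fin (n + 1) → I) (i₀.succAbove k) =
      countAbove p (α ∘ i₀.succAbove) y k + 1 := by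
  classical
  unfold countAbove
  rw [Fin.sum_univ_succAbove _ i₀, add_comm]
  simp [hx, hi]

theorem countAbove_insertNth_of_le (hx : p ≤ (x : ℝ)) (k : Fin n) :
    countAbove p α (i₀.insertNth x y : Fin (n + 1) → I) (i₀.succAbove k) =
      countAbove p (α ∘ i₀.succAbove) y k := by
  classical
  unfold countAbove
  rw [Fin.sum_univ_succAbove _ i₀]
  simp [not_lt.2 hx]

theorem lastGood_insertNth_of_lt (hi : ∀ j, α (i₀.succAbove j) < α i₀) (hx : (x : ℝ) < p)
    (h : LastGood t p (κ + 1) (α ∘ i₀.succAbove) y) :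
    LastGood t p κ α (i₀.insertNth x y : Fin (n + 1) → I) := by
  rcases h with h | ⟨k, h1, h2, h3⟩
  · left
    rw [Fin.forall_iff_succAbove i₀]
    simpa [hx] using h
  · refine Or.inr ⟨i₀.succAbove k, by simpa using h1, ?_, ?_⟩
    · rw [Fin.forall_iff_succAbove i₀]
      simp only [Fin.insertNth_apply_same, Fin.insertNth_apply_succAbove]
      exact ⟨fun h => absurd hx (not_lt.2 h), h2⟩
    · rw [countAbove_insertNth_of_lt hi hx, Fin.insertNth_apply_succAbove, add_comm _ 1,
        ← add_assoc]
      exact h3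

theorem lastGood_insertNth_of_le (hi : ∀ j, α (i₀.succAbove j) < α i₀) (hx : p ≤ (x : ℝ))
    (h : t κ ≤ x) : LastGood t p κ α (i₀.insertNth x y : Fin (n + 1) → I) := by
  refine Or.inr ⟨i₀, by simpa using hx, ?_, ?_⟩
  · rw [Fin.forall_iff_succAbove i₀]
    exact ⟨fun _ => le_rfl, fun j _ => (hi j).le⟩
  · rw [countAbove_insertNth_self hi]; simpa using h

theorem beforeGood_of_insertNth_of_lt {s : ℝ} (hi : ∀ j, α (i₀.succAbove j) < α i₀)
    (hx : (x : ℝ) < p) (h : BeforeGood t p κ s α (i₀.insertNth x y : Fin (n + 1) → I)) :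
    BeforeGood t p (κ + 1) s (α ∘ i₀.succAbove) y := by
  obtain ⟨i, h1, h2, h3, h4⟩ := h
  rcases Fin.eq_self_or_eq_succAbove i₀ i with rfl | ⟨k, rfl⟩
  · rw [Fin.insertNth_apply_same] at h1; exact absurd hx (not_lt.2 h1)
  · rw [countAbove_insertNth_of_lt hi hx, add_comm _ 1, ← add_assoc] at h4
    rw [Fin.insertNth_apply_succAbove] at h1 h2 h4
    refine ⟨k, h1, h2, fun j hj hj' => ?_, h4⟩
    exact h3 (i₀.succAbove j) (by simpa using hj) (by simpa using hj')

theorem threshold_le_of_beforeGood {s : ℝ} (hi : ∀ j, α (i₀.succAbove j) < α i₀)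
    (hx : p ≤ (x : ℝ)) (hs : (x : ℝ) < s)
    (h : BeforeGood t p κ s α (i₀.insertNth x y : Fin (n + 1) → I)) : t κ ≤ x := by
  obtain ⟨i, h1, h2, h3, h4⟩ := h
  have := h3 i₀ (by simpa using hx) (by simpa using hs)
  rcases Fin.eq_self_or_eq_succAbove i₀ i with rfl | ⟨k, rfl⟩
  · rw [countAbove_insertNth_self hi] at h4; simpa using h4
  · exact absurd (hi k) (not_lt.2 this)

theorem beforeGood_of_insertNth_of_le {s : ℝ}
    (hx : p ≤ (x : ℝ)) (hs : s ≤ x)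
    (h : BeforeGood t p κ s α (i₀.insertNth x y : Fin (n + 1) → I)) :
    BeforeGood t p κ s (α ∘ i₀.succAbove) y := by
  obtain ⟨i, h1, h2, h3, h4⟩ := h
  rcases Fin.eq_self_or_eq_succAbove i₀ i with rfl | ⟨k, rfl⟩
  · rw [Fin.insertNth_apply_same] at h2; exact absurd h2 (not_lt.2 hs)
  · rw [countAbove_insertNth_of_le hx] at h4
    rw [Fin.insertNth_apply_succAbove] at h1 h2 h4
    refine ⟨k, h1, h2, fun j hj hj' => ?_, h4⟩
    exact h3 (i₀.succAbove j) (by simpa using hj) (by simpa using hj')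

theorem secondGood_of_insertNth_of_lt (hi : ∀ j, α (i₀.succAbove j) < α i₀)
    (hx : (x : ℝ) < p) (h : SecondGood t p κ α (i₀.insertNth x y : Fin (n + 1) → I)) :
    SecondGood t p (κ + 1) (α ∘ i₀.succAbove) y := by
  obtain ⟨i, h1, h2, h3⟩ := h
  rcases Fin.eq_self_or_eq_succAbove i₀ i with rfl | ⟨k, rfl⟩
  · rw [Fin.insertNth_apply_same] at h1; exact absurd hx (not_lt.2 h1)
  · rw [Fin.insertNth_apply_succAbove] at h1 h3
    refine ⟨k, h1, fun j hj => ?_, beforeGood_of_insertNth_of_lt hi hx h3⟩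
    exact h2 (i₀.succAbove j) (by simpa using hj)

theorem beforeGood_of_secondGood_insertNth (hi : ∀ j, α (i₀.succAbove j) < α i₀)
    (hx : p ≤ (x : ℝ)) (h : SecondGood t p κ α (i₀.insertNth x y : Fin (n + 1) → I)) :
    BeforeGood t p κ x (α ∘ i₀.succAbove) y := by
  obtain ⟨i, h1, h2, h3⟩ := h
  rcases Fin.eq_self_or_eq_succAbove i₀ i with rfl | ⟨k, rfl⟩
  · rw [Fin.insertNth_apply_same] at h3
    exact beforeGood_of_insertNth_of_le hx le_rfl h3
  · exact absurd (hi k) (not_lt.2 (h2 i₀ (by simpa using hx)))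

end Peel

end ROSp
namespace ROSp
open Set
open scoped unitInterval

theorem volume_coe_lt {a : ℝ} (h0 : 0 ≤ a) (h1 : a ≤ 1) :
    volume {x : I | (x : ℝ) < a} = ENNReal.ofReal a :=
  unitInterval.volume_Iio (x := ⟨a, h0, h1⟩)

theorem volume_le_coe {a : ℝ} (h0 : 0 ≤ a) (h1 : a ≤ 1) :
    volume {x : I | a ≤ (x : ℝ)} = ENNReal.ofReal (1 - a) :=
  unitInterval.volume_Ici (x := ⟨a, h0, h1⟩)

theorem volume_le_coe_lt {a b : ℝ} (h0 : 0 ≤ a) (h1 : a ≤ 1) (h2 : 0 ≤ b) (h3 : b ≤ 1) :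
    volume {x : I | a ≤ (x : ℝ) ∧ (x : ℝ) < b} = ENNReal.ofReal (b - a) :=
  unitInterval.volume_Ico (x := ⟨a, h0, h1⟩) (y := ⟨b, h2, h3⟩)

theorem measurableSet_coe_lt (a : ℝ) : MeasurableSet {x : I | (x : ℝ) < a} :=
  measurableSet_lt measurable_subtype_coe measurable_const

theorem measurableSet_le_coe (a : ℝ) : MeasurableSet {x : I | a ≤ (x : ℝ)} :=
  measurableSet_le measurable_const measurable_subtype_coe

theorem le_volume_lastGood {t : ℕ → ℝ} {p : ℝ} (ht1 : ∀ k, t k ≤ 1) (hp0 : 0 ≤ p) (hp1 : p ≤ 1)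
    {n : ℕ} (κ : ℕ) {α : Fin n → ℝ} (hα : Function.Injective α) :
    ENNReal.ofReal (p ^ n + ∑ k ∈ Finset.range n, p ^ k * (1 - max p (t (κ + k)))) ≤
      volume {τ | LastGood t p κ α τ} := by
  induction n generalizing κ with
  | zero => simp [LastGood]
  | succ n ih =>
    obtain ⟨i₀, hi⟩ := exists_forall_lt hα
    have hT : ∀ k, 0 ≤ 1 - max p (t k) := fun k => sub_nonneg.2 (max_le hp1 (ht1 k))
    rw [volume_eq_lintegral_insertNth i₀ (measurableSet_lastGood t p κ α)]
    have hc := ih (κ + 1) (hα.comp (Fin.succAbove_right_injective (p := i₀)))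
    set c := p ^ n + ∑ k ∈ Finset.range n, p ^ k * (1 - max p (t (κ + 1 + k))) with hcdef
    have hc0 : 0 ≤ c := add_nonneg (by positivity)
      (Finset.sum_nonneg fun k _ => mul_nonneg (by positivity) (hT _))
    have heq : p ^ (n + 1) + ∑ k ∈ Finset.range (n + 1), p ^ k * (1 - max p (t (κ + k))) =
        c * p + 1 * (1 - max p (t κ)) := by
      rw [Finset.sum_range_succ', hcdef, add_mul, Finset.sum_mul, pow_succ, ← add_assoc]
      simp only [pow_zero, add_zero]
      congr 2
      refine Finset.sum_congr rfl fun k _ => ?_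
      rw [show κ + (k + 1) = κ + 1 + k by ring]; ring
    rw [heq, ENNReal.ofReal_add (by positivity) (by simpa using hT κ),
      ENNReal.ofReal_mul hc0, ENNReal.ofReal_mul zero_le_one,
      ← volume_coe_lt hp0 hp1, ← volume_le_coe (le_max_of_le_left hp0) (max_le hp1 (ht1 κ)),
      ← lintegral_indicator_const (measurableSet_coe_lt p),
      ← lintegral_indicator_const (measurableSet_le_coe _),
      ← lintegral_add_left (measurable_const.indicator (measurableSet_coe_lt p))]
    refine lintegral_mono fun x => ?_
    rcases lt_or_ge (x : ℝ) p with hx | hx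
    · have h2 : ¬ max p (t κ) ≤ x := fun h => absurd ((le_max_left _ _).trans h) (not_le.2 hx)
      rw [indicator_of_mem (show x ∈ {x : I | (x : ℝ) < p} from hx),
        indicator_of_notMem (show x ∉ {x : I | max p (t κ) ≤ (x : ℝ)} from h2), add_zero]
      exact hc.trans (measure_mono fun y hy => lastGood_insertNth_of_lt hi hx hy)
    · rw [indicator_of_notMem (show x ∉ {x : I | (x : ℝ) < p} from not_lt.2 hx), zero_add]
      by_cases h : max p (t κ) ≤ x
      · rw [indicator_of_mem (show x ∈ {x : I | max p (t κ) ≤ (x : ℝ)} from h)]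
        have : {y : Fin n → I | i₀.insertNth x y ∈ {τ | LastGood t p κ α τ}} = univ :=
          eq_univ_of_forall fun y => lastGood_insertNth_of_le hi hx ((le_max_right _ _).trans h)
        rw [this, measure_univ, ENNReal.ofReal_one]
      · rw [indicator_of_notMem (show x ∉ {x : I | max p (t κ) ≤ (x : ℝ)} from h)]
        exact zero_le

theorem beforeSum_nonneg {t : ℕ → ℝ} {p : ℝ} (hp0 : 0 ≤ p) (κ n : ℕ) {s : ℝ} (hs : 0 ≤ s) :
    0 ≤ ∑ l ∈ Finset.range n, p ^ l * ((s⁻¹) ^ (l + 1) * max (s - max p (t (κ + l))) 0) :=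
  Finset.sum_nonneg fun l _ => mul_nonneg (by positivity)
    (mul_nonneg (by positivity) (le_max_right _ _))

theorem volume_beforeGood_le {t : ℕ → ℝ} {p : ℝ} (ht1 : ∀ k, t k ≤ 1) (hp0 : 0 ≤ p)
    (hp1 : p ≤ 1) {n : ℕ} (κ : ℕ) {α : Fin n → ℝ} (hα : Function.Injective α) {s : ℝ}
    (hs0 : 0 ≤ s) (hs1 : s ≤ 1) (hps : p ≤ s) :
    volume {τ | BeforeGood t p κ s α τ} ≤ ENNReal.ofReal
      (∑ l ∈ Finset.range n, p ^ l * ((s⁻¹) ^ (l + 1) * max (s - max p (t (κ + l))) 0)) := by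
  rcases hs0.eq_or_lt with rfl | hs
  · have : {τ : Fin n → I | BeforeGood t p κ 0 α τ} = ∅ := by
      refine eq_empty_of_forall_notMem ?_
      rintro τ ⟨i, -, h, -⟩
      exact absurd (τ i).2.1 (not_le.2 h)
    simp [this]
  induction n generalizing κ with
  | zero =>
    have : {τ : Fin 0 → I | BeforeGood t p κ s α τ} = ∅ :=
      eq_empty_of_forall_notMem fun τ ⟨i, _⟩ => i.elim0
    simp [this]
  | succ n ih =>
    obtain ⟨i₀, hi⟩ := exists_forall_lt hα
    have hmeas : MeasurableSet {τ | BeforeGood t p κ s α τ} :=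
      measurableSet_setOfPred.2 (measurable_beforeGood t p κ α measurable_const)
    rw [volume_eq_lintegral_insertNth i₀ hmeas]
    have hinj := hα.comp (Fin.succAbove_right_injective (p := i₀))
    have h1 := ih (κ + 1) hinj
    have h2 := ih κ hinj
    set A := ∑ l ∈ Finset.range n, p ^ l * ((s⁻¹) ^ (l + 1) * max (s - max p (t (κ + 1 + l))) 0)
      with hA
    set B := ∑ l ∈ Finset.range n, p ^ l * ((s⁻¹) ^ (l + 1) * max (s - max p (t (κ + l))) 0)
      with hB
    have hA0 : 0 ≤ A := beforeSum_nonneg hp0 (κ + 1) n hs0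
    have hB0 : 0 ≤ B := beforeSum_nonneg hp0 κ n hs0
    have key : A * p + 1 * max (s - max p (t κ)) 0 + B * (1 - s) ≤
        ∑ l ∈ Finset.range (n + 1), p ^ l * ((s⁻¹) ^ (l + 1) * max (s - max p (t (κ + l))) 0) := by
      have e1 : A * p + 1 * max (s - max p (t κ)) 0 = s * ∑ l ∈ Finset.range (n + 1),
          p ^ l * ((s⁻¹) ^ (l + 1) * max (s - max p (t (κ + l))) 0) := by
        rw [Finset.sum_range_succ', mul_add, Finset.mul_sum, hA, Finset.sum_mul]
        congr 1
        · refine Finset.sum_congr rfl fun l _ => ?_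
          rw [show κ + (l + 1) = κ + 1 + l by ring, pow_succ (s⁻¹) (l + 1)]
          have hss : s * s⁻¹ = 1 := mul_inv_cancel₀ hs.ne'
          linear_combination
            (-(p ^ (l + 1) * (s⁻¹) ^ (l + 1) * max (s - max p (t (κ + 1 + l))) 0)) * hss
        · simp only [pow_zero, zero_add, pow_one, one_mul, add_zero]
          field_simp
      have e2 : B ≤ ∑ l ∈ Finset.range (n + 1),
          p ^ l * ((s⁻¹) ^ (l + 1) * max (s - max p (t (κ + l))) 0) := by
        rw [Finset.sum_range_succ]
        exact le_add_of_nonneg_right (mul_nonneg (by positivity)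
          (mul_nonneg (by positivity) (le_max_right _ _)))
      rw [e1]
      nlinarith
    refine le_trans ?_ (ENNReal.ofReal_le_ofReal key)
    have hT0 : 0 ≤ max p (t κ) := le_max_of_le_left hp0
    have hT1 : max p (t κ) ≤ 1 := max_le hp1 (ht1 κ)
    have hmax : ENNReal.ofReal (max (s - max p (t κ)) 0) = ENNReal.ofReal (s - max p (t κ)) := by
      simp
    have hm2 : MeasurableSet {x : I | max p (t κ) ≤ (x : ℝ) ∧ (x : ℝ) < s} :=
      (measurableSet_le_coe _).inter (measurableSet_coe_lt _)
    rw [ENNReal.ofReal_add (by positivity) (mul_nonneg hB0 (by linarith)),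
      ENNReal.ofReal_add (by positivity) (by positivity), ENNReal.ofReal_mul hA0,
      ENNReal.ofReal_mul hB0, ENNReal.ofReal_mul zero_le_one, hmax,
      ← volume_coe_lt hp0 hp1, ← volume_le_coe_lt hT0 hT1 hs0 hs1, ← volume_le_coe hs0 hs1,
      ← lintegral_indicator_const (measurableSet_coe_lt p), ← lintegral_indicator_const hm2,
      ← lintegral_indicator_const (measurableSet_le_coe s),
      ← lintegral_add_left (measurable_const.indicator (measurableSet_coe_lt p)),
      ← lintegral_add_right _ (measurable_const.indicator (measurableSet_le_coe s))]
    refine lintegral_mono fun x => ?_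
    rcases lt_or_ge (x : ℝ) p with hx | hx
    · refine le_add_right (le_add_right ?_)
      rw [indicator_of_mem (show x ∈ {x : I | (x : ℝ) < p} from hx)]
      exact (measure_mono fun y hy => beforeGood_of_insertNth_of_lt hi hx hy).trans h1
    rcases lt_or_ge (x : ℝ) s with hxs | hxs
    · refine le_add_right (le_add_left ?_)
      by_cases h : max p (t κ) ≤ x
      · rw [indicator_of_mem (show x ∈ {x : I | max p (t κ) ≤ (x : ℝ) ∧ (x : ℝ) < s} from
          ⟨h, hxs⟩), ENNReal.ofReal_one]
        exact prob_le_one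
      · have : {y : Fin n → I | i₀.insertNth x y ∈ {τ | BeforeGood t p κ s α τ}} = ∅ :=
          eq_empty_of_forall_notMem fun y hy =>
            h (max_le hx (threshold_le_of_beforeGood hi hx hxs hy))
        rw [this, measure_empty]
        exact zero_le
    · refine le_add_left ?_
      rw [indicator_of_mem (show x ∈ {x : I | s ≤ (x : ℝ)} from hxs)]
      exact (measure_mono fun y hy => beforeGood_of_insertNth_of_le hx hxs hy).trans h2

theorem continuous_inv_pow_mul_posPart {T : ℝ} (hT : 0 < T) (l : ℕ) :
    Continuous fun s : ℝ => (s⁻¹) ^ (l + 1) * max (s - T) 0 := by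
  rw [continuous_iff_continuousAt]
  intro s
  rcases lt_or_ge s T with h | h
  · have : (fun s : ℝ => (s⁻¹) ^ (l + 1) * max (s - T) 0) =ᶠ[nhds s] fun _ => 0 := by
      filter_upwards [Iio_mem_nhds h] with x hx
      rw [max_eq_right (by linarith [show x < T from hx]), mul_zero]
    exact continuousAt_const.congr this.symm
  · have h0 : s ≠ 0 := (hT.trans_le h).ne'
    exact ((continuousAt_inv₀ h0).pow _).mul (by fun_prop)

theorem sum_shift_add_le (J : ℕ → ℕ → ℝ) {p : ℝ} (hp0 : 0 ≤ p) (hJ : ∀ l k, 0 ≤ J l k) (κ n : ℕ) :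
    (∑ N ∈ Finset.range n, p ^ N * ∑ l ∈ Finset.range (N + 1), J l (κ + 1 + N)) * p +
      ∑ l ∈ Finset.range n, p ^ l * J l (κ + l) ≤
    ∑ N ∈ Finset.range (n + 1), p ^ N * ∑ l ∈ Finset.range (N + 1), J l (κ + N) := by
  have h : ∑ N ∈ Finset.range (n + 1), p ^ N * ∑ l ∈ Finset.range (N + 1), J l (κ + N) =
      ∑ N ∈ Finset.range (n + 1), p ^ N * ∑ l ∈ Finset.range N, J l (κ + N) +
      ∑ N ∈ Finset.range (n + 1), p ^ N * J N (κ + N) := by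
    rw [← Finset.sum_add_distrib]
    refine Finset.sum_congr rfl fun N _ => ?_
    rw [Finset.sum_range_succ, mul_add]
  rw [h, Finset.sum_range_succ' (fun N => p ^ N * ∑ l ∈ Finset.range N, J l (κ + N)),
    Finset.sum_range_succ (fun N => p ^ N * J N (κ + N)), Finset.sum_mul]
  have h1 : ∀ N ∈ Finset.range n, p ^ N * (∑ l ∈ Finset.range (N + 1), J l (κ + 1 + N)) * p =
      p ^ (N + 1) * ∑ l ∈ Finset.range (N + 1), J l (κ + (N + 1)) := fun N _ => by
    rw [show κ + (N + 1) = κ + 1 + N by ring]; ring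
  rw [Finset.sum_congr rfl h1]
  have := mul_nonneg (pow_nonneg hp0 n) (hJ n (κ + n))
  simp only [Finset.range_zero, Finset.sum_empty, mul_zero, add_zero]
  linarith

theorem volume_secondGood_le {t : ℕ → ℝ} {p : ℝ} (ht0 : ∀ k, 0 < t k) (ht1 : ∀ k, t k ≤ 1)
    (hp0 : 0 ≤ p) (hp1 : p ≤ 1) {n : ℕ} (κ : ℕ) {α : Fin n → ℝ} (hα : Function.Injective α) :
    volume {τ | SecondGood t p κ α τ} ≤ ENNReal.ofReal
      (∑ N ∈ Finset.range n, p ^ N * ∑ l ∈ Finset.range (N + 1),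
        ∫ s in p..1, (s⁻¹) ^ (l + 1) * max (s - max p (t (κ + N))) 0) := by
  have hJ : ∀ l T, 0 ≤ ∫ s in p..1, (s⁻¹) ^ (l + 1) * max (s - T) 0 := fun l T =>
    intervalIntegral.integral_nonneg hp1 fun s hs => mul_nonneg
      (pow_nonneg (inv_nonneg.2 (hp0.trans hs.1)) _) (le_max_right _ _)
  have hcont : ∀ k l, Continuous fun s : ℝ => (s⁻¹) ^ (l + 1) * max (s - max p (t k)) 0 :=
    fun k l => continuous_inv_pow_mul_posPart (lt_max_of_lt_right (ht0 k)) l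
  induction n generalizing κ with
  | zero =>
    have : {τ : Fin 0 → I | SecondGood t p κ α τ} = ∅ :=
      eq_empty_of_forall_notMem fun τ ⟨i, _⟩ => i.elim0
    simp [this]
  | succ n ih =>
    obtain ⟨i₀, hi⟩ := exists_forall_lt hα
    rw [volume_eq_lintegral_insertNth i₀ (measurableSet_secondGood t p κ α)]
    have hinj := hα.comp (Fin.succAbove_right_injective (p := i₀))
    have h1 := ih (κ + 1) hinj
    set A := ∑ N ∈ Finset.range n, p ^ N * ∑ l ∈ Finset.range (N + 1),
        ∫ s in p..1, (s⁻¹) ^ (l + 1) * max (s - max p (t (κ + 1 + N))) 0 with hA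
    have hA0 : 0 ≤ A := Finset.sum_nonneg fun N _ => mul_nonneg (by positivity)
      (Finset.sum_nonneg fun l _ => hJ _ _)
    let D : ℝ → ℝ := fun s =>
      ∑ l ∈ Finset.range n, p ^ l * ((s⁻¹) ^ (l + 1) * max (s - max p (t (κ + l))) 0)
    have hD : Continuous D := continuous_finsetSum _ fun l _ => continuous_const.mul (hcont _ l)
    have hDint : ∫ s in p..1, D s = ∑ l ∈ Finset.range n,
        p ^ l * ∫ s in p..1, (s⁻¹) ^ (l + 1) * max (s - max p (t (κ + l))) 0 := by
      rw [intervalIntegral.integral_finsetSum fun l _ =>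
        ((hcont _ l).intervalIntegrable _ _).const_mul _]
      simp only [intervalIntegral.integral_const_mul]
    have key : A * p + ∫ s in p..1, D s ≤ ∑ N ∈ Finset.range (n + 1), p ^ N *
        ∑ l ∈ Finset.range (N + 1),
          ∫ s in p..1, (s⁻¹) ^ (l + 1) * max (s - max p (t (κ + N))) 0 := by
      rw [hDint]
      refine sum_shift_add_le (fun l k => ∫ s in p..1, (s⁻¹) ^ (l + 1) * max (s - max p (t k)) 0)
        hp0 (fun l k => hJ l _) κ n
    refine le_trans ?_ (ENNReal.ofReal_le_ofReal key)
    obtain ⟨hi1, hi2⟩ := integral_ite_lt (A := 0) hp0 hp1 hD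
    rw [mul_zero, zero_add] at hi2
    have hD0 : ∀ s, 0 ≤ s → 0 ≤ D s := fun s hs => beforeSum_nonneg hp0 κ n hs
    rw [ENNReal.ofReal_add (by positivity) (intervalIntegral.integral_nonneg hp1 fun s hs =>
      hD0 s (hp0.trans hs.1)), ← hi2, ← lintegral_unitInterval_ofReal hi1 ?_,
      ENNReal.ofReal_mul hA0, ← volume_coe_lt hp0 hp1,
      ← lintegral_indicator_const (measurableSet_coe_lt p),
      ← lintegral_add_left (measurable_const.indicator (measurableSet_coe_lt p))]
    swap
    · intro s hs
      split_ifs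
      · exact le_rfl
      · exact hD0 s hs.1
    refine lintegral_mono fun x => ?_
    rcases lt_or_ge (x : ℝ) p with hx | hx
    · refine le_add_right ?_
      rw [indicator_of_mem (show x ∈ {x : I | (x : ℝ) < p} from hx)]
      exact (measure_mono fun y hy => secondGood_of_insertNth_of_lt hi hx hy).trans h1
    · refine le_add_left ?_
      rw [if_neg (not_lt.2 hx)]
      exact (measure_mono fun y hy => beforeGood_of_secondGood_insertNth hi hx hy).trans
        (volume_beforeGood_le ht1 hp0 hp1 κ hinj x.2.1 x.2.2 hx)

end ROSp
namespace ROSp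
open Set
open scoped unitInterval

theorem sum_integral_kernel (N : ℕ) {p : ℝ} (hp1 : p ≤ 1) :
    ∑ l ∈ Finset.range (N + 1), ∫ s in p..1, (s⁻¹) ^ (l + 1) * max (s - max p (threshold N)) 0 =
      ∫ s in max p (threshold N)..1, lookahead N s := by
  set T := max p (threshold N) with hT
  have hT0 : 0 < T := lt_max_of_lt_right (threshold_pos N)
  have hT1 : T ≤ 1 := max_le hp1 (threshold_lt_one N).le
  have hpT : p ≤ T := le_max_left _ _
  have hc := fun l => continuous_inv_pow_mul_posPart hT0 l
  have h1 : ∀ l ∈ Finset.range (N + 1), ∫ s in p..1, (s⁻¹) ^ (l + 1) * max (s - T) 0 =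
      ∫ s in T..1, (s⁻¹) ^ (l + 1) * (s - T) := fun l _ => by
    rw [← intervalIntegral.integral_add_adjacent_intervals
      ((hc l).intervalIntegrable p T) ((hc l).intervalIntegrable T 1),
      intervalIntegral.integral_congr (a := p) (b := T) (g := fun _ => (0 : ℝ)) fun s hs => ?_,
      intervalIntegral.integral_congr (a := T) (b := 1)
        (g := fun s => (s⁻¹) ^ (l + 1) * (s - T)) fun s hs => ?_]
    · simp
    · rw [uIcc_of_le hT1] at hs
      simp only [max_eq_left (sub_nonneg.2 hs.1)]
    · rw [uIcc_of_le hpT] at hs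
      simp only [max_eq_right (sub_nonpos.2 hs.2), mul_zero]
  have hpos : ∀ s ∈ uIcc T 1, 0 < s := fun s hs => by
    rw [uIcc_of_le hT1] at hs; exact hT0.trans_le hs.1
  have hci : ∀ l, ContinuousOn (fun s : ℝ => (s⁻¹) ^ (l + 1)) (uIcc T 1) := fun l =>
    (continuousOn_inv₀.mono fun s hs => (hpos s hs).ne').pow _
  have hcl : ContinuousOn (lookahead N) (uIcc T 1) :=
    (continuousOn_lookahead N).mono fun s hs => hpos s hs
  have hcs : ContinuousOn (fun s : ℝ => ∑ l ∈ Finset.range (N + 1), (s⁻¹) ^ (l + 1) * (s - T))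
      (uIcc T 1) := continuousOn_finsetSum _ fun l _ => (hci l).mul (by fun_prop)
  have hli : ∀ l ∈ Finset.range (N + 1),
      IntervalIntegrable (fun s : ℝ => (s⁻¹) ^ (l + 1) * (s - T)) volume T 1 := fun l _ =>
    ((hci l).mul (by fun_prop)).intervalIntegrable
  rw [Finset.sum_congr rfl h1, ← intervalIntegral.integral_finsetSum hli]
  have hparts := intervalIntegral.integral_eq_sub_of_hasDerivAt (a := T) (b := 1)
    (f := fun s => lookahead N s * (s - T))
    (f' := fun s => lookahead N s - ∑ l ∈ Finset.range (N + 1), (s⁻¹) ^ (l + 1) * (s - T))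
    (fun s hs => by
      have := (hasDerivAt_lookahead N (hpos s hs)).mul ((hasDerivAt_id s).sub_const T)
      refine this.congr_deriv ?_
      rw [← Finset.sum_mul]
      simp only [id]; ring)
    (hcl.sub hcs).intervalIntegrable
  rw [intervalIntegral.integral_sub hcl.intervalIntegrable hcs.intervalIntegrable,
    lookahead_one] at hparts
  linarith

theorem integral_gain_eq (N : ℕ) {p : ℝ} (hp0 : 0 ≤ p) (hp1 : p ≤ 1) :
    ∫ τ in p..1, gain N τ =
      (1 - max p (threshold N)) - ∫ s in max p (threshold N)..1, lookahead N s := by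
  set T := max p (threshold N) with hT
  have hT0 : 0 < T := lt_max_of_lt_right (threshold_pos N)
  have hT1 : T ≤ 1 := max_le hp1 (threshold_lt_one N).le
  have hpT : p ≤ T := le_max_left _ _
  have h1 : ∫ τ in p..T, gain N τ = 0 := by
    rcases le_total p (threshold N) with h | h
    · rw [intervalIntegral.integral_congr_ae (g := fun _ => (0 : ℝ))]
      · simp
      · refine Filter.Eventually.of_forall fun x hx => ?_
        rw [uIoc_of_le hpT, hT, max_eq_right h] at hx
        exact gain_of_le_threshold N (hp0.trans_lt hx.1) hx.2
    · rw [hT, max_eq_left h, intervalIntegral.integral_same]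
  have h2 : ∫ τ in T..1, gain N τ = ∫ τ in T..1, (1 - lookahead N τ) := by
    refine intervalIntegral.integral_congr fun x hx => ?_
    rw [uIcc_of_le hT1] at hx
    exact gain_of_threshold_le N ((le_max_right _ _).trans hx.1) hx.2
  rw [← intervalIntegral.integral_add_adjacent_intervals (gain_intervalIntegrable N hp0 hpT)
    (gain_intervalIntegrable N hT0.le hT1), h1, h2, intervalIntegral.integral_sub (by simp)]
  · simp
  · refine ContinuousOn.intervalIntegrable ((continuousOn_lookahead N).mono fun s hs => ?_)
    rw [uIcc_of_le hT1] at hs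
    exact hT0.trans_le hs.1

theorem nthLargest_lt_iff (S : Finset ℝ) (k : ℕ) {v : ℝ} (hv : v ∉ S) :
    nthLargest S k < (v : WithBot ℝ) ↔ (S.filter (v < ·)).card ≤ k := by
  set l := S.sort (· ≥ ·) with hl
  have hlen : l.length = S.card := Finset.length_sort _
  have hsorted : ∀ i j : ℕ, ∀ (hi : i < l.length) (hj : j < l.length), i < j → l[j] < l[i] := by
    intro i j hi hj hij
    have h1 := List.pairwise_iff_getElem.1 (Finset.pairwise_sort S (· ≥ ·)) i j hi hj hij
    exact lt_of_le_of_ne h1 fun e =>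
      hij.ne' ((Finset.sort_nodup S (· ≥ ·)).getElem_inj_iff.1 e)
  have hmem : ∀ i (hi : i < l.length), l[i] ∈ S := fun i hi =>
    (Finset.mem_sort (· ≥ ·)).1 (List.getElem_mem hi)
  have hdef : nthLargest S k = match l[k]? with
    | some v => (v : WithBot ℝ)
    | none => ⊥ := rfl
  rcases lt_or_ge k l.length with hk | hk
  · rw [hdef, List.getElem?_eq_getElem hk]
    simp only [WithBot.coe_lt_coe]
    constructor
    · intro h
      have hsub : S.filter (v < ·) ⊆ (Finset.range k).image fun i => l.getD i 0 := by
        intro x hx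
        rw [Finset.mem_filter] at hx
        obtain ⟨i, hi, rfl⟩ := List.getElem_of_mem ((Finset.mem_sort (· ≥ ·)).2 hx.1)
        rw [Finset.mem_image]
        refine ⟨i, ?_, List.getD_eq_getElem _ _ hi⟩
        rw [Finset.mem_range]
        by_contra! hki
        rcases hki.eq_or_lt with rfl | hki
        · exact lt_asymm h hx.2
        · exact lt_asymm (h.trans hx.2) (hsorted _ _ hk hi hki)
      exact (Finset.card_le_card hsub).trans (Finset.card_image_le.trans (by simp))
    · intro h
      by_contra! hle
      have hsub : (Finset.range (k + 1)).image (fun i => l.getD i 0) ⊆ S.filter (v < ·) := by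
        intro x hx
        obtain ⟨i, hi, rfl⟩ := Finset.mem_image.1 hx
        rw [Finset.mem_range] at hi
        have hil : i < l.length := by omega
        rw [List.getD_eq_getElem _ _ hil, Finset.mem_filter]
        refine ⟨hmem i hil, lt_of_lt_of_le (hle.lt_of_ne ?_) ?_⟩
        · rintro rfl; exact hv (hmem k hk)
        · rcases (Nat.lt_succ_iff.1 hi).eq_or_lt with rfl | hik
          · exact le_rfl
          · exact (hsorted _ _ hil hk hik).le
      have hcard := Finset.card_le_card hsub
      rw [Finset.card_image_of_injOn, Finset.card_range] at hcard
      · omega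
      · intro i hi j hj hij
        simp only [Finset.coe_range, mem_Iio] at hi hj
        simp only at hij
        rw [List.getD_eq_getElem _ _ (show i < l.length by omega),
          List.getD_eq_getElem _ _ (show j < l.length by omega)] at hij
        exact (Finset.sort_nodup S (· ≥ ·)).getElem_inj_iff.1 hij
  · rw [hdef, List.getElem?_eq_none hk]
    simp only [WithBot.bot_lt_coe, true_iff]
    exact (Finset.card_filter_le _ _).trans (by omega)

theorem card_filter_sampleValues {n : ℕ} (p : ℝ) (α : Fin n ↪ ℝ) (τ : Fin n → I) (i : Fin n) :
    ((sampleValues p α τ).filter (α i < ·)).card = countAbove p α τ i := by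
  classical
  rw [sampleValues, Finset.filter_map, Finset.card_map, countAbove, Finset.filter_filter,
    Finset.card_filter]
  rfl

theorem notMem_sampleValues {n : ℕ} {p : ℝ} {α : Fin n ↪ ℝ} {τ : Fin n → I} {i : Fin n}
    (h : p ≤ τ i) : α i ∉ sampleValues p α τ := by
  classical
  rw [sampleValues]
  simpa using h

theorem exists_threshold_index {x : ℝ} (hx1 : x < 1) (m : ℕ) :
    (∃ k, threshold k ≤ x ∧ x < threshold (k + 1) ∧ m ≤ k) ↔ threshold m ≤ x := by
  constructor
  · rintro ⟨k, h1, -, h3⟩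
    exact (threshold_strictMono.monotone h3).trans h1
  · intro h
    have hex := exists_lt_threshold hx1
    classical
    have hpos : m < Nat.find hex := by
      by_contra! hle
      exact absurd (Nat.find_spec hex)
        (not_lt.2 ((threshold_strictMono.monotone hle).trans h))
    obtain ⟨k, hk⟩ : ∃ k, Nat.find hex = k + 1 := ⟨Nat.find hex - 1, by omega⟩
    refine ⟨k, not_lt.1 (Nat.find_min hex (by omega)), ?_, by omega⟩
    rw [← hk]; exact Nat.find_spec hex

theorem acceptable_threshold_iff {n : ℕ} {p : ℝ} {α : Fin n ↪ ℝ} {τ : Fin n → I}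
    (hτ : ∀ i, (τ i : ℝ) < 1) (i : Fin n) :
    Acceptable threshold p α τ i ↔ p ≤ τ i ∧ (∀ j, p ≤ τ j → τ j < τ i → α j < α i) ∧
      threshold (countAbove p α τ i) ≤ τ i := by
  refine and_congr_right fun hp => and_congr_right fun _ => ?_
  rw [← exists_threshold_index (hτ i)]
  refine exists_congr fun k => and_congr_right fun _ => and_congr_right fun _ => ?_
  rw [nthLargest_lt_iff _ _ (notMem_sampleValues hp), card_filter_sampleValues]

theorem countAbove_anti {n : ℕ} {p : ℝ} {α : Fin n → ℝ} {τ : Fin n → I} {i j : Fin n}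
    (h : α i ≤ α j) : countAbove p α τ j ≤ countAbove p α τ i := by
  classical
  refine Finset.sum_le_sum fun k _ => ?_
  split_ifs with h1 h2
  · exact le_rfl
  · exact absurd ⟨h1.1, h.trans_lt h1.2⟩ h2
  · exact Nat.zero_le _
  · exact le_rfl

theorem wins_of_lastGood {n : ℕ} {p : ℝ} {α : Fin n ↪ ℝ} {τ : Fin n → I}
    (hτ : ∀ i, (τ i : ℝ) < 1) (h1 : LastGood threshold p 0 α τ)
    (h2 : ¬ SecondGood threshold p 0 α τ) : Wins threshold p α τ := by
  rcases h1 with h1 | ⟨i, hi, hmax, hth⟩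
  · exact Or.inl h1
  refine Or.inr ⟨i, ⟨(acceptable_threshold_iff hτ i).2 ⟨hi, fun j hj hji => ?_, ?_⟩, ?_⟩, hmax⟩
  · exact (hmax j hj).lt_of_ne fun e => hji.ne (congrArg τ (α.injective e))
  · rwa [zero_add] at hth
  · intro j hji hacc
    obtain ⟨hj, hrec, hjth⟩ := (acceptable_threshold_iff hτ j).1 hacc
    classical
    obtain ⟨m, hm, hmmax⟩ := (Finset.univ.filter fun m => p ≤ τ m ∧ τ m < τ i).exists_max_image α
      ⟨j, by simp [hj, hji]⟩
    simp only [Finset.mem_filter, Finset.mem_univ, true_and] at hm hmmax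
    refine h2 ⟨i, hi, hmax, m, hm.1, hm.2, fun k hk hk' => hmmax k ⟨hk, hk'⟩, ?_⟩
    rw [zero_add]
    have hjm := hmmax j ⟨hj, hji⟩
    have hle : τ j ≤ τ m := by
      by_contra! hlt
      exact absurd (hrec m hm.1 hlt) (not_lt.2 hjm)
    exact ((threshold_strictMono.monotone (countAbove_anti hjm)).trans hjth).trans hle

theorem ae_forall_coe_lt_one (n : ℕ) : ∀ᵐ τ : Fin n → I, ∀ i, (τ i : ℝ) < 1 := by
  rw [ae_all_iff]
  intro i
  have h : ∀ᵐ x : I, (x : ℝ) < 1 := by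
    have : ∀ᵐ x : I, x ≠ 1 := by simp [ae_iff]
    filter_upwards [this] with x hx
    exact x.2.2.lt_of_ne fun e => hx (Subtype.ext e)
  exact (Measure.quasiMeasurePreserving_eval (μ := fun _ : Fin n => (volume : Measure I)) i).ae h

theorem le_algWinProb {n : ℕ} {p : ℝ} (hp0 : 0 ≤ p) (hp1 : p ≤ 1) (α : Fin n ↪ ℝ) :
    p ^ n + ∑ k ∈ Finset.range n, p ^ k * ∫ τ in p..1, gain k τ ≤
      algWinProb threshold p α := by
  have ht1 := fun k => (threshold_lt_one k).le
  have hL := le_volume_lastGood ht1 hp0 hp1 0 α.injective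
  have hS := volume_secondGood_le threshold_pos ht1 hp0 hp1 0 α.injective
  simp only [zero_add, sum_integral_kernel _ hp1] at hL hS
  have hsub : volume ({τ | LastGood threshold p 0 α τ} \ {τ | SecondGood threshold p 0 α τ}) ≤
      volume {τ : Fin n → I | Wins threshold p α τ} := by
    refine measure_mono_ae ?_
    filter_upwards [ae_forall_coe_lt_one n] with τ hτ hd
    exact wins_of_lastGood hτ hd.1 hd.2
  have h1 := (tsub_le_tsub hL hS).trans (le_measure_sdiff.trans hsub)
  rw [← ENNReal.ofReal_sub _ ?_] at h1
  swap
  · refine Finset.sum_nonneg fun k _ => mul_nonneg (by positivity)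
      (intervalIntegral.integral_nonneg (max_le hp1 (ht1 k)) fun s hs => ?_)
    exact lookahead_nonneg k ((lt_max_of_lt_right (threshold_pos k)).trans_le hs.1) hs.2
  refine le_trans (le_of_eq ?_) ((ENNReal.ofReal_le_iff_le_toReal (measure_ne_top _ _)).1 h1)
  rw [add_sub_assoc, ← Finset.sum_sub_distrib]
  congr 1
  refine Finset.sum_congr rfl fun k _ => ?_
  rw [integral_gain_eq k hp0 hp1]; ring

theorem optValue_le_algWinProb {n : ℕ} {p : ℝ} (hp0 : 0 ≤ p) (hp1 : p < 1) (α : Fin n ↪ ℝ) :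
    optValue p ≤ algWinProb threshold p α := by
  refine le_trans ?_ (le_algWinProb hp0 hp1.le α)
  have hs := summable_integral_gain hp0 hp1
  rw [optValue, ← hs.sum_add_tsum_nat_add n, add_comm]
  gcongr
  have hg := (summable_geometric_of_lt_one hp0 hp1).mul_left (p ^ n * (1 - p))
  have h : ∑' k : ℕ, p ^ n * (1 - p) * p ^ k = p ^ n := by
    rw [tsum_mul_left, tsum_geometric_of_lt_one hp0 hp1, mul_assoc,
      mul_inv_cancel₀ (by linarith), mul_one]
  rw [← h]
  refine ((summable_nat_add_iff n).2 hs).tsum_le_tsum (fun k => ?_) hg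
  have := mul_le_mul_of_nonneg_left (integral_gain_le (k + n) hp0 hp1.le)
    (pow_nonneg hp0 (k + n))
  rw [pow_add] at this ⊢
  linarith

end ROSp
namespace ROSp

/-! ### Sampling the elements in the first positions of a uniformly random order -/

/-- The first `s` positions. -/
def initPos (n s : ℕ) : Finset (Fin n) := Finset.univ.filter fun k => (k : ℕ) < s

/-- The list of the positions from `s` on. -/
def lastPos (n s : ℕ) : List (Fin n) := (List.finRange n).filter fun k => s ≤ (k : ℕ)

theorem exists_perm_initPos {n : ℕ} (P : Finset (Fin n)) :
    ∃ e : Equiv.Perm (Fin n), P.map e.toEmbedding = initPos n P.card ∧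
      ((List.finRange n).filter (· ∉ P)).map e = lastPos n P.card := by
  have hcard : P.card + Pᶜ.card = n := by simp
  let E := finSumEquivOfFinset (s := P) rfl rfl
  let e : Equiv.Perm (Fin n) := E.symm.trans (finSumFinEquiv.trans (finCongr hcard))
  have hin : ∀ i : Fin P.card, ((e (P.orderEmbOfFin rfl i) : Fin n) : ℕ) = i := fun i => by
    have : E.symm (P.orderEmbOfFin rfl i) = Sum.inl i := by
      rw [Equiv.symm_apply_eq]; rfl
    simp [e, this]
  have hout : ∀ i : Fin Pᶜ.card, ((e (Pᶜ.orderEmbOfFin rfl i) : Fin n) : ℕ) = P.card + i :=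
    fun i => by
      have : E.symm (Pᶜ.orderEmbOfFin rfl i) = Sum.inr i := by
        rw [Equiv.symm_apply_eq]; rfl
      simp [e, this]
  have hmem : ∀ i, (e i : ℕ) < P.card ↔ i ∈ P := fun i => by
    by_cases hi : i ∈ P
    · obtain ⟨j, rfl⟩ : i ∈ Set.range (P.orderEmbOfFin rfl) := by
        rw [Finset.range_orderEmbOfFin]; exact hi
      simp [hin]
    · obtain ⟨j, rfl⟩ : i ∈ Set.range (Pᶜ.orderEmbOfFin rfl) := by
        rw [Finset.range_orderEmbOfFin]; simpa using hi
      simp only [hout, hi, iff_false]; omega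
  have hmono : ∀ i j, i ∉ P → j ∉ P → i < j → e i < e j := fun i j hi hj hij => by
    obtain ⟨i, rfl⟩ : i ∈ Set.range (Pᶜ.orderEmbOfFin rfl) := by
      rw [Finset.range_orderEmbOfFin]; simpa using hi
    obtain ⟨j, rfl⟩ : j ∈ Set.range (Pᶜ.orderEmbOfFin rfl) := by
      rw [Finset.range_orderEmbOfFin]; simpa using hj
    rw [Fin.lt_def, hout, hout]
    have := (Pᶜ.orderEmbOfFin rfl).lt_iff_lt.1 hij
    omega
  refine ⟨e, ?_, ?_⟩
  · ext k
    simp only [initPos, Finset.mem_map, Equiv.coe_toEmbedding, Finset.mem_filter, Finset.mem_univ,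
      true_and]
    constructor
    · rintro ⟨i, hi, rfl⟩; exact (hmem i).2 hi
    · intro hk
      exact ⟨e.symm k, (hmem _).1 (by simpa using hk), e.apply_symm_apply k⟩
  · have hs1 : (((List.finRange n).filter (· ∉ P)).map e).Pairwise (· < ·) := by
      rw [List.pairwise_map, List.pairwise_filter]
      refine (List.pairwise_lt_finRange n).imp fun {i j} hij hi hj => ?_
      exact hmono i j (by simpa using hi) (by simpa using hj) hij
    have hs2 : (lastPos n P.card).Pairwise (· < ·) := (List.pairwise_lt_finRange n).filter _
    refine List.Perm.eq_of_pairwise' hs1 hs2 ?_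
    rw [List.perm_ext_iff_of_nodup (hs1.imp fun h => h.ne) (hs2.imp fun h => h.ne)]
    intro k
    simp only [lastPos, List.mem_map, List.mem_filter, List.mem_finRange, true_and,
      decide_eq_true_eq]
    constructor
    · rintro ⟨i, hi, rfl⟩; exact not_lt.1 fun h => hi ((hmem i).1 h)
    · intro hk
      refine ⟨e.symm k, fun h => ?_, e.apply_symm_apply k⟩
      have := (hmem _).2 h
      rw [Equiv.apply_symm_apply] at this; omega

theorem sum_sample_sum_perm {n : ℕ} (w : ℕ → ℝ) (F : Finset (Fin n) → List (Fin n) → ℝ) :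
    ∑ S : Finset (Fin n), w S.card *
      ∑ σ : Equiv.Perm (Fin n), F S ((List.ofFn σ).filter (fun i => i ∉ S)) =
    ∑ s ∈ Finset.range (n + 1), (n.choose s : ℝ) * (w s * ∑ π : Equiv.Perm (Fin n),
      F ((initPos n s).map π.toEmbedding) ((lastPos n s).map π)) := by
  have h1 : ∀ σ : Equiv.Perm (Fin n),
      ∑ S : Finset (Fin n), w S.card * F S ((List.ofFn σ).filter (fun i => i ∉ S)) =
      ∑ P : Finset (Fin n), w P.card *
        F (P.map σ.toEmbedding) (((List.finRange n).filter (· ∉ P)).map σ) := fun σ => by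
    rw [← σ.finsetCongr.sum_comp]
    refine Finset.sum_congr rfl fun P _ => ?_
    rw [List.ofFn_eq_map, List.filter_map]
    simp only [Equiv.finsetCongr_apply, Finset.card_map, Function.comp_def]
    congr 4
    funext i
    simp
  have h2 : ∀ P : Finset (Fin n), ∑ σ : Equiv.Perm (Fin n),
      F (P.map σ.toEmbedding) (((List.finRange n).filter (· ∉ P)).map σ) =
      ∑ π : Equiv.Perm (Fin n),
        F ((initPos n P.card).map π.toEmbedding) ((lastPos n P.card).map π) := fun P => by
    obtain ⟨e, he1, he2⟩ := exists_perm_initPos P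
    rw [← Equiv.sum_comp (Equiv.mulRight e)]
    refine Finset.sum_congr rfl fun π _ => ?_
    rw [← he1, ← he2, Finset.map_map, List.map_map]
    rfl
  simp only [Finset.mul_sum]
  rw [Finset.sum_comm]
  simp only [h1]
  rw [Finset.sum_comm]
  simp only [← Finset.mul_sum, h2]
  have := Finset.sum_powerset_apply_card (fun s => w s * ∑ π : Equiv.Perm (Fin n),
    F ((initPos n s).map π.toEmbedding) ((lastPos n s).map π)) (x := (Finset.univ : Finset (Fin n)))
  simpa [nsmul_eq_mul] using this

/-- The online values when the elements in the first `s` positions of the order `π` are sampled. -/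
def onlineList {n : ℕ} (α : Fin n → ℝ) (s : ℕ) (π : Equiv.Perm (Fin n)) : List ℝ :=
  (lastPos n s).map fun k => α (π k)

/-- The sampled values when the elements in the first `s` positions of the order `π` are sampled. -/
noncomputable def sampleSet {n : ℕ} (α : Fin n → ℝ) (s : ℕ) (π : Equiv.Perm (Fin n)) : Finset ℝ :=
  (initPos n s).image fun k => α (π k)

theorem winProb_eq_sum (p : ℝ) (A : Algorithm) {n : ℕ} (α : Fin n ↪ ℝ) :
    winProb p A α = ∑ s ∈ Finset.range (n + 1), (n.choose s : ℝ) * (p ^ s * (1 - p) ^ (n - s) *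
      ((∑ π : Equiv.Perm (Fin n), winProbOnList (A n (sampleSet α s π)) (onlineList α s π)) /
        (n.factorial : ℝ))) := by
  have := sum_sample_sum_perm (n := n) (fun s => p ^ s * (1 - p) ^ (n - s) / (n.factorial : ℝ))
    (fun S L => winProbOnList (A n (S.map α)) (L.map α))
  rw [winProb]
  refine Eq.trans (Finset.sum_congr rfl fun S _ => ?_)
    (this.trans (Finset.sum_congr rfl fun s _ => ?_))
  · simp only [onlineValues]; ring
  · have h : ∀ π : Equiv.Perm (Fin n), winProbOnList
        (A n (((initPos n s).map π.toEmbedding).map α)) (((lastPos n s).map π).map α) =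
        winProbOnList (A n (sampleSet α s π)) (onlineList α s π) := fun π => by
      rw [List.map_map, sampleSet, Finset.map_map, Finset.map_eq_image]
      rfl
    simp only [h]; ring

end ROSp
namespace ROSp

/-! ### Rapidly increasing instances -/

open Filter Topology

/-- The law (an ultrafilter) of a sequence of `n` values, each of which is infinitely large
compared to the preceding ones. -/
noncomputable def fastUltrafilter : (n : ℕ) → Ultrafilter (Fin n → ℝ)
  | 0 => pure Fin.elim0
  | n + 1 => (Ultrafilter.of atTop : Ultrafilter ℝ).bind fun x =>
      (fastUltrafilter n).map (Fin.cons (α := fun _ => ℝ) x)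

theorem eventually_fastUltrafilter_succ {n : ℕ} {P : (Fin (n + 1) → ℝ) → Prop} :
    (∀ᶠ α in (fastUltrafilter (n + 1) : Filter (Fin (n + 1) → ℝ)), P α) ↔
      ∀ᶠ x in (Ultrafilter.of atTop : Ultrafilter ℝ), ∀ᶠ α in (fastUltrafilter n : Filter (Fin n → ℝ)),
        P (Fin.cons x α) := Iff.rfl

theorem eventually_fastUltrafilter_comp_succAbove {n : ℕ} (i : Fin (n + 1))
    (P : (Fin n → ℝ) → Prop) :
    (∀ᶠ α in (fastUltrafilter (n + 1) : Filter (Fin (n + 1) → ℝ)), P fun j => α (i.succAbove j)) ↔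
      ∀ᶠ α in (fastUltrafilter n : Filter (Fin n → ℝ)), P α := by
  induction n with
  | zero =>
    obtain rfl : i = 0 := Fin.fin_one_eq_zero i
    rw [eventually_fastUltrafilter_succ]
    simp
  | succ n ih =>
    rw [eventually_fastUltrafilter_succ]
    refine Fin.cases ?_ (fun i => ?_) i
    · simp
    · rw [eventually_fastUltrafilter_succ]
      have h : ∀ (x : ℝ) (α : Fin (n + 1) → ℝ),
          (fun j => (Fin.cons x α : Fin (n + 2) → ℝ) (i.succ.succAbove j)) =
            (Fin.cons x fun j => α (i.succAbove j) : Fin (n + 1) → ℝ) := fun x α => by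
        funext j
        refine Fin.cases ?_ (fun j => ?_) j <;> simp
      simp only [h]
      exact eventually_congr (Eventually.of_forall fun x => ih i fun α => P (Fin.cons x α))

theorem map_fastUltrafilter {n : ℕ} (i : Fin (n + 1)) :
    Filter.map (fun (α : Fin (n + 1) → ℝ) j => α (i.succAbove j)) (fastUltrafilter (n + 1)) =
      fastUltrafilter n :=
  Filter.ext fun s => eventually_fastUltrafilter_comp_succAbove i (· ∈ s)

theorem eventually_strictMono_fastUltrafilter (n : ℕ) (x : ℝ) :
    ∀ᶠ α in (fastUltrafilter n : Filter (Fin n → ℝ)), StrictMono α ∧ ∀ i, x < α i := by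
  induction n generalizing x with
  | zero => exact Eventually.of_forall fun α => ⟨fun i => i.elim0, fun i => i.elim0⟩
  | succ n ih =>
    rw [eventually_fastUltrafilter_succ]
    filter_upwards [(Ultrafilter.of_le (f := (atTop : Filter ℝ))) (eventually_gt_atTop x)] with y hy
    filter_upwards [ih y] with α hα
    refine ⟨?_, fun i => ?_⟩
    · intro i j
      refine Fin.cases ?_ (fun i => ?_) i <;> refine Fin.cases ?_ (fun j => ?_) j
      · simp
      · simpa using hα.2 j
      · simp
      · simpa using fun h => hα.1 h
    · refine Fin.cases hy (fun i => ?_) i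
      exact lt_trans hy (hα.2 i)

/-- The limit of a function on instances along rapidly increasing instances. -/
noncomputable def fastLim {n : ℕ} (f : (Fin n → ℝ) → ℝ) : ℝ := limUnder ↑(fastUltrafilter n) f

theorem tendsto_fastLim {n : ℕ} {f : (Fin n → ℝ) → ℝ} (hf : ∀ α, f α ∈ Set.Icc (0 : ℝ) 1) :
    Tendsto f (fastUltrafilter n) (𝓝 (fastLim f)) := by
  refine tendsto_nhds_limUnder ?_
  obtain ⟨x, -, hx⟩ := (isCompact_Icc (a := (0 : ℝ)) (b := 1)).ultrafilter_le_nhds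
    ((fastUltrafilter n).map f) (by
      rw [le_principal_iff]
      exact Eventually.of_forall (f := (fastUltrafilter n : Filter (Fin n → ℝ))) hf)
  exact ⟨x, hx⟩

theorem fastLim_mem {n : ℕ} {f : (Fin n → ℝ) → ℝ} (hf : ∀ α, f α ∈ Set.Icc (0 : ℝ) 1) :
    fastLim f ∈ Set.Icc (0 : ℝ) 1 :=
  isClosed_Icc.mem_of_tendsto (tendsto_fastLim hf) (Eventually.of_forall hf)

theorem fastLim_comp_succAbove {n : ℕ} (i : Fin (n + 1)) (f : (Fin n → ℝ) → ℝ) :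
    (fastLim fun α => f fun j => α (i.succAbove j)) = fastLim f := by
  unfold fastLim limUnder
  rw [← map_fastUltrafilter i, Filter.map_map]
  rfl

/-! ### Inserting a last element into a permutation -/

/-- The order of `n + 1` elements that puts `i` last and arranges the others according to `σ`. -/
def insertLast {n : ℕ} (i : Fin (n + 1)) (π : Equiv.Perm (Fin n)) : Equiv.Perm (Fin (n + 1)) where
  toFun := Fin.snoc (α := fun _ => Fin (n + 1)) (fun j => i.succAbove (π j)) i
  invFun := Fin.succAboveCases i (Fin.last n) fun j => (π.symm j).castSucc
  left_inv j := by refine Fin.lastCases ?_ (fun j => ?_) j <;> simp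
  right_inv j := by refine Fin.succAboveCases i ?_ (fun j => ?_) j <;> simp

@[simp] theorem insertLast_last {n : ℕ} (i : Fin (n + 1)) (π : Equiv.Perm (Fin n)) :
    insertLast i π (Fin.last n) = i := by simp [insertLast]

@[simp] theorem insertLast_castSucc {n : ℕ} (i : Fin (n + 1)) (π : Equiv.Perm (Fin n))
    (j : Fin n) : insertLast i π j.castSucc = i.succAbove (π j) := by simp [insertLast]

theorem insertLast_bijective (n : ℕ) : Function.Bijective
    fun x : Fin (n + 1) × Equiv.Perm (Fin n) => insertLast x.1 x.2 := by
  rw [Fintype.bijective_iff_injective_and_card]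
  refine ⟨?_, by simp [Fintype.card_perm, Nat.factorial_succ]⟩
  rintro ⟨i, π⟩ ⟨i', π'⟩ h
  have hi : i = i' := by simpa using congr($h (Fin.last n))
  subst hi
  refine Prod.ext rfl (Equiv.ext fun j => ?_)
  simpa using congr($h j.castSucc)

theorem sum_perm_succ {n : ℕ} (F : Equiv.Perm (Fin (n + 1)) → ℝ) :
    ∑ π, F π = ∑ π : Equiv.Perm (Fin n), ∑ i, F (insertLast i π) := by
  rw [← (insertLast_bijective n).sum_comp F, Fintype.sum_prod_type, Finset.sum_comm]

/-- Extend a finite sequence by default values. -/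
def extend {β : Type*} [Inhabited β] {n : ℕ} (f : Fin n → β) (j : ℕ) : β :=
  if h : j < n then f ⟨j, h⟩ else default

theorem extend_of_lt {β : Type*} [Inhabited β] {n : ℕ} (f : Fin n → β) {j : ℕ} (h : j < n) :
    extend f j = f ⟨j, h⟩ := dif_pos h

theorem extend_insertLast_of_lt {β : Type*} [Inhabited β] {n : ℕ} (f : Fin (n + 1) → β)
    (i : Fin (n + 1)) (π : Equiv.Perm (Fin n)) {j : ℕ} (h : j < n) :
    extend (fun j => f (insertLast i π j)) j = extend (fun j => f (i.succAbove (π j))) j := by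
  rw [extend_of_lt _ h, extend_of_lt _ (h.trans n.lt_succ_self), ← insertLast_castSucc]
  rfl

theorem extend_insertLast_self {β : Type*} [Inhabited β] {n : ℕ} (f : Fin (n + 1) → β)
    (i : Fin (n + 1)) (π : Equiv.Perm (Fin n)) :
    extend (fun j => f (insertLast i π j)) n = f i := by
  rw [extend_of_lt _ n.lt_succ_self]
  exact congrArg f (insertLast_last i π)

end ROSp
namespace ROSp

/-! ### Records of a sequence of ranks -/

/-- The sequence of the ranks in the order `π`. -/
def rankSeq {n : ℕ} (π : Equiv.Perm (Fin n)) : ℕ → ℕ := extend fun j => (π j : ℕ)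

/-- Position `m` holds the maximum of the positions in `[s, n)`, and `k` of the positions in
`[0, s)` hold a larger value. -/
def IsLastRecord {β : Type*} [LinearOrder β] (s n m k : ℕ) (x : ℕ → β) : Prop :=
  s ≤ m ∧ m < n ∧ (∀ j, s ≤ j → j < n → j ≠ m → x j < x m) ∧
    ((Finset.range s).filter fun j => x m < x j).card = k

/-- Position `m` holds the last but one record of the positions in `[s, n)`. The numbers `k` and
`l` count the positions in `[0, s)` that hold a larger value than the last but one record and than
the last record, respectively. -/
def IsSecondLastRecord {β : Type*} [LinearOrder β] (s n m k l : ℕ) (x : ℕ → β) : Prop :=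
  ∃ M, IsLastRecord s n M l x ∧ IsLastRecord s M m k x

theorem IsLastRecord.congr {β γ : Type*} [LinearOrder β] [LinearOrder γ] {s n m k : ℕ}
    {x : ℕ → β} {y : ℕ → γ} (h : ∀ i < n, ∀ j < n, (x i < x j ↔ y i < y j)) :
    IsLastRecord s n m k x ↔ IsLastRecord s n m k y := by
  unfold IsLastRecord
  refine and_congr_right fun hs => and_congr_right fun hm => and_congr ?_ ?_
  · exact forall_congr' fun j => forall_congr' fun _ => forall_congr' fun hj => by rw [h j hj m hm]
  · rw [Finset.filter_congr fun j hj => h m hm j ((Finset.mem_range.1 hj).trans_le (hs.trans hm.le))]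

theorem rankSeq_of_lt {n : ℕ} (π : Equiv.Perm (Fin n)) {j : ℕ} (h : j < n) :
    rankSeq π j = π ⟨j, h⟩ := extend_of_lt _ h

theorem rankSeq_lt {n : ℕ} (π : Equiv.Perm (Fin n)) {j : ℕ} (h : j < n) : rankSeq π j < n := by
  rw [rankSeq_of_lt π h]; exact (π _).2

theorem rankSeq_inj {n : ℕ} (π : Equiv.Perm (Fin n)) {i j : ℕ} (hi : i < n) (hj : j < n)
    (h : rankSeq π i = rankSeq π j) : i = j := by
  rw [rankSeq_of_lt π hi, rankSeq_of_lt π hj] at h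
  simpa using π.injective (Fin.ext h)

theorem rankSeq_insertLast_self {n : ℕ} (i : Fin (n + 1)) (π : Equiv.Perm (Fin n)) :
    rankSeq (insertLast i π) n = i :=
  extend_insertLast_self (fun j : Fin (n + 1) => (j : ℕ)) i π

theorem rankSeq_insertLast_of_lt {n : ℕ} (i : Fin (n + 1)) (π : Equiv.Perm (Fin n)) {j : ℕ}
    (h : j < n) : rankSeq (insertLast i π) j =
      if rankSeq π j < i then rankSeq π j else rankSeq π j + 1 := by
  rw [rankSeq, extend_insertLast_of_lt (fun j : Fin (n + 1) => (j : ℕ)) i π h, extend_of_lt _ h,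
    rankSeq_of_lt π h, Fin.succAbove]
  simp only [Fin.lt_def, Fin.val_castSucc]
  split_ifs <;> simp

theorem rankSeq_insertLast_lt_iff {n : ℕ} (i : Fin (n + 1)) (π : Equiv.Perm (Fin n)) {j l : ℕ}
    (hj : j < n) (hl : l < n) : rankSeq (insertLast i π) j < rankSeq (insertLast i π) l ↔
      rankSeq π j < rankSeq π l := by
  rw [rankSeq_insertLast_of_lt i π hj, rankSeq_insertLast_of_lt i π hl]
  split_ifs <;> omega

theorem card_rankSeq_gt {n : ℕ} (π : Equiv.Perm (Fin n)) {v : ℕ} (hv : v < n) :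
    ((Finset.range n).filter fun j => v < rankSeq π j).card + v + 1 = n := by
  have h : ((Finset.range n).filter fun j => v < rankSeq π j).card = (Finset.Ioo v n).card := by
    refine Finset.card_bij (fun j _ => rankSeq π j) ?_ ?_ ?_
    · intro j hj
      simp only [Finset.mem_filter, Finset.mem_range] at hj
      exact Finset.mem_Ioo.2 ⟨hj.2, rankSeq_lt π hj.1⟩
    · intro j hj l hl h
      simp only [Finset.mem_filter, Finset.mem_range] at hj hl
      exact rankSeq_inj π hj.1 hl.1 h
    · intro b hb
      rw [Finset.mem_Ioo] at hb
      refine ⟨π.symm ⟨b, hb.2⟩, ?_, ?_⟩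
      · simp only [Finset.mem_filter, Finset.mem_range, Fin.is_lt, true_and]
        rw [rankSeq_of_lt π (Fin.is_lt _)]; simpa using hb.1
      · rw [rankSeq_of_lt π (Fin.is_lt _)]; simp
  rw [h, Nat.card_Ioo]; omega

theorem filter_range_eq_of_le {s n : ℕ} (hs : s ≤ n) {P : ℕ → Prop} [DecidablePred P]
    (h : ∀ j, s ≤ j → j < n → ¬ P j) :
    (Finset.range n).filter P = (Finset.range s).filter P := by
  ext j
  simp only [Finset.mem_filter, Finset.mem_range]
  constructor
  · rintro ⟨h1, h2⟩
    exact ⟨not_le.1 fun hj => h j hj h1 h2, h2⟩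
  · rintro ⟨h1, h2⟩; exact ⟨h1.trans_le hs, h2⟩

theorem IsLastRecord.rankSeq_add {n s m k : ℕ} {π : Equiv.Perm (Fin n)}
    (h : IsLastRecord s n m k (rankSeq π)) : rankSeq π m + k + 1 = n := by
  obtain ⟨hs, hm, h1, h2⟩ := h
  have h3 := card_rankSeq_gt π (rankSeq_lt π hm)
  rw [filter_range_eq_of_le (hs.trans hm.le) fun j hj hjn => ?_, h2] at h3
  · omega
  · by_cases hjm : j = m
    · subst hjm; exact lt_irrefl _
    · exact (h1 j hj hjn hjm).asymm

theorem isLastRecord_insertLast_of_lt {n s m k : ℕ} (i : Fin (n + 1)) (π : Equiv.Perm (Fin n))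
    (hm : m < n) : IsLastRecord s (n + 1) m k (rankSeq (insertLast i π)) ↔
      IsLastRecord s n m k (rankSeq π) ∧ (i : ℕ) + k < n := by
  rw [← IsLastRecord.congr fun a ha b hb => rankSeq_insertLast_lt_iff i π ha hb]
  have key : IsLastRecord s n m k (rankSeq (insertLast i π)) →
      (rankSeq (insertLast i π) n < rankSeq (insertLast i π) m ↔ (i : ℕ) + k < n) := fun h => by
    rw [IsLastRecord.congr fun a ha b hb => rankSeq_insertLast_lt_iff i π ha hb] at h
    have := h.rankSeq_add
    rw [rankSeq_insertLast_self, rankSeq_insertLast_of_lt i π hm]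
    split_ifs <;> omega
  constructor
  · rintro ⟨hs, -, h1, h2⟩
    have : IsLastRecord s n m k (rankSeq (insertLast i π)) :=
      ⟨hs, hm, fun j hj hjn => h1 j hj (by omega), h2⟩
    exact ⟨this, (key this).1 (h1 n (by omega) (by omega) (by omega))⟩
  · rintro ⟨h, hi⟩
    have h' := (key h).2 hi
    obtain ⟨hs, -, h1, h2⟩ := h
    refine ⟨hs, by omega, fun j hj hjn hjm => ?_, h2⟩
    rcases Nat.lt_succ_iff_lt_or_eq.1 hjn with h3 | rfl
    · exact h1 j hj h3 hjm
    · exact h'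

theorem isLastRecord_insertLast_self {n s k : ℕ} (i : Fin (n + 1)) (π : Equiv.Perm (Fin n))
    (hs : s ≤ n) : IsLastRecord s (n + 1) n k (rankSeq (insertLast i π)) ↔
      (i : ℕ) + k = n ∧ ∀ j, s ≤ j → j < n → rankSeq π j + k < n := by
  constructor
  · intro h
    have h3 := h.rankSeq_add
    rw [rankSeq_insertLast_self] at h3
    refine ⟨by omega, fun j hj hjn => ?_⟩
    have := h.2.2.1 j hj (by omega) (by omega)
    rw [rankSeq_insertLast_self, rankSeq_insertLast_of_lt i π hjn] at this
    split_ifs at this <;> omega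
  · rintro ⟨hi, h⟩
    have h1 : ∀ j, s ≤ j → j < n + 1 → j ≠ n →
        rankSeq (insertLast i π) j < rankSeq (insertLast i π) n := fun j hj hjn hne => by
      have hj' : j < n := by omega
      have := h j hj hj'
      rw [rankSeq_insertLast_self, rankSeq_insertLast_of_lt i π hj']
      split_ifs <;> omega
    refine ⟨hs, by omega, h1, ?_⟩
    have := (show IsLastRecord s (n + 1) n _ (rankSeq (insertLast i π)) from
      ⟨hs, by omega, h1, rfl⟩).rankSeq_add
    rw [rankSeq_insertLast_self] at this ⊢
    omega

theorem isSecondLastRecord_insertLast {n s m k l : ℕ} (i : Fin (n + 1)) (π : Equiv.Perm (Fin n)) :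
    IsSecondLastRecord s (n + 1) m k l (rankSeq (insertLast i π)) ↔
      (IsSecondLastRecord s n m k l (rankSeq π) ∧ (i : ℕ) + l < n) ∨
        (IsLastRecord s n m k (rankSeq π) ∧ (i : ℕ) + l = n ∧ l ≤ k) := by
  have hc : ∀ M ≤ n, (IsLastRecord s M m k (rankSeq (insertLast i π)) ↔
      IsLastRecord s M m k (rankSeq π)) := fun M hM => IsLastRecord.congr fun a ha b hb =>
    rankSeq_insertLast_lt_iff i π (ha.trans_le hM) (hb.trans_le hM)
  constructor
  · rintro ⟨M, h1, h2⟩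
    rcases Nat.lt_succ_iff_lt_or_eq.1 h1.2.1 with hM | rfl
    · left
      rw [isLastRecord_insertLast_of_lt i π hM] at h1
      rw [hc M hM.le] at h2
      exact ⟨⟨M, h1.1, h2⟩, h1.2⟩
    · right
      rw [isLastRecord_insertLast_self i π h1.1] at h1
      rw [hc M le_rfl] at h2
      have := h2.rankSeq_add
      have := h1.2 m h2.1 h2.2.1
      exact ⟨h2, h1.1, by omega⟩
  · rintro (⟨⟨M, h1, h2⟩, hi⟩ | ⟨h1, hi, hl⟩)
    · have hM := h1.2.1
      exact ⟨M, (isLastRecord_insertLast_of_lt i π hM).2 ⟨h1, hi⟩, (hc M hM.le).2 h2⟩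
    · refine ⟨n, ?_, (hc n le_rfl).2 h1⟩
      rw [isLastRecord_insertLast_self i π (h1.1.trans h1.2.1.le)]
      have h3 := h1.rankSeq_add
      refine ⟨hi, fun j hj hjn => ?_⟩
      by_cases hjm : j = m
      · subst hjm; omega
      · have := h1.2.2.1 j hj hjn hjm; omega

/-! ### Sums over the orders with given records -/

open Classical in
/-- The sum of `g` over the orders in which position `m` holds the last record. -/
noncomputable def lastSum {n : ℕ} (g : Equiv.Perm (Fin n) → ℝ) (s m k : ℕ) : ℝ :=
  ∑ π, if IsLastRecord s n m k (rankSeq π) then g π else 0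

open Classical in
/-- The sum of `g` over the orders in which position `m` holds the last but one record. -/
noncomputable def secondLastSum {n : ℕ} (g : Equiv.Perm (Fin n) → ℝ) (s m k l : ℕ) : ℝ :=
  ∑ π, if IsSecondLastRecord s n m k l (rankSeq π) then g π else 0

theorem card_fin_add_lt {N M k : ℕ} (hM : M ≤ N) :
    (Finset.univ.filter fun i : Fin N => (i : ℕ) + k < M).card = M - k := by
  rw [← Finset.card_map Fin.valEmbedding, ← Finset.card_range (M - k)]
  congr 1
  ext a
  simp only [Finset.mem_map, Finset.mem_filter, Finset.mem_univ, true_and, Fin.valEmbedding_apply,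
    Finset.mem_range]
  constructor
  · rintro ⟨i, hi, rfl⟩; omega
  · intro h; exact ⟨⟨a, by omega⟩, by simp; omega, rfl⟩

theorem card_fin_add_eq {n k : ℕ} (hk : k ≤ n) :
    (Finset.univ.filter fun i : Fin (n + 1) => (i : ℕ) + k = n).card = 1 := by
  rw [Finset.card_eq_one]
  refine ⟨⟨n - k, by omega⟩, ?_⟩
  ext i
  simp only [Finset.mem_filter, Finset.mem_univ, true_and, Finset.mem_singleton, Fin.ext_iff]
  omega

theorem lastSum_succ {n s m k : ℕ} {g : Equiv.Perm (Fin n) → ℝ}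
    {g' : Equiv.Perm (Fin (n + 1)) → ℝ} (hg : ∀ i π, g' (insertLast i π) = g π) (hm : m < n) :
    lastSum g' s m k = (n - k) * lastSum g s m k := by
  classical
  unfold lastSum
  rw [sum_perm_succ, Finset.mul_sum]
  refine Finset.sum_congr rfl fun π _ => ?_
  simp only [hg, isLastRecord_insertLast_of_lt _ π hm]
  by_cases h : IsLastRecord s n m k (rankSeq π)
  · have := h.rankSeq_add
    simp only [h, true_and, if_true]
    rw [← Finset.sum_filter, Finset.sum_const, card_fin_add_lt (by omega), nsmul_eq_mul,
      Nat.cast_sub (by omega)]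
  · simp [h]

theorem secondLastSum_succ {n s m k l : ℕ} {g : Equiv.Perm (Fin n) → ℝ}
    {g' : Equiv.Perm (Fin (n + 1)) → ℝ} (hg : ∀ i π, g' (insertLast i π) = g π) (hl : l ≤ k) :
    secondLastSum g' s m k l = (n - l) * secondLastSum g s m k l + lastSum g s m k := by
  classical
  unfold lastSum secondLastSum
  rw [sum_perm_succ, Finset.mul_sum, ← Finset.sum_add_distrib]
  refine Finset.sum_congr rfl fun π _ => ?_
  simp only [hg, isSecondLastRecord_insertLast]
  have h1 : ∀ i : Fin (n + 1), (if (IsSecondLastRecord s n m k l (rankSeq π) ∧ (i : ℕ) + l < n) ∨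
      (IsLastRecord s n m k (rankSeq π) ∧ (i : ℕ) + l = n ∧ l ≤ k) then g π else 0) =
      (if IsSecondLastRecord s n m k l (rankSeq π) then if (i : ℕ) + l < n then g π else 0 else 0) +
      (if IsLastRecord s n m k (rankSeq π) then if (i : ℕ) + l = n then g π else 0 else 0) :=
      fun i => by
    by_cases h2 : (i : ℕ) + l < n
    · have h3 : ¬ (i : ℕ) + l = n := by omega
      simp [h2, h3]
    · by_cases h3 : (i : ℕ) + l = n <;> simp [h2, h3, hl]
  simp only [h1, Finset.sum_add_distrib]
  congr 1
  · by_cases h : IsSecondLastRecord s n m k l (rankSeq π)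
    · obtain ⟨M, h2, -⟩ := id h
      have := h2.rankSeq_add
      simp only [h, if_true]
      rw [← Finset.sum_filter, Finset.sum_const, card_fin_add_lt (by omega), nsmul_eq_mul,
        Nat.cast_sub (by omega)]
    · simp [h]
  · by_cases h : IsLastRecord s n m k (rankSeq π)
    · have := h.rankSeq_add
      simp only [h, if_true]
      rw [← Finset.sum_filter, Finset.sum_const, card_fin_add_eq (by omega), one_smul]
    · simp [h]

theorem secondLastSum_eq_zero {s m k l : ℕ} (g : Equiv.Perm (Fin (m + 1)) → ℝ) :
    secondLastSum g s m k l = 0 := by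
  classical
  refine Finset.sum_eq_zero fun π _ => if_neg ?_
  rintro ⟨M, h1, h2⟩
  have := h1.2.1
  have := h2.2.1
  omega

end ROSp
namespace ROSp

/-! ### The weight of the last record -/

/-- `∫ u in 1..x, u ^ (j - 1)`. -/
noncomputable def powInt (j : ℕ) (x : ℝ) : ℝ :=
  if j = 0 then Real.log x else (x ^ j - 1) / j

theorem sum_powInt (k : ℕ) (t : ℝ) :
    ∑ j ∈ Finset.range (k + 1), powInt j t⁻¹ = lookahead k t := by
  rw [Finset.sum_range_succ', lookahead, invPowSum, add_comm]
  simp [powInt, Real.log_inv]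

theorem powInt_nonneg (j : ℕ) {x : ℝ} (hx : 1 ≤ x) : 0 ≤ powInt j x := by
  unfold powInt
  split_ifs
  · exact Real.log_nonneg hx
  · have := one_le_pow₀ (n := j) hx
    exact div_nonneg (by linarith) (by positivity)

theorem powInt_mul (j : ℕ) {x y : ℝ} (hx : 0 < x) (hy : 0 < y) :
    powInt j (x * y) = x ^ j * powInt j y + powInt j x := by
  unfold powInt
  split_ifs with h
  · rw [Real.log_mul hx.ne' hy.ne', h]; ring
  · rw [mul_pow]; ring

theorem pow_mul_sub_le {n : ℝ} {i j : ℕ} (h : (i + j : ℝ) ≤ n) (hn : 0 < n) :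
    ((n + 1) / n) ^ j * (n - (i + j)) ≤ n - i := by
  induction j with
  | zero => simp
  | succ j ih =>
    push_cast at h ⊢
    refine le_trans ?_ (ih (by linarith))
    rw [pow_succ, mul_assoc]
    refine mul_le_mul_of_nonneg_left ?_ (by positivity)
    rw [div_mul_eq_mul_div, div_le_iff₀ hn]
    have : (0 : ℝ) ≤ i + j := by positivity
    nlinarith

theorem powInt_step_mul_le {n : ℝ} {i j : ℕ} (h : (i + j : ℝ) ≤ n) (hn : 0 < n) :
    powInt j ((n + 1) / n) * (n - (i + j)) ≤ 1 := by
  unfold powInt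
  split_ifs with hj
  · have h1 := Real.log_le_sub_one_of_pos (show (0 : ℝ) < (n + 1) / n by positivity)
    have h2 : (n + 1) / n - 1 = 1 / n := by field_simp; ring
    rw [h2, le_div_iff₀ hn] at h1
    have h3 : 0 ≤ Real.log ((n + 1) / n) := Real.log_nonneg (by rw [le_div_iff₀ hn]; linarith)
    have : (0 : ℝ) ≤ i + j := by positivity
    nlinarith
  · have h1 := pow_mul_sub_le h hn
    have : (0 : ℝ) < j := by positivity
    rw [div_mul_eq_mul_div, div_le_iff₀ this]
    linarith

theorem lastSum_nonneg {n : ℕ} {g : Equiv.Perm (Fin n) → ℝ} (hg : ∀ π, 0 ≤ g π) (s m k : ℕ) :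
    0 ≤ lastSum g s m k := by
  classical
  exact Finset.sum_nonneg fun π _ => by split_ifs; exacts [hg π, le_rfl]

theorem lastSum_mul_powInt_le {g : ∀ n, Equiv.Perm (Fin n) → ℝ} {s m i j : ℕ}
    (hg : ∀ n, m < n → ∀ i π, g (n + 1) (insertLast i π) = g n π) (h0 : ∀ n π, 0 ≤ g n π)
    (hk : i + j ≤ m) {n : ℕ} (hm : m < n) :
    lastSum (g n) s m (i + j) * powInt j (n / (m + 1)) ≤ secondLastSum (g n) s m (i + j) i := by
  induction n, hm using Nat.le_induction with
  | base =>
    rw [secondLastSum_eq_zero]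
    have : ((m + 1 : ℕ) : ℝ) / (m + 1) = 1 := by
      rw [Nat.cast_add_one]; exact div_self (by positivity)
    rw [this]
    simp [powInt]
  | succ n hn ih =>
    have hmn : (m + 1 : ℝ) ≤ n := by exact_mod_cast hn
    have hn0 : (0 : ℝ) < n := lt_of_lt_of_le (by positivity) hmn
    have hk' : (i + j : ℝ) ≤ n := by
      have : (i + j : ℝ) ≤ m := by exact_mod_cast hk
      linarith
    rw [lastSum_succ (hg n hn) hn, secondLastSum_succ (hg n hn) (Nat.le_add_right i j)]
    have ha := lastSum_nonneg (h0 n) s m (i + j)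
    set a := lastSum (g n) s m (i + j)
    have hr : ((n + 1 : ℕ) : ℝ) / (m + 1) = ((n + 1) / n) * (n / (m + 1)) := by
      push_cast; field_simp
    rw [hr, powInt_mul j (by positivity) (by positivity)]
    have h1 := pow_mul_sub_le hk' hn0
    have h2 := powInt_step_mul_le hk' hn0
    have h3 : 0 ≤ powInt j (n / (m + 1)) := powInt_nonneg j (by
      rw [le_div_iff₀ (by positivity)]; linarith)
    have hi : (i : ℝ) ≤ n := by have : (0 : ℝ) ≤ j := by positivity
                                linarith
    push_cast
    have h4 := mul_le_mul_of_nonneg_left h1 (mul_nonneg ha h3)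
    have h5 := mul_le_mul_of_nonneg_left h2 ha
    have h6 := mul_le_mul_of_nonneg_left ih (show (0 : ℝ) ≤ n - i by linarith)
    linarith

theorem lastSum_sub_secondLastSum_le {g : ∀ n, Equiv.Perm (Fin n) → ℝ} {s m k : ℕ}
    (hg : ∀ n, m < n → ∀ i π, g (n + 1) (insertLast i π) = g n π) (h0 : ∀ n π, 0 ≤ g n π)
    (hk : k ≤ m) {n : ℕ} (hm : m < n) :
    lastSum (g n) s m k - ∑ l ∈ Finset.range (k + 1), secondLastSum (g n) s m k l ≤
      lastSum (g n) s m k * gain k ((m + 1) / n) := by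
  have ha := lastSum_nonneg (h0 n) s m k
  have hn0 : (0 : ℝ) < n := by exact_mod_cast (Nat.zero_le m).trans_lt hm
  have hmn : ((m + 1 : ℝ) / n) ≤ 1 := by
    rw [div_le_one hn0]; exact_mod_cast hm
  have h1 : lastSum (g n) s m k * lookahead k ((m + 1) / n) ≤
      ∑ l ∈ Finset.range (k + 1), secondLastSum (g n) s m k l := by
    rw [← sum_powInt, Finset.mul_sum, ← Finset.sum_range_reflect (fun l => secondLastSum _ _ _ _ l)]
    refine Finset.sum_le_sum fun j hj => ?_
    have hj' : j ≤ k := Nat.lt_succ_iff.1 (Finset.mem_range.1 hj)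
    have := lastSum_mul_powInt_le (s := s) (i := k - j) (j := j) hg h0 (by omega) hm
    rw [Nat.sub_add_cancel hj'] at this
    rw [inv_div]
    simpa using this
  have h2 : 1 - lookahead k ((m + 1) / n) ≤ gain k ((m + 1) / n) := by
    rw [gain, min_eq_left hmn]; exact le_max_left _ _
  nlinarith

/-! ### The number of orders with a given last record -/

open Classical in
/-- The number of orders in which the `k` largest values are in the first `s` positions. -/
noncomputable def topCount (n s k : ℕ) : ℕ :=
  (Finset.univ.filter fun π : Equiv.Perm (Fin n) =>
    ∀ j, s ≤ j → j < n → rankSeq π j + k < n).card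

theorem topCount_self (s k : ℕ) : topCount s s k = s.factorial := by
  classical
  rw [topCount, Finset.filter_true_of_mem fun π _ j h1 h2 => absurd h1 (not_le.2 h2),
    Finset.card_univ, Fintype.card_perm, Fintype.card_fin]

theorem card_filter_perm_succ {n : ℕ} (P : Equiv.Perm (Fin (n + 1)) → Prop) [DecidablePred P]
    (Q : Equiv.Perm (Fin n) → Prop) [DecidablePred Q] (R : Fin (n + 1) → Prop) [DecidablePred R]
    (h : ∀ i π, P (insertLast i π) ↔ R i ∧ Q π) :
    (Finset.univ.filter P).card = (Finset.univ.filter R).card * (Finset.univ.filter Q).card := by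
  rw [← Finset.card_product]
  symm
  refine Finset.card_bij (fun x _ => insertLast x.1 x.2) ?_ ?_ ?_
  · intro x hx
    simp only [Finset.mem_product, Finset.mem_filter, Finset.mem_univ, true_and] at hx ⊢
    exact (h _ _).2 hx
  · exact fun x _ y _ hxy => (insertLast_bijective n).1 hxy
  · intro π hπ
    obtain ⟨x, rfl⟩ := (insertLast_bijective n).2 π
    simp only [Finset.mem_product, Finset.mem_filter, Finset.mem_univ, true_and] at hπ ⊢
    exact ⟨x, (h _ _).1 hπ, rfl⟩

theorem topCount_succ {n s k : ℕ} (hs : s ≤ n) :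
    topCount (n + 1) s k = (n + 1 - k) * topCount n s k := by
  classical
  rw [← card_fin_add_lt (N := n + 1) le_rfl]
  refine card_filter_perm_succ _ _ _ fun i π => ?_
  constructor
  · intro h
    have h1 := h n hs n.lt_succ_self
    rw [rankSeq_insertLast_self] at h1
    refine ⟨h1, fun j hj hjn => ?_⟩
    have := h j hj (by omega)
    rw [rankSeq_insertLast_of_lt i π hjn] at this
    split_ifs at this <;> omega
  · rintro ⟨h1, h2⟩ j hj hjn
    rcases Nat.lt_succ_iff_lt_or_eq.1 hjn with h3 | rfl
    · have := h2 j hj h3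
      rw [rankSeq_insertLast_of_lt i π h3]
      split_ifs <;> omega
    · rw [rankSeq_insertLast_self]; exact h1

theorem lastSum_one_self {m s k : ℕ} (hs : s ≤ m) (hk : k ≤ m) :
    lastSum (fun _ : Equiv.Perm (Fin (m + 1)) => (1 : ℝ)) s m k = topCount m s k := by
  classical
  rw [lastSum, Finset.sum_boole, topCount]
  congr 1
  rw [card_filter_perm_succ _ (fun π => ∀ j, s ≤ j → j < m → rankSeq π j + k < m)
    (fun i => (i : ℕ) + k = m) fun i π => isLastRecord_insertLast_self i π hs,
    card_fin_add_eq hk, one_mul]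

theorem topCount_mul {m s k : ℕ} (hk : k ≤ s) (hs : s ≤ m) :
    topCount m s k = s.descFactorial k * (m - k).factorial := by
  induction m, hs using Nat.le_induction with
  | base => rw [topCount_self, mul_comm, Nat.factorial_mul_descFactorial hk]
  | succ n hn ih =>
    rw [topCount_succ hn, ih, Nat.succ_sub (hk.trans hn), Nat.succ_eq_add_one, Nat.factorial_succ]
    ring

theorem lastSum_one {n m s k : ℕ} (hk : k ≤ s) (hs : s ≤ m) (hm : m < n) :
    lastSum (fun _ : Equiv.Perm (Fin n) => (1 : ℝ)) s m k =
      s.descFactorial k * (n - 1 - k).factorial := by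
  induction n, hm using Nat.le_induction with
  | base =>
    rw [lastSum_one_self hs (hk.trans hs), topCount_mul hk hs]
    simp
  | succ n hn ih =>
    rw [lastSum_succ (fun _ _ => rfl) hn, ih]
    have h1 : n + 1 - 1 - k = (n - 1 - k) + 1 := by omega
    have h2 : ((n - 1 - k : ℕ) : ℝ) + 1 = n - k := by
      rw [← Nat.cast_add_one, ← Nat.cast_sub (by omega)]; congr 1; omega
    rw [h1, Nat.factorial_succ]
    push_cast
    rw [h2]; ring

theorem descFactorial_mul_pow_le {s N : ℕ} (h : s ≤ N) (k : ℕ) :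
    s.descFactorial k * N ^ k ≤ s ^ k * N.descFactorial k := by
  induction k with
  | zero => simp
  | succ k ih =>
    rw [Nat.descFactorial_succ, Nat.descFactorial_succ, pow_succ, pow_succ]
    have h1 : (s - k) * N ≤ s * (N - k) := by
      rw [Nat.sub_mul, Nat.mul_sub]
      exact Nat.sub_le_sub_left (by rw [mul_comm]; exact Nat.mul_le_mul_left k h) _
    calc (s - k) * s.descFactorial k * (N ^ k * N)
        = (s.descFactorial k * N ^ k) * ((s - k) * N) := by ring
      _ ≤ (s ^ k * N.descFactorial k) * (s * (N - k)) := Nat.mul_le_mul ih h1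
      _ = _ := by ring

theorem lastSum_le {n m s k : ℕ} {g : Equiv.Perm (Fin n) → ℝ} (hg : ∀ π, g π ≤ 1)
    (hk : k ≤ s) (hs : s ≤ m) (hm : m < n) :
    lastSum g s m k ≤ n.factorial * ((1 / n) * ((s : ℝ) / (n - 1)) ^ k) := by
  classical
  have h1 : lastSum g s m k ≤ lastSum (fun _ : Equiv.Perm (Fin n) => (1 : ℝ)) s m k :=
    Finset.sum_le_sum fun π _ => by split_ifs; exacts [hg π, le_rfl]
  refine h1.trans ?_
  rw [lastSum_one hk hs hm]
  obtain ⟨N, rfl⟩ : ∃ N, n = N + 1 := ⟨n - 1, by omega⟩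
  rcases Nat.eq_zero_or_pos k with rfl | hk0
  · rw [Nat.factorial_succ]
    have : ((N : ℝ) + 1) ≠ 0 := by positivity
    push_cast
    field_simp
    simp
  have hN : (0 : ℝ) < N := by exact_mod_cast (by omega : 0 < N)
  have h2 : (s.descFactorial k : ℝ) * N ^ k ≤ s ^ k * N.descFactorial k := by
    exact_mod_cast descFactorial_mul_pow_le (show s ≤ N by omega) k
  have h3 : (N.descFactorial k : ℝ) * (N - k).factorial = N.factorial := by
    rw [mul_comm]; exact_mod_cast Nat.factorial_mul_descFactorial (show k ≤ N by omega)
  have h4 : ((N + 1 : ℕ).factorial : ℝ) * ((1 / ((N + 1 : ℕ) : ℝ)) *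
      ((s : ℝ) / (((N + 1 : ℕ) : ℝ) - 1)) ^ k) = N.factorial * (s ^ k / N ^ k) := by
    rw [Nat.factorial_succ, div_pow]
    push_cast
    rw [add_sub_cancel_right]
    field_simp
  rw [h4, mul_div_assoc', le_div_iff₀ (by positivity), ← h3]
  rw [Nat.add_sub_cancel]
  have := mul_le_mul_of_nonneg_right h2 (show (0 : ℝ) ≤ (N - k).factorial by positivity)
  linarith

end ROSp
namespace ROSp

/-! ### Stopping probabilities of an algorithm along a sequence of values -/

open Filter Topology

/-- The values in the positions `s, …, s + j - 1`. -/
def segment {β : Type*} (s j : ℕ) (x : ℕ → β) : List β := (List.range' s j).map x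

/-- The probability that an algorithm with the first `s` values as its sample stops not later than
at position `m`. -/
noncomputable def stopProb (q : Finset ℝ → List ℝ → unitInterval) (s m : ℕ) (x : ℕ → ℝ) : ℝ :=
  1 - ∏ u ∈ Finset.range (m + 1 - s),
    (1 - (q ((Finset.range s).image x) (segment s (u + 1) x) : ℝ))

theorem one_sub_coe_mem (t : unitInterval) : 1 - (t : ℝ) ∈ Set.Icc (0 : ℝ) 1 :=
  ⟨sub_nonneg.2 t.2.2, sub_le_self _ t.2.1⟩

theorem stopProb_mem (q : Finset ℝ → List ℝ → unitInterval) (s m : ℕ) (x : ℕ → ℝ) :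
    stopProb q s m x ∈ Set.Icc (0 : ℝ) 1 :=
  ⟨sub_nonneg.2 (Finset.prod_le_one (fun _ _ => (one_sub_coe_mem _).1)
    fun _ _ => (one_sub_coe_mem _).2), sub_le_self _ (Finset.prod_nonneg fun _ _ =>
      (one_sub_coe_mem _).1)⟩

theorem stopProb_mono (q : Finset ℝ → List ℝ → unitInterval) (s : ℕ) (x : ℕ → ℝ) {m M : ℕ}
    (h : m ≤ M) : stopProb q s m x ≤ stopProb q s M x := by
  refine sub_le_sub_left ?_ _
  rw [← Finset.prod_range_mul_prod_Ico _ (show m + 1 - s ≤ M + 1 - s by omega)]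
  exact mul_le_of_le_one_right (Finset.prod_nonneg fun _ _ => (one_sub_coe_mem _).1)
    (Finset.prod_le_one (fun _ _ => (one_sub_coe_mem _).1) fun _ _ => (one_sub_coe_mem _).2)

theorem stopProb_congr (q : Finset ℝ → List ℝ → unitInterval) {s m : ℕ} (hs : s ≤ m + 1)
    {x y : ℕ → ℝ} (h : ∀ j < m + 1, x j = y j) : stopProb q s m x = stopProb q s m y := by
  unfold stopProb segment
  have h1 : (Finset.range s).image x = (Finset.range s).image y :=
    Finset.image_congr fun j hj => h j ((Finset.mem_range.1 hj).trans_le hs)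
  rw [h1]
  congr 1
  refine Finset.prod_congr rfl fun u hu => ?_
  rw [List.map_congr_left fun j hj => h j ?_]
  have := Finset.mem_range.1 hu
  rw [List.mem_range'_1] at hj
  omega

theorem onlineList_eq {n : ℕ} (α : Fin n → ℝ) (s : ℕ) (π : Equiv.Perm (Fin n)) :
    onlineList α s π = segment s (n - s) (extend fun j => α (π j)) := by
  have h1 : (lastPos n s).map Fin.val = List.range' s (n - s) := by
    have hs1 : ((lastPos n s).map Fin.val).Pairwise (· < ·) := by
      rw [List.pairwise_map]
      exact (List.pairwise_lt_finRange n).filter _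
    have hs2 : (List.range' s (n - s)).Pairwise (· < ·) := List.pairwise_lt_range'
    refine List.Perm.eq_of_pairwise' hs1 hs2 ?_
    rw [List.perm_ext_iff_of_nodup (hs1.imp fun h => h.ne) (hs2.imp fun h => h.ne)]
    intro k
    simp only [lastPos, List.mem_map, List.mem_filter, List.mem_finRange, true_and,
      decide_eq_true_eq, List.mem_range'_1]
    constructor
    · rintro ⟨i, hi, rfl⟩; omega
    · intro hk; exact ⟨⟨k, by omega⟩, hk.1, rfl⟩
  rw [onlineList, segment, ← h1, List.map_map]
  refine List.map_congr_left fun k _ => ?_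
  exact (extend_of_lt (fun j => α (π j)) k.2).symm

theorem sampleSet_eq {n : ℕ} (α : Fin n → ℝ) {s : ℕ} (hs : s ≤ n) (π : Equiv.Perm (Fin n)) :
    sampleSet α s π = (Finset.range s).image (extend fun j => α (π j)) := by
  ext v
  simp only [sampleSet, initPos, Finset.mem_image, Finset.mem_filter, Finset.mem_univ, true_and,
    Finset.mem_range]
  constructor
  · rintro ⟨k, hk, rfl⟩
    exact ⟨k, hk, extend_of_lt _ k.2⟩
  · rintro ⟨k, hk, rfl⟩
    exact ⟨⟨k, hk.trans_le hs⟩, hk, (extend_of_lt (fun j => α (π j)) (hk.trans_le hs)).symm⟩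

theorem take_segment {β : Type*} {s i j : ℕ} (h : i ≤ j) (x : ℕ → β) :
    (segment s j x).take i = segment s i x := by
  refine List.ext_getElem (by simpa [segment] using h) fun k h1 h2 => ?_
  simp [segment]

theorem winProbOnList_mem (q : List ℝ → unitInterval) {L : List ℝ} (hL : L.Nodup) :
    winProbOnList q L ∈ Set.Icc (0 : ℝ) 1 := by
  classical
  unfold winProbOnList
  split_ifs with h
  · simp
  have hterm : ∀ j : Fin L.length, (∏ i ∈ Finset.range j, (1 - (q (L.take (i + 1)) : ℝ))) *
      (q (L.take (j + 1)) : ℝ) ∈ Set.Icc (0 : ℝ) 1 := fun j => by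
    have h1 : (∏ i ∈ Finset.range (j : ℕ), (1 - (q (L.take (i + 1)) : ℝ))) ∈ Set.Icc (0 : ℝ) 1 :=
      ⟨Finset.prod_nonneg fun _ _ => (one_sub_coe_mem _).1,
        Finset.prod_le_one (fun _ _ => (one_sub_coe_mem _).1) fun _ _ => (one_sub_coe_mem _).2⟩
    exact ⟨mul_nonneg h1.1 (q _).2.1, mul_le_one₀ h1.2 (q _).2.1 (q _).2.2⟩
  constructor
  · exact Finset.sum_nonneg fun j _ => by split_ifs; exacts [(hterm j).1, le_rfl]
  · by_cases hJ : ∃ J : Fin L.length, ∀ y ∈ L, y ≤ L[J]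
    · obtain ⟨J, hJ⟩ := hJ
      rw [Finset.sum_eq_single J]
      · rw [if_pos hJ]; exact (hterm J).2
      · intro j _ hj
        rw [if_neg]
        intro hmax
        refine hj (Fin.ext ?_)
        have := le_antisymm (hmax L[J] (List.getElem_mem _)) (hJ L[j] (List.getElem_mem _))
        exact ((List.Nodup.getElem_inj_iff hL).1 this).symm
      · simp
    · refine (Finset.sum_nonpos fun j _ => ?_).trans zero_le_one
      rw [if_neg fun h => hJ ⟨j, h⟩]

theorem onlineList_nodup {n : ℕ} {α : Fin n → ℝ} (hα : Function.Injective α) (s : ℕ)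
    (π : Equiv.Perm (Fin n)) : (onlineList α s π).Nodup :=
  ((List.nodup_finRange n).filter _).map (hα.comp π.injective)

theorem winProbOnList_segment_eq (q : List ℝ → unitInterval) {s n M l : ℕ} {x : ℕ → ℝ}
    (h : IsLastRecord s n M l x) :
    winProbOnList q (segment s (n - s) x) =
      (∏ u ∈ Finset.range (M - s), (1 - (q (segment s (u + 1) x) : ℝ))) *
        (q (segment s (M - s + 1) x) : ℝ) := by
  classical
  obtain ⟨hs, hM, hmax, -⟩ := h
  have hlen : (segment s (n - s) x).length = n - s := by simp [segment]
  have hget : ∀ j (hj : j < (segment s (n - s) x).length), (segment s (n - s) x)[j] = x (s + j) :=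
    fun j hj => by simp [segment]
  have hne : segment s (n - s) x ≠ [] := by
    rw [← List.length_pos_iff, hlen]; omega
  rw [winProbOnList, if_neg hne, Finset.sum_eq_single ⟨M - s, by rw [hlen]; omega⟩]
  · have h1 : ∀ i ≤ M - s, (segment s (n - s) x).take (i + 1) = segment s (i + 1) x := fun i hi =>
      take_segment (by omega) x
    rw [if_pos]
    · simp only
      rw [h1 _ le_rfl, Finset.prod_congr rfl fun i hi => by
        rw [h1 i (Finset.mem_range.1 hi).le]]
    · intro y hy
      rw [segment, List.mem_map] at hy
      obtain ⟨j, hj, rfl⟩ := hy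
      rw [List.mem_range'_1] at hj
      rw [Fin.getElem_fin, hget, show s + (M - s) = M by omega]
      by_cases hjM : j = M
      · rw [hjM]
      · exact (hmax j hj.1 (by omega) hjM).le
  · intro j _ hj
    rw [if_neg]
    intro hmax'
    have h1 := hmax' (x M) (by
      rw [segment, List.mem_map]
      exact ⟨M, by rw [List.mem_range'_1]; omega, rfl⟩)
    have hj2 : (j : ℕ) < n - s := j.2.trans_eq hlen
    rw [Fin.getElem_fin, hget] at h1
    have hne : s + (j : ℕ) ≠ M := fun h => hj (Fin.ext (by simp only; omega))
    exact absurd (hmax (s + j) (by omega) (by omega) hne) (not_lt.2 h1)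
  · simp

theorem winProbOnList_segment_eq_stopProb {q : Finset ℝ → List ℝ → unitInterval} {s n M l : ℕ}
    {x : ℕ → ℝ} (h : IsLastRecord s n M l x) :
    winProbOnList (q ((Finset.range s).image x)) (segment s (n - s) x) =
      stopProb q s M x - (if s < M then stopProb q s (M - 1) x else 0) := by
  have hs := h.1
  have h2 : stopProb q s M x = 1 - (∏ u ∈ Finset.range (M - s),
      (1 - (q ((Finset.range s).image x) (segment s (u + 1) x) : ℝ))) *
      (1 - (q ((Finset.range s).image x) (segment s (M - s + 1) x) : ℝ)) := by
    rw [stopProb, Nat.sub_add_comm hs, Finset.prod_range_succ]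
  have h3 : (if s < M then stopProb q s (M - 1) x else 0) = 1 - ∏ u ∈ Finset.range (M - s),
      (1 - (q ((Finset.range s).image x) (segment s (u + 1) x) : ℝ)) := by
    split_ifs with hlt
    · rw [stopProb, Nat.sub_add_cancel (by omega)]
    · rw [show M - s = 0 by omega]; simp
  rw [h2, h3, winProbOnList_segment_eq _ h]
  ring

theorem exists_isLastRecord {s n : ℕ} (h : s < n) {x : ℕ → ℝ} (hx : Set.InjOn x (Set.Iio n)) :
    ∃ M k, IsLastRecord s n M k x := by
  obtain ⟨M, hM, hmax⟩ := Finset.exists_max_image (Finset.Ico s n) x ⟨s, by simpa using h⟩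
  rw [Finset.mem_Ico] at hM
  refine ⟨M, _, hM.1, hM.2, fun j hj hjn hne => ?_, rfl⟩
  exact (hmax j (Finset.mem_Ico.2 ⟨hj, hjn⟩)).lt_of_ne fun e => hne (hx hjn hM.2 e)

theorem IsLastRecord.unique {β : Type*} [LinearOrder β] {s n m k M l : ℕ} {x : ℕ → β}
    (h : IsLastRecord s n m k x) (h' : IsLastRecord s n M l x) : m = M ∧ k = l := by
  have hm : m = M := by
    by_contra hne
    exact (h.2.2.1 M h'.1 h'.2.1 (Ne.symm hne)).asymm (h'.2.2.1 m h.1 h.2.1 hne)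
  subst hm
  exact ⟨rfl, h.2.2.2.symm.trans h'.2.2.2⟩

theorem IsLastRecord.le {β : Type*} [LinearOrder β] {s n m k : ℕ} {x : ℕ → β}
    (h : IsLastRecord s n m k x) : k ≤ s := by
  rw [← h.2.2.2]
  exact (Finset.card_filter_le _ _).trans (Finset.card_range s).le

open Classical in
theorem winProbOnList_segment_le_sum {q : Finset ℝ → List ℝ → unitInterval} {s n : ℕ} {x : ℕ → ℝ}
    (h : s < n) (hx : Set.InjOn x (Set.Iio n)) :
    winProbOnList (q ((Finset.range s).image x)) (segment s (n - s) x) ≤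
      ∑ m ∈ Finset.Ico s n, ∑ k ∈ Finset.range (s + 1),
        ((if IsLastRecord s n m k x then stopProb q s m x else 0) -
          ∑ l ∈ Finset.range (k + 1),
            if IsSecondLastRecord s n m k l x then stopProb q s m x else 0) := by
  obtain ⟨M, l, hM⟩ := exists_isLastRecord h hx
  refine (winProbOnList_segment_eq_stopProb hM).trans_le ?_
  simp only [Finset.sum_sub_distrib]
  refine sub_le_sub ?_ ?_
  · rw [Finset.sum_eq_single_of_mem M (Finset.mem_Ico.2 ⟨hM.1, hM.2.1⟩),
      Finset.sum_eq_single_of_mem l (Finset.mem_range.2 (Nat.lt_succ_of_le hM.le)), if_pos hM]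
    · exact fun k _ hk => if_neg fun h' => hk (h'.unique hM).2
    · exact fun m _ hm => Finset.sum_eq_zero fun k _ => if_neg fun h' => hm (h'.unique hM).1
  · split_ifs with hlt
    · obtain ⟨m₀, k₀, h0⟩ := exists_isLastRecord hlt
        (hx.mono (Set.Iio_subset_Iio hM.2.1.le))
      have huniq : ∀ m k i, IsSecondLastRecord s n m k i x → m = m₀ ∧ k = k₀ ∧ i = l := by
        rintro m k i ⟨M', h1, h2⟩
        obtain ⟨rfl, rfl⟩ := h1.unique hM
        obtain ⟨rfl, rfl⟩ := h2.unique h0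
        exact ⟨rfl, rfl, rfl⟩
      have hlk : l ≤ k₀ := by
        have h1 := hM.2.2.1 m₀ h0.1 (h0.2.1.trans hM.2.1) h0.2.1.ne
        rw [← hM.2.2.2, ← h0.2.2.2]
        exact Finset.card_le_card (Finset.monotone_filter_right _ fun j _ hj => h1.trans hj)
      rw [Finset.sum_eq_single_of_mem m₀ (Finset.mem_Ico.2 ⟨h0.1, h0.2.1.trans hM.2.1⟩),
        Finset.sum_eq_single_of_mem k₀ (Finset.mem_range.2 (Nat.lt_succ_of_le h0.le)),
        Finset.sum_eq_single_of_mem l (Finset.mem_range.2 (Nat.lt_succ_of_le hlk)),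
        if_pos ⟨M, hM, h0⟩]
      · exact stopProb_mono q s x (Nat.le_sub_one_of_lt h0.2.1)
      · exact fun i _ hi => if_neg fun h' => hi (huniq _ _ _ h').2.2
      · exact fun k _ hk => Finset.sum_eq_zero fun i _ => if_neg fun h' => hk (huniq _ _ _ h').2.1
      · exact fun m _ hm => Finset.sum_eq_zero fun k _ => Finset.sum_eq_zero fun i _ =>
          if_neg fun h' => hm (huniq _ _ _ h').1
    · refine Finset.sum_nonpos fun m _ => Finset.sum_nonpos fun k _ => Finset.sum_nonpos fun i _ => ?_
      rw [if_neg]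
      rintro ⟨M', h1, h2⟩
      obtain ⟨rfl, -⟩ := h1.unique hM
      exact hlt (h2.1.trans_lt h2.2.1)

/-- The upper bound for the winning probability with `s` sampled elements. -/
noncomputable def sampleBound (n s : ℕ) : ℝ :=
  ∑ m ∈ Finset.Ico s n, ∑ k ∈ Finset.range (s + 1),
    (1 / n) * ((s : ℝ) / (n - 1)) ^ k * gain k ((m + 1) / n)

/-- The limit of the probabilities to stop not later than at position `m`. -/
noncomputable def stopLim (q : Finset ℝ → List ℝ → unitInterval) (s m n : ℕ)
    (π : Equiv.Perm (Fin n)) : ℝ :=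
  fastLim fun α => stopProb q s m (extend fun j => α (π j))

theorem stopLim_insertLast (q : Finset ℝ → List ℝ → unitInterval) {s m n : ℕ} (hs : s ≤ m)
    (hm : m < n) (i : Fin (n + 1)) (π : Equiv.Perm (Fin n)) :
    stopLim q s m (n + 1) (insertLast i π) = stopLim q s m n π := by
  rw [stopLim, stopLim, ← fastLim_comp_succAbove i]
  congr 1
  funext α
  exact stopProb_congr q (by omega) fun j hj => extend_insertLast_of_lt α i π (by omega)

theorem exists_tendsto_le_sampleBound (q : Finset ℝ → List ℝ → unitInterval) {n s : ℕ}
    (hs : s < n) : ∃ (R : (Fin n → ℝ) → ℝ) (r : ℝ), r ≤ sampleBound n s ∧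
      Tendsto R (fastUltrafilter n) (𝓝 r) ∧ ∀ α, StrictMono α →
        (∑ π : Equiv.Perm (Fin n), winProbOnList (q (sampleSet α s π)) (onlineList α s π)) /
          (n.factorial : ℝ) ≤ R α := by
  classical
  let S : (ℕ → Equiv.Perm (Fin n) → ℝ) → ℝ := fun g => (∑ m ∈ Finset.Ico s n,
    ∑ k ∈ Finset.range (s + 1), (lastSum (g m) s m k -
      ∑ l ∈ Finset.range (k + 1), secondLastSum (g m) s m k l)) / (n.factorial : ℝ)
  refine ⟨fun α => S fun m π => stopProb q s m (extend fun j => α (π j)),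
    S fun m π => stopLim q s m n π, ?_, ?_, ?_⟩
  · have hf : (0 : ℝ) < n.factorial := by positivity
    rw [div_le_iff₀ hf, sampleBound, Finset.sum_mul]
    refine Finset.sum_le_sum fun m hm => ?_
    rw [Finset.sum_mul]
    refine Finset.sum_le_sum fun k hk => ?_
    rw [Finset.mem_Ico] at hm
    have hks : k ≤ s := Nat.lt_succ_iff.1 (Finset.mem_range.1 hk)
    have hmem : ∀ n' π, stopLim q s m n' π ∈ Set.Icc (0 : ℝ) 1 := fun n' π =>
      fastLim_mem fun α => stopProb_mem q s m _
    refine (lastSum_sub_secondLastSum_le (g := stopLim q s m)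
      (fun n' hn' i π => stopLim_insertLast q hm.1 hn' i π) (fun n' π => (hmem n' π).1)
      (hks.trans hm.1) hm.2).trans ?_
    have := mul_le_mul_of_nonneg_right
      (lastSum_le (g := stopLim q s m n) (fun π => (hmem n π).2) hks hm.1 hm.2)
      (gain_nonneg k ((m + 1) / n))
    linarith
  · have h1 : ∀ m π, Tendsto (fun α : Fin n → ℝ => stopProb q s m (extend fun j => α (π j)))
        (fastUltrafilter n) (𝓝 (stopLim q s m n π)) := fun m π =>
      tendsto_fastLim fun α => stopProb_mem q s m _
    refine Tendsto.div_const (tendsto_finsetSum _ fun m _ => tendsto_finsetSum _ fun k _ =>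
      Tendsto.sub ?_ (tendsto_finsetSum _ fun l _ => ?_)) _
    · refine tendsto_finsetSum _ fun π _ => ?_
      split_ifs
      exacts [h1 m π, tendsto_const_nhds]
    · refine tendsto_finsetSum _ fun π _ => ?_
      split_ifs
      exacts [h1 m π, tendsto_const_nhds]
  · intro α hα
    refine div_le_div_of_nonneg_right ?_ (by positivity)
    have hord : ∀ π : Equiv.Perm (Fin n), ∀ i < n, ∀ j < n,
        ((extend fun j => α (π j)) i < (extend fun j => α (π j)) j ↔ rankSeq π i < rankSeq π j) :=
      fun π i hi j hj => by
        rw [extend_of_lt _ hi, extend_of_lt _ hj, rankSeq_of_lt π hi, rankSeq_of_lt π hj,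
          hα.lt_iff_lt, Fin.lt_def]
    have hinj : ∀ π : Equiv.Perm (Fin n), Set.InjOn (extend fun j => α (π j)) (Set.Iio n) :=
      fun π i hi j hj h => by
        rw [extend_of_lt _ hi, extend_of_lt _ hj] at h
        exact congrArg Fin.val (π.injective (hα.injective h))
    refine (Finset.sum_le_sum fun π _ => ?_).trans_eq (b := ∑ π : Equiv.Perm (Fin n),
      ∑ m ∈ Finset.Ico s n, ∑ k ∈ Finset.range (s + 1),
        ((if IsLastRecord s n m k (rankSeq π) then
          stopProb q s m (extend fun j => α (π j)) else 0) -
          ∑ l ∈ Finset.range (k + 1), if IsSecondLastRecord s n m k l (rankSeq π) then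
            stopProb q s m (extend fun j => α (π j)) else 0)) ?_
    · rw [onlineList_eq, sampleSet_eq α hs.le]
      refine (winProbOnList_segment_le_sum hs (hinj π)).trans_eq ?_
      have h2 : ∀ m k, IsLastRecord s n m k (extend fun j => α (π j)) ↔
          IsLastRecord s n m k (rankSeq π) := fun m k => IsLastRecord.congr (hord π)
      have h3 : ∀ m k l, IsSecondLastRecord s n m k l (extend fun j => α (π j)) ↔
          IsSecondLastRecord s n m k l (rankSeq π) := fun m k l => exists_congr fun M => by
        rw [h2]
        refine and_congr_right fun hM => IsLastRecord.congr fun a ha b hb => ?_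
        exact hord π a (ha.trans hM.2.1) b (hb.trans hM.2.1)
      simp only [h2, h3]
    · simp only [lastSum, secondLastSum]
      rw [Finset.sum_comm]
      refine Finset.sum_congr rfl fun m _ => ?_
      rw [Finset.sum_comm]
      refine Finset.sum_congr rfl fun k _ => ?_
      rw [Finset.sum_sub_distrib]
      congr 1
      rw [Finset.sum_comm]

end ROSp
namespace ROSp

/-! ### No algorithm has a guarantee larger than `optValue p` -/

theorem winProb_nonneg {p : ℝ} (hp0 : 0 ≤ p) (hp1 : p ≤ 1) (A : Algorithm) {n : ℕ}
    (α : Fin n ↪ ℝ) : 0 ≤ winProb p A α := by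
  rw [winProb_eq_sum]
  refine Finset.sum_nonneg fun s _ => mul_nonneg (Nat.cast_nonneg _) (mul_nonneg
    (mul_nonneg (pow_nonneg hp0 _) (pow_nonneg (sub_nonneg.2 hp1) _))
    (div_nonneg (Finset.sum_nonneg fun π _ => ?_) (Nat.cast_nonneg _)))
  exact (winProbOnList_mem _ (onlineList_nodup α.injective s π)).1

theorem guarantee_le_winProb {p : ℝ} (hp0 : 0 ≤ p) (hp1 : p ≤ 1) (A : Algorithm) {n : ℕ}
    (hn : 0 < n) (α : Fin n ↪ ℝ) : guarantee p A ≤ winProb p A α := by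
  refine (ciInf_le ⟨0, ?_⟩ ⟨n, hn⟩).trans (ciInf_le ⟨0, ?_⟩ α)
  · rintro _ ⟨m, rfl⟩
    exact Real.iInf_nonneg fun β => winProb_nonneg hp0 hp1 A β
  · rintro _ ⟨β, rfl⟩
    exact winProb_nonneg hp0 hp1 A β

/-- The probability that `s` out of `n` elements are sampled. -/
noncomputable def binomialWeight (p : ℝ) (n s : ℕ) : ℝ :=
  (n.choose s : ℝ) * (p ^ s * (1 - p) ^ (n - s))

theorem binomialWeight_nonneg {p : ℝ} (hp0 : 0 ≤ p) (hp1 : p ≤ 1) (n s : ℕ) :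
    0 ≤ binomialWeight p n s :=
  mul_nonneg (Nat.cast_nonneg _) (mul_nonneg (pow_nonneg hp0 _) (pow_nonneg (sub_nonneg.2 hp1) _))

theorem sum_binomialWeight (p : ℝ) (n : ℕ) :
    ∑ s ∈ Finset.range (n + 1), binomialWeight p n s = 1 := by
  have := add_pow p (1 - p) n
  rw [add_sub_cancel, one_pow] at this
  rw [this]
  exact Finset.sum_congr rfl fun s _ => by rw [binomialWeight]; ring

theorem sum_binomialWeight_far_le {p δ : ℝ} (hp0 : 0 ≤ p) (hp1 : p ≤ 1) (hδ : 0 < δ) {n : ℕ}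
    (hn : 0 < n) : ∑ s ∈ (Finset.range (n + 1)).filter (fun s : ℕ => δ ≤ |p - s / n|),
      binomialWeight p n s ≤ 1 / (n * δ ^ 2) := by
  have hn0 : (0 : ℝ) < n := by exact_mod_cast hn
  have hv : ∑ s ∈ Finset.range (n + 1), (p - s / n) ^ 2 * binomialWeight p n s =
      p * (1 - p) / n := by
    rw [← bernstein.variance hn.ne' ⟨p, hp0, hp1⟩, Finset.sum_range]
    refine Finset.sum_congr rfl fun s _ => ?_
    simp [bernstein_apply, bernstein.z, binomialWeight, mul_assoc]
  have h1 : δ ^ 2 * ∑ s ∈ (Finset.range (n + 1)).filter (fun s : ℕ => δ ≤ |p - s / n|),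
      binomialWeight p n s ≤ p * (1 - p) / n := by
    rw [← hv, Finset.mul_sum]
    refine (Finset.sum_le_sum fun s hs => ?_).trans (Finset.sum_le_sum_of_subset_of_nonneg
      (Finset.filter_subset _ _) fun s _ _ =>
        mul_nonneg (sq_nonneg _) (binomialWeight_nonneg hp0 hp1 n s))
    refine mul_le_mul_of_nonneg_right ?_ (binomialWeight_nonneg hp0 hp1 n s)
    rw [← sq_abs (p - s / n)]
    exact pow_le_pow_left₀ hδ.le (Finset.mem_filter.1 hs).2 2
  have h2 : p * (1 - p) / n ≤ 1 / n := by
    gcongr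
    nlinarith
  rw [le_div_iff₀ (by positivity)]
  rw [le_div_iff₀ hn0] at h2
  nlinarith

theorem guarantee_le_sum {p : ℝ} (hp0 : 0 ≤ p) (hp1 : p ≤ 1) (A : Algorithm) {n : ℕ}
    (hn : 0 < n) (T : Finset ℕ) (hT : T ⊆ Finset.range n) :
    guarantee p A ≤ ∑ s ∈ T, binomialWeight p n s * sampleBound n s +
      ∑ s ∈ Finset.range (n + 1) \ T, binomialWeight p n s := by
  have hex : ∀ s : ℕ, ∃ (R : (Fin n → ℝ) → ℝ) (r : ℝ), s < n → (r ≤ sampleBound n s ∧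
      Filter.Tendsto R (fastUltrafilter n) (nhds r) ∧ ∀ α, StrictMono α →
        (∑ π : Equiv.Perm (Fin n), winProbOnList (A n (sampleSet α s π)) (onlineList α s π)) /
          (n.factorial : ℝ) ≤ R α) := fun s => by
    by_cases hs : s < n
    · obtain ⟨R, r, h⟩ := exists_tendsto_le_sampleBound (A n) hs
      exact ⟨R, r, fun _ => h⟩
    · exact ⟨0, 0, fun h => absurd h hs⟩
  choose R r hR using hex
  have hT' : ∀ s ∈ T, s < n := fun s hs => Finset.mem_range.1 (hT hs)
  have hlim : Filter.Tendsto (fun α => ∑ s ∈ T, binomialWeight p n s * R s α +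
      ∑ s ∈ Finset.range (n + 1) \ T, binomialWeight p n s) (fastUltrafilter n)
      (nhds (∑ s ∈ T, binomialWeight p n s * r s +
        ∑ s ∈ Finset.range (n + 1) \ T, binomialWeight p n s)) :=
    (tendsto_finsetSum _ fun s hs => (hR s (hT' s hs)).2.1.const_mul _).add_const _
  refine (ge_of_tendsto hlim ?_).trans (add_le_add_left (Finset.sum_le_sum fun s hs =>
    mul_le_mul_of_nonneg_left (hR s (hT' s hs)).1 (binomialWeight_nonneg hp0 hp1 n s)) _)
  filter_upwards [eventually_strictMono_fastUltrafilter n 0] with α hα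
  refine (guarantee_le_winProb hp0 hp1 A hn ⟨α, hα.1.injective⟩).trans ?_
  rw [winProb_eq_sum, ← Finset.sum_sdiff (hT.trans (Finset.range_mono n.le_succ)), add_comm]
  refine add_le_add (Finset.sum_le_sum fun s hs => ?_) (Finset.sum_le_sum fun s hs => ?_)
  · rw [← mul_assoc]
    exact mul_le_mul_of_nonneg_left ((hR s (hT' s hs)).2.2 α hα.1)
      (binomialWeight_nonneg hp0 hp1 n s)
  · rw [← mul_assoc]
    refine mul_le_of_le_one_right (binomialWeight_nonneg hp0 hp1 n s) ?_
    rw [div_le_one (by positivity)]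
    refine (Finset.sum_le_card_nsmul _ _ 1 fun π _ =>
      (winProbOnList_mem _ (onlineList_nodup hα.1.injective s π)).2).trans ?_
    simp [Fintype.card_perm]

theorem guarantee_le_one {p : ℝ} (hp0 : 0 ≤ p) (hp1 : p ≤ 1) (A : Algorithm) :
    guarantee p A ≤ 1 := by
  have := guarantee_le_sum hp0 hp1 A one_pos ∅ (Finset.empty_subset _)
  rwa [Finset.sum_empty, zero_add, Finset.sdiff_empty, sum_binomialWeight] at this

theorem sum_gain_le {s n : ℕ} (hs : s < n) (k : ℕ) :
    ∑ m ∈ Finset.Ico s n, (1 / n : ℝ) * gain k ((m + 1) / n) ≤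
      (∫ τ in ((s + 1 : ℝ) / n)..1, gain k τ) + 1 / n := by
  have hn0 : (0 : ℝ) < n := by exact_mod_cast (Nat.zero_le s).trans_lt hs
  have hint : ∀ a b : ℝ, 0 ≤ a → a ≤ b → IntervalIntegrable (gain k) volume a b :=
    fun a b ha hab => gain_intervalIntegrable k ha hab
  have h1 : ∀ m : ℕ, (1 / n : ℝ) * gain k ((m + 1) / n) ≤
      ∫ τ in (((m : ℕ) + 1 : ℝ) / n)..((((m + 1 : ℕ) : ℝ) + 1) / n), gain k τ := fun m => by
    have hpos : (0 : ℝ) < (m + 1) / n := by positivity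
    have hle : ((m : ℝ) + 1) / n ≤ (((m + 1 : ℕ) : ℝ) + 1) / n := by
      push_cast; gcongr; linarith
    have := intervalIntegral.integral_mono_on hle (intervalIntegrable_const (μ := volume)
      (c := gain k ((m + 1) / n))) (hint _ _ hpos.le hle)
      fun τ hτ => gain_mono k hpos hτ.1
    rw [intervalIntegral.integral_const, smul_eq_mul] at this
    refine le_trans (le_of_eq ?_) this
    congr 1
    push_cast
    ring
  refine (Finset.sum_le_sum fun m _ => h1 m).trans ?_
  rw [intervalIntegral.sum_integral_adjacent_intervals_Ico
    (a := fun m : ℕ => ((m : ℝ) + 1) / n) hs.le fun m _ => hint _ _ (by positivity) (by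
      push_cast; gcongr; linarith)]
  have hs1 : ((s : ℝ) + 1) / n ≤ 1 := by rw [div_le_one hn0]; exact_mod_cast hs
  have hn1 : (1 : ℝ) ≤ ((n : ℝ) + 1) / n := by rw [le_div_iff₀ hn0]; linarith
  rw [← intervalIntegral.integral_add_adjacent_intervals (hint _ 1 (by positivity) hs1)
    (hint 1 _ zero_le_one hn1)]
  refine add_le_add_right ((integral_gain_le k zero_le_one hn1).trans (le_of_eq ?_)) _
  field_simp
  ring

theorem sampleBound_le {p δ : ℝ} (hp0 : 0 ≤ p) (hδ : 0 < δ) (hδ1 : p + 2 * δ < 1) {s n : ℕ}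
    (hs : s < n) (hs1 : p - δ ≤ (s + 1) / n) (hs2 : (s : ℝ) / (n - 1) ≤ p + 2 * δ) :
    sampleBound n s ≤ optValue p + ((1 - (p + 2 * δ))⁻¹ - (1 - p)⁻¹) +
      (1 - (p + 2 * δ))⁻¹ * (δ + 1 / n) := by
  have hn0 : (0 : ℝ) < n := by exact_mod_cast (Nat.zero_le s).trans_lt hs
  have hn1 : (0 : ℝ) ≤ n - 1 := by
    have : (1 : ℝ) ≤ n := by exact_mod_cast (Nat.succ_le_of_lt ((Nat.zero_le s).trans_lt hs))
    linarith
  have hs' : ((s : ℝ) + 1) / n ≤ 1 := by rw [div_le_one hn0]; exact_mod_cast hs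
  have hp1 : p < 1 := by linarith
  set p' := p + 2 * δ with hp'
  have hp'0 : 0 ≤ p' := by positivity
  have hsum := ((summable_integral_gain hp0 hp1).hasSum.add
    ((hasSum_geometric_of_lt_one hp'0 hδ1).sub (hasSum_geometric_of_lt_one hp0 hp1))).add
    ((hasSum_geometric_of_lt_one hp'0 hδ1).mul_right (δ + 1 / (n : ℝ)))
  rw [sampleBound, Finset.sum_comm]
  have hpow : ∀ k, p ^ k ≤ p' ^ k := fun k => pow_le_pow_left₀ hp0 (by linarith) k
  refine (Finset.sum_le_sum fun k _ => ?_).trans (sum_le_hasSum (Finset.range (s + 1))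
    (fun k _ => ?_) hsum)
  · have h1 : ∑ m ∈ Finset.Ico s n, (1 / n : ℝ) * ((s : ℝ) / (n - 1)) ^ k * gain k ((m + 1) / n) =
        ((s : ℝ) / (n - 1)) ^ k * ∑ m ∈ Finset.Ico s n, (1 / n : ℝ) * gain k ((m + 1) / n) := by
      rw [Finset.mul_sum]
      exact Finset.sum_congr rfl fun m _ => by ring
    rw [h1]
    set c := ∫ τ in p..1, gain k τ with hc
    have hc1 : c ≤ 1 := (integral_gain_le k hp0 hp1.le).trans (by linarith)
    have hc0 : 0 ≤ c := integral_gain_nonneg k hp1.le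
    have h2 : (∫ τ in ((s + 1 : ℝ) / n)..1, gain k τ) ≤ c + δ := by
      rcases le_total p ((s + 1 : ℝ) / n) with h | h
      · rw [hc, ← intervalIntegral.integral_add_adjacent_intervals
          (gain_intervalIntegrable k hp0 h) (gain_intervalIntegrable k (by positivity) hs')]
        have := integral_gain_nonneg k h
        linarith
      · rw [← intervalIntegral.integral_add_adjacent_intervals
          (gain_intervalIntegrable k (by positivity) h) (gain_intervalIntegrable k hp0 hp1.le)]
        have := integral_gain_le k (by positivity) h
        linarith
    have h3 := sum_gain_le hs k
    have h4 : ((s : ℝ) / (n - 1)) ^ k ≤ p' ^ k := pow_le_pow_left₀ (by positivity) hs2 k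
    have h5 : 0 ≤ c + δ + 1 / (n : ℝ) := by positivity
    calc ((s : ℝ) / (n - 1)) ^ k * ∑ m ∈ Finset.Ico s n, (1 / n : ℝ) * gain k ((m + 1) / n)
        ≤ ((s : ℝ) / (n - 1)) ^ k * (c + δ + 1 / (n : ℝ)) :=
          mul_le_mul_of_nonneg_left (by linarith) (by positivity)
      _ ≤ p' ^ k * (c + δ + 1 / (n : ℝ)) := mul_le_mul_of_nonneg_right h4 h5
      _ ≤ p ^ k * c + (p' ^ k - p ^ k) + p' ^ k * (δ + 1 / (n : ℝ)) := by
          nlinarith [hpow k]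
  · have h1 : 0 ≤ ∫ τ in p..1, gain k τ := integral_gain_nonneg k hp1.le
    have := hpow k
    have h2 : 0 ≤ p' ^ k - p ^ k := by linarith
    positivity

theorem guarantee_le_add {p δ : ℝ} (hp0 : 0 ≤ p) (hδ : 0 < δ) (hδ1 : p + 2 * δ < 1)
    (A : Algorithm) {n : ℕ} (hn : 1 / δ < n) :
    guarantee p A ≤ optValue p + ((1 - (p + 2 * δ))⁻¹ - (1 - p)⁻¹) +
      (1 - (p + 2 * δ))⁻¹ * (δ + 1 / n) + 1 / (n * δ ^ 2) := by
  have hp1 : p ≤ 1 := by linarith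
  have hn0 : (0 : ℝ) < n := lt_trans (by positivity) hn
  have hnN : 0 < n := by exact_mod_cast hn0
  have hn1 : 1 < n * δ := by rwa [div_lt_iff₀ hδ] at hn
  have hn2 : (0 : ℝ) < n - 1 := by nlinarith
  let T := (Finset.range n).filter fun s : ℕ => |p - s / n| < δ
  refine (guarantee_le_sum hp0 hp1 A hnN T (Finset.filter_subset _ _)).trans (add_le_add ?_ ?_)
  · set D := optValue p + ((1 - (p + 2 * δ))⁻¹ - (1 - p)⁻¹) +
      (1 - (p + 2 * δ))⁻¹ * (δ + 1 / n) with hD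
    have hopt : 0 ≤ optValue p := tsum_nonneg fun k =>
      mul_nonneg (pow_nonneg hp0 k) (integral_gain_nonneg k hp1)
    have hinv : (1 - p)⁻¹ ≤ (1 - (p + 2 * δ))⁻¹ :=
      inv_anti₀ (by linarith) (by linarith)
    have hpos : 0 < (1 - (p + 2 * δ))⁻¹ := inv_pos.2 (by linarith)
    have hD0 : 0 ≤ D := by
      have : 0 < (1 - (p + 2 * δ))⁻¹ * (δ + 1 / n) := by positivity
      linarith
    calc ∑ s ∈ T, binomialWeight p n s * sampleBound n s
        ≤ ∑ s ∈ T, binomialWeight p n s * D := by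
          refine Finset.sum_le_sum fun s hs => mul_le_mul_of_nonneg_left ?_
            (binomialWeight_nonneg hp0 hp1 n s)
          obtain ⟨hs1, hs2⟩ := Finset.mem_filter.1 hs
          rw [abs_lt] at hs2
          have h3 : (s : ℝ) / n ≤ (s + 1) / n := by gcongr; linarith
          refine sampleBound_le hp0 hδ hδ1 (Finset.mem_range.1 hs1) (by linarith) ?_
          rw [div_le_iff₀ hn2]
          have h4 : (s : ℝ) < (p + δ) * n := by
            rw [← div_lt_iff₀ hn0]; linarith
          nlinarith
      _ = (∑ s ∈ T, binomialWeight p n s) * D := by rw [Finset.sum_mul]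
      _ ≤ 1 * D := by
          refine mul_le_mul_of_nonneg_right ?_ hD0
          rw [← sum_binomialWeight p n]
          exact Finset.sum_le_sum_of_subset_of_nonneg
            ((Finset.filter_subset _ _).trans (Finset.range_mono n.le_succ))
            fun s _ _ => binomialWeight_nonneg hp0 hp1 n s
      _ = D := one_mul D
  · refine (Finset.sum_le_sum_of_subset_of_nonneg (fun s hs => ?_)
      fun s _ _ => binomialWeight_nonneg hp0 hp1 n s).trans
      (sum_binomialWeight_far_le hp0 hp1 hδ hnN)
    rw [Finset.mem_sdiff, Finset.mem_range] at hs
    rw [Finset.mem_filter, Finset.mem_range]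
    refine ⟨hs.1, not_lt.1 fun h => ?_⟩
    by_cases hsn : s = n
    · subst hsn
      rw [div_self hn0.ne', abs_lt] at h
      linarith
    · exact hs.2 (Finset.mem_filter.2 ⟨Finset.mem_range.2 (by omega), h⟩)

theorem guarantee_le_optValue {p : ℝ} (hp0 : 0 ≤ p) (hp1 : p < 1) (A : Algorithm) :
    guarantee p A ≤ optValue p := by
  have h1 : ∀ δ, 0 < δ → p + 2 * δ < 1 →
      guarantee p A ≤ optValue p + ((1 - (p + 2 * δ))⁻¹ - (1 - p)⁻¹) +
        (1 - (p + 2 * δ))⁻¹ * δ := fun δ hδ hδ1 => by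
    have hlim : Filter.Tendsto (fun n : ℕ => optValue p + ((1 - (p + 2 * δ))⁻¹ - (1 - p)⁻¹) +
        (1 - (p + 2 * δ))⁻¹ * (δ + 1 / (n : ℝ)) + 1 / (n : ℝ) * (1 / δ ^ 2)) Filter.atTop
        (nhds (optValue p + ((1 - (p + 2 * δ))⁻¹ - (1 - p)⁻¹) +
          (1 - (p + 2 * δ))⁻¹ * (δ + 0) + 0 * (1 / δ ^ 2))) :=
      (((tendsto_one_div_atTop_nhds_zero_nat.const_add _).const_mul _).const_add _).add
        (tendsto_one_div_atTop_nhds_zero_nat.mul_const _)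
    rw [add_zero, zero_mul, add_zero] at hlim
    refine ge_of_tendsto hlim ?_
    filter_upwards [tendsto_natCast_atTop_atTop.eventually (Filter.eventually_gt_atTop (1 / δ))]
      with n hn
    refine (guarantee_le_add hp0 hδ hδ1 A hn).trans (le_of_eq ?_)
    rw [one_div_mul_one_div]
  have hcont : ContinuousAt (fun δ : ℝ => optValue p + ((1 - (p + 2 * δ))⁻¹ - (1 - p)⁻¹) +
      (1 - (p + 2 * δ))⁻¹ * δ) 0 := by
    have : 1 - (p + 2 * (0 : ℝ)) ≠ 0 := by linarith
    fun_prop (disch := assumption)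
  have hlim := hcont.tendsto
  simp only [mul_zero, add_zero, sub_self] at hlim
  refine ge_of_tendsto (hlim.mono_left (nhdsWithin_le_nhds (s := Set.Ioi 0))) ?_
  filter_upwards [self_mem_nhdsWithin, nhdsWithin_le_nhds
    (gt_mem_nhds (show (0 : ℝ) < (1 - p) / 2 by linarith))] with δ hδ hδ1
  exact h1 δ hδ (by linarith)

end ROSp
namespace ROSp

/-! ### The order of independent uniform arrival times -/

open scoped unitInterval

theorem ae_injective (n : ℕ) : ∀ᵐ τ : Fin n → I, Function.Injective τ := by
  have h : ∀ i j : Fin n, i ≠ j → ∀ᵐ τ : Fin n → I, τ i ≠ τ j := fun i j hij => by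
    obtain ⟨m, rfl⟩ : ∃ m, n = m + 1 := ⟨n - 1, by have := i.2; omega⟩
    obtain ⟨j, rfl⟩ := Fin.exists_succAbove_eq hij.symm
    have hm : MeasurableSet {τ : Fin (m + 1) → I | τ i = τ (i.succAbove j)} :=
      measurableSet_eq_fun (measurable_pi_apply _) (measurable_pi_apply _)
    have h0 : volume {τ : Fin (m + 1) → I | τ i = τ (i.succAbove j)} = 0 := by
      rw [volume_eq_lintegral_insertNth i hm]
      refine (lintegral_congr fun a => ?_).trans lintegral_zero
      have := Measure.pi_hyperplane (fun _ : Fin m => (volume : Measure I)) j a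
      simpa [eq_comm, volume_pi] using this
    rw [ae_iff]
    simpa using h0
  have h' : ∀ i j : Fin n, ∀ᵐ τ : Fin n → I, i ≠ j → τ i ≠ τ j := fun i j => by
    by_cases hij : i = j
    · simp [hij]
    · filter_upwards [h i j hij] with τ hτ _ using hτ
  filter_upwards [ae_all_iff.2 fun i => ae_all_iff.2 fun j => h' i j] with τ hτ i j hij
  by_contra hne
  exact hτ i j hne hij

theorem measurePreserving_comp_perm {n : ℕ} (π : Equiv.Perm (Fin n)) :
    MeasurePreserving (fun (u : Fin n → I) i => u (π.symm i)) volume volume := by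
  have := volume_measurePreserving_piCongrLeft (fun _ : Fin n => I) π
  convert this using 1
  funext u i
  obtain ⟨k, rfl⟩ := π.surjective i
  simp [MeasurableEquiv.piCongrLeft]

theorem volume_eq_sum_perm {n : ℕ} {A : Set (Fin n → I)} (hA : MeasurableSet A) :
    volume.real A = ∑ π : Equiv.Perm (Fin n),
      volume.real {u : Fin n → I | StrictMono u ∧ (fun i => u (π.symm i)) ∈ A} := by
  have hsm : MeasurableSet {u : Fin n → I | StrictMono u} := by
    refine measurableSet_setOfPred.2 ?_
    unfold StrictMono
    refine Measurable.forall fun i => Measurable.forall fun j => Measurable.imp measurable_const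
      (measurableSet_setOfPred.1 (measurableSet_lt (measurable_pi_apply i) (measurable_pi_apply j)))
  let B : Equiv.Perm (Fin n) → Set (Fin n → I) := fun π =>
    {τ | StrictMono (fun k => τ (π k)) ∧ τ ∈ A}
  have hB : ∀ π, MeasurableSet (B π) := fun π =>
    (hsm.preimage (measurable_pi_lambda _ fun k => measurable_pi_apply (π k))).inter hA
  have h1 : volume.real A = volume.real (⋃ π, B π) := by
    refine measureReal_congr ?_
    filter_upwards [ae_injective n] with τ hτ
    refine propext ⟨fun h => ?_, fun h => ?_⟩
    · exact Set.mem_iUnion.2 ⟨Tuple.sort τ,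
        (Tuple.monotone_sort τ).strictMono_of_injective (hτ.comp (Tuple.sort τ).injective), h⟩
    · obtain ⟨π, -, h⟩ := Set.mem_iUnion.1 h
      exact h
  rw [h1, measureReal_iUnion_fintype ?_ hB]
  · refine Finset.sum_congr rfl fun π _ => ?_
    rw [measureReal_def, measureReal_def,
      ← (measurePreserving_comp_perm π).measure_preimage (hB π).nullMeasurableSet]
    congr 2
    ext u
    simp [B]
  · intro π π' hne
    refine Set.disjoint_left.2 fun τ h h' => hne ?_
    have hr : Set.range (fun k => τ (π k)) = Set.range fun k => τ (π' k) := by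
      rw [show (fun k => τ (π k)) = τ ∘ π from rfl, show (fun k => τ (π' k)) = τ ∘ π' from rfl,
        π.surjective.range_comp, π'.surjective.range_comp]
    have he := (h.1.range_inj h'.1).1 hr
    have hinj : Function.Injective τ := by
      have := h.1.injective.comp π.symm.injective
      simpa [Function.comp_def] using this
    exact Equiv.ext fun k => hinj (congrFun he k)

/-- The increasing sequences of arrival times, the first `s` of which are smaller than `p`. -/
def orderedTimes (p : ℝ) (n s : ℕ) : Set (Fin n → I) :=
  {u | StrictMono u ∧ ∀ k, (u k : ℝ) < p ↔ (k : ℕ) < s}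

theorem measurable_coe_apply_lt {n : ℕ} (i : Fin n) (a : ℝ) :
    Measurable fun τ : Fin n → I => ((τ i : ℝ) < a) :=
  measurableSet_setOfPred.1 (measurableSet_lt (measurable_subtype_coe.comp (measurable_pi_apply i))
    measurable_const)

theorem measurableSet_orderedTimes (p : ℝ) (n s : ℕ) : MeasurableSet (orderedTimes p n s) := by
  refine measurableSet_setOfPred.2 (Measurable.and ?_ ?_)
  · unfold StrictMono
    refine Measurable.forall fun i => Measurable.forall fun j => Measurable.imp measurable_const
      (measurableSet_setOfPred.1 (measurableSet_lt (measurable_pi_apply i) (measurable_pi_apply j)))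
  · exact Measurable.forall fun k => (measurable_coe_apply_lt k p).iff measurable_const

theorem mem_orderedTimes_iff {p : ℝ} {n s : ℕ} (hs : s ≤ n) {u : Fin n → I} (hu : StrictMono u) :
    u ∈ orderedTimes p n s ↔ (Finset.univ.filter fun k => (u k : ℝ) < p).card = s := by
  have key : ∀ k, (u k : ℝ) < p ↔ (k : ℕ) < (Finset.univ.filter fun k => (u k : ℝ) < p).card :=
    fun k => by
      constructor
      · intro hk
        rw [← Nat.succ_le_iff, Nat.succ_eq_add_one, ← Fin.card_Iic]
        refine Finset.card_le_card fun i hi => ?_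
        rw [Finset.mem_filter]
        refine ⟨Finset.mem_univ _, lt_of_le_of_lt ?_ hk⟩
        exact_mod_cast hu.monotone (Finset.mem_Iic.1 hi)
      · intro hk
        by_contra hp
        refine absurd hk (not_lt.2 ?_)
        rw [← Fin.card_Iio]
        refine Finset.card_le_card fun i hi => ?_
        rw [Finset.mem_Iio]
        by_contra hki
        refine hp (lt_of_le_of_lt ?_ (Finset.mem_filter.1 hi).2)
        exact_mod_cast hu.monotone (not_lt.1 hki)
  constructor
  · rintro ⟨-, h⟩
    simp only [h]
    refine (Fin.card_filter_val_lt).trans (min_eq_right hs)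
  · intro h
    exact ⟨hu, fun k => by rw [key, h]⟩

theorem volume_sample_eq {p : ℝ} (hp0 : 0 ≤ p) (hp1 : p ≤ 1) {n : ℕ} (P : Finset (Fin n)) :
    volume.real {τ : Fin n → I | ∀ i, (τ i : ℝ) < p ↔ i ∈ P} =
      p ^ P.card * (1 - p) ^ (n - P.card) := by
  classical
  have h : {τ : Fin n → I | ∀ i, (τ i : ℝ) < p ↔ i ∈ P} =
      Set.univ.pi fun i => if i ∈ P then {x : I | (x : ℝ) < p} else {x : I | p ≤ (x : ℝ)} := by
    ext τ
    simp only [Set.mem_pi, Set.mem_univ, true_implies, Set.mem_ofPred_eq]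
    refine forall_congr' fun i => ?_
    by_cases hi : i ∈ P <;> simp [hi]
  rw [measureReal_def, h, volume_pi_pi]
  simp only [apply_ite, volume_coe_lt hp0 hp1, volume_le_coe hp0 hp1]
  rw [Finset.prod_ite]
  simp only [Finset.prod_const, ENNReal.toReal_mul, ENNReal.toReal_pow, ENNReal.toReal_ofReal hp0,
    ENNReal.toReal_ofReal (sub_nonneg.2 hp1)]
  congr 2
  · simp
  · rw [Finset.filter_not, Finset.card_sdiff_of_subset (Finset.filter_subset _ _)]
    simp

theorem factorial_mul_volume_orderedTimes {p : ℝ} (hp0 : 0 ≤ p) (hp1 : p ≤ 1) {n s : ℕ}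
    (hs : s ≤ n) : n.factorial * volume.real (orderedTimes p n s) = binomialWeight p n s := by
  classical
  have hmP : ∀ P : Finset (Fin n), MeasurableSet {τ : Fin n → I | ∀ i, (τ i : ℝ) < p ↔ i ∈ P} :=
    fun P => measurableSet_setOfPred.2
      (Measurable.forall fun i => (measurable_coe_apply_lt i p).iff measurable_const)
  have hA : {τ : Fin n → I | (Finset.univ.filter fun k => (τ k : ℝ) < p).card = s} =
      ⋃ P ∈ Finset.powersetCard s (Finset.univ : Finset (Fin n)),
        {τ : Fin n → I | ∀ i, (τ i : ℝ) < p ↔ i ∈ P} := by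
    ext τ
    simp only [Set.mem_ofPred_eq, Set.mem_iUnion, Finset.mem_powersetCard, exists_prop]
    constructor
    · intro h
      exact ⟨_, ⟨Finset.subset_univ _, h⟩, fun i => by simp⟩
    · rintro ⟨P, ⟨-, hP⟩, h⟩
      rw [← hP]
      congr 1
      ext i
      simp [h i]
  have hmA : MeasurableSet
      {τ : Fin n → I | (Finset.univ.filter fun k => (τ k : ℝ) < p).card = s} := by
    rw [hA]
    exact Finset.measurableSet_biUnion _ fun P _ => hmP P
  have h1 : volume.real {τ : Fin n → I | (Finset.univ.filter fun k => (τ k : ℝ) < p).card = s} =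
      binomialWeight p n s := by
    rw [hA, measureReal_biUnion_finset ?_ fun P _ => hmP P]
    · rw [Finset.sum_congr rfl fun P hP => by
        rw [volume_sample_eq hp0 hp1 P, (Finset.mem_powersetCard.1 hP).2]]
      rw [Finset.sum_const, Finset.card_powersetCard, Finset.card_univ, Fintype.card_fin,
        nsmul_eq_mul, binomialWeight]
    · intro P _ P' _ hne
      refine Set.disjoint_left.2 fun τ h h' => hne ?_
      ext i
      rw [← h i, ← h' i]
  rw [← h1, volume_eq_sum_perm hmA, Finset.sum_congr rfl fun π _ => ?_, Finset.sum_const,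
    Finset.card_univ, Fintype.card_perm, Fintype.card_fin, nsmul_eq_mul]
  congr 1
  ext u
  refine ⟨fun h => ?_, fun h => ⟨h.1, ?_⟩⟩
  · rw [mem_orderedTimes_iff hs h.1]
    exact (Finset.card_equiv π fun k => by simp).trans h.2
  · rw [mem_orderedTimes_iff hs h.1] at h
    exact (Finset.card_equiv π.symm fun k => by simp).trans h

end ROSp
namespace ROSp

/-! ### Realizing `ALG_t` by an algorithm that observes the values only -/

open scoped unitInterval

/-- If the sampled values are `S`, the online values revealed so far are those in `L`, and the
arrival times of all elements in increasing order are `u`, then the last value in `L` is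
acceptable. -/
def Accepts (t : ℕ → ℝ) {n : ℕ} (S : Finset ℝ) (u : Fin n → I) (L : List ℝ) : Prop :=
  ∃ v ∈ L.getLast?, (∀ y ∈ L.dropLast, y < v) ∧ ∃ k, t k ≤ extend (fun i => (u i : ℝ)) (S.card + L.length - 1) ∧
    extend (fun i => (u i : ℝ)) (S.card + L.length - 1) < t (k + 1) ∧ nthLargest S k < (v : WithBot ℝ)

/-- The arrival times for which the last value in `L` is the first acceptable one. -/
def stopTimes (t : ℕ → ℝ) (p : ℝ) (n : ℕ) (S : Finset ℝ) (L : List ℝ) : Set (Fin n → I) :=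
  {u | u ∈ orderedTimes p n S.card ∧ Accepts t S u L ∧
    ∀ i, i + 1 < L.length → ¬ Accepts t S u (L.take (i + 1))}

/-- The algorithm that stops with the conditional probability that `ALG_t` does. -/
noncomputable def realization (t : ℕ → ℝ) (p : ℝ) : Algorithm := fun n S L =>
  Set.projIcc 0 1 zero_le_one (volume.real (stopTimes t p n S L) /
    (volume.real (orderedTimes p n S.card) -
      ∑ i ∈ Finset.range (L.length - 1), volume.real (stopTimes t p n S (L.take (i + 1)))))

theorem length_segment {β : Type*} (s j : ℕ) (x : ℕ → β) : (segment s j x).length = j := by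
  simp [segment]

theorem accepts_segment {t : ℕ → ℝ} {n s j : ℕ} {S : Finset ℝ} (hS : S.card = s) {u : Fin n → I}
    {x : ℕ → ℝ} : Accepts t S u (segment s (j + 1) x) ↔
      (∀ i, s ≤ i → i < s + j → x i < x (s + j)) ∧ ∃ k, t k ≤ extend (fun i => (u i : ℝ)) (s + j) ∧
        extend (fun i => (u i : ℝ)) (s + j) < t (k + 1) ∧ nthLargest S k < (x (s + j) : WithBot ℝ) := by
  have h1 : segment s (j + 1) x = segment s j x ++ [x (s + j)] := by
    rw [segment, List.range'_concat, List.map_append, segment]; simp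
  have h2 : S.card + (segment s (j + 1) x).length - 1 = s + j := by
    rw [length_segment, hS]; omega
  unfold Accepts
  rw [h2, h1, List.getLast?_concat, List.dropLast_concat]
  simp only [Option.mem_def, Option.some.injEq, exists_eq_left', segment, List.mem_map,
    List.mem_range'_1, forall_exists_index, and_imp]
  refine and_congr_left' ⟨fun h i hi hij => h _ i hi hij rfl, ?_⟩
  rintro h _ i hi hij rfl
  exact h i hi hij

theorem sampleValues_eq {p : ℝ} {n s : ℕ} (hs : s ≤ n) (β : Fin n ↪ ℝ) {u : Fin n → I}
    (hu : u ∈ orderedTimes p n s) : sampleValues p β u = (Finset.range s).image (extend β) := by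
  ext v
  simp only [sampleValues, Finset.mem_map, Finset.mem_filter, Finset.mem_univ, true_and, hu.2,
    Finset.mem_image, Finset.mem_range]
  constructor
  · rintro ⟨k, hk, rfl⟩
    exact ⟨k, hk, extend_of_lt _ k.2⟩
  · rintro ⟨k, hk, rfl⟩
    exact ⟨⟨k, hk.trans_le hs⟩, hk, (extend_of_lt _ (hk.trans_le hs)).symm⟩

theorem card_image_extend {n s : ℕ} (hs : s ≤ n) (β : Fin n ↪ ℝ) :
    ((Finset.range s).image (extend β)).card = s := by
  rw [Finset.card_image_of_injOn, Finset.card_range]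
  intro i hi j hj h
  have hi' := (Finset.mem_range.1 hi).trans_le hs
  have hj' := (Finset.mem_range.1 hj).trans_le hs
  rw [extend_of_lt _ hi', extend_of_lt _ hj'] at h
  exact congrArg Fin.val (β.injective h)

theorem acceptable_iff_accepts {t : ℕ → ℝ} {p : ℝ} {n s : ℕ} (hs : s ≤ n) (β : Fin n ↪ ℝ)
    {u : Fin n → I} (hu : u ∈ orderedTimes p n s) (k : Fin n) : Acceptable t p β u k ↔
      s ≤ k ∧ Accepts t ((Finset.range s).image (extend β)) u
        (segment s (k - s + 1) (extend β)) := by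
  have hle : ∀ j, p ≤ (u j : ℝ) ↔ s ≤ (j : ℕ) := fun j => by
    rw [← not_lt, hu.2, not_lt]
  rw [Acceptable, hle]
  refine and_congr_right fun hk => ?_
  rw [accepts_segment (card_image_extend hs β), show s + ((k : ℕ) - s) = k by omega,
    extend_of_lt _ k.2, extend_of_lt _ k.2, sampleValues_eq hs β hu]
  refine and_congr_left' ?_
  constructor
  · intro h i hi hik
    rw [extend_of_lt _ (hik.trans k.2)]
    exact h ⟨i, hik.trans k.2⟩ ((hle _).2 hi) (hu.1 hik)
  · intro h j hj hjk
    have := h j ((hle j).1 hj) (hu.1.lt_iff_lt.1 hjk)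
    rwa [extend_of_lt _ j.2] at this

theorem wins_iff_mem_stopTimes {t : ℕ → ℝ} {p : ℝ} {n s M l : ℕ} (β : Fin n ↪ ℝ)
    (hM : IsLastRecord s n M l (extend β)) {u : Fin n → I} (hu : u ∈ orderedTimes p n s) :
    Wins t p β u ↔ u ∈ stopTimes t p n ((Finset.range s).image (extend β))
      (segment s (M - s + 1) (extend β)) := by
  obtain ⟨hsM, hMn, hmax, -⟩ := hM
  have hs : s ≤ n := hsM.trans hMn.le
  have hle : ∀ j, p ≤ (u j : ℝ) ↔ s ≤ (j : ℕ) := fun j => by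
    rw [← not_lt, hu.2, not_lt]
  have htake : ∀ i, i + 1 < M - s + 1 → (segment s (M - s + 1) (extend β)).take (i + 1) =
      segment s (i + 1) (extend β) := fun i hi => take_segment hi.le _
  have hpicks : Picks t p β u ⟨M, hMn⟩ ↔ u ∈ stopTimes t p n ((Finset.range s).image (extend β))
      (segment s (M - s + 1) (extend β)) := by
    unfold Picks stopTimes
    rw [Set.mem_ofPred_eq, card_image_extend hs β, acceptable_iff_accepts hs β hu, length_segment]
    simp only [hu, true_and, hsM]
    refine and_congr_right fun _ => ⟨fun h i hi => ?_, fun h j hj => ?_⟩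
    · have hi' : s + i < n := by omega
      have := h ⟨s + i, hi'⟩ (hu.1 (by rw [Fin.lt_def]; simp only; omega))
      rw [acceptable_iff_accepts hs β hu, not_and] at this
      rw [htake i hi]
      simpa using this (by simp)
    · have hjM : (j : ℕ) < M := hu.1.lt_iff_lt.1 hj
      rw [acceptable_iff_accepts hs β hu, not_and]
      intro hj'
      have := h (j - s) (by omega)
      rwa [htake _ (by omega)] at this
  rw [← hpicks, Wins]
  constructor
  · rintro (h | ⟨i, hi, hi'⟩)
    · exact absurd ((hu.2 _).1 (h ⟨M, hMn⟩)) (not_lt.2 hsM)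
    · have hiM : i = ⟨M, hMn⟩ := by
        by_contra hne
        have h1 := hi' ⟨M, hMn⟩ ((hle _).2 hsM)
        have h2 := hmax i ((hle i).1 hi.1.1) i.2 fun h => hne (Fin.ext h)
        rw [extend_of_lt _ i.2, extend_of_lt _ hMn] at h2
        exact absurd h2 (not_lt.2 h1)
      rwa [← hiM]
  · intro h
    refine Or.inr ⟨_, h, fun j hj => ?_⟩
    by_cases hjM : (j : ℕ) = M
    · exact (congrArg β (Fin.ext hjM)).le
    · have := hmax j ((hle j).1 hj) j.2 hjM
      rw [extend_of_lt _ j.2, extend_of_lt _ hMn] at this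
      exact this.le

theorem measurable_accepts (t : ℕ → ℝ) {n : ℕ} (S : Finset ℝ) (L : List ℝ) :
    Measurable fun u : Fin n → I => Accepts t S u L := by
  have hm : Measurable fun u : Fin n → I => extend (fun i => (u i : ℝ)) (S.card + L.length - 1) := by
    by_cases h : S.card + L.length - 1 < n
    · simp only [extend_of_lt _ h]
      exact measurable_coe_apply _
    · simp only [extend, h, dif_neg, not_false_eq_true]
      exact measurable_const
  unfold Accepts
  by_cases hv : ∃ v, v ∈ L.getLast?
  · obtain ⟨v, hv⟩ := hv
    have hv' : L.getLast? = some v := hv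
    simp only [hv', Option.mem_def, Option.some.injEq, exists_eq_left']
    refine measurable_const.and (Measurable.exists fun k => Measurable.and ?_
      (Measurable.and ?_ measurable_const))
    · exact measurableSet_setOfPred.1 (measurableSet_le measurable_const hm)
    · exact measurableSet_setOfPred.1 (measurableSet_lt hm measurable_const)
  · have : ∀ u : Fin n → I, ¬ ∃ v ∈ L.getLast?, (∀ y ∈ L.dropLast, y < v) ∧
        ∃ k, t k ≤ extend (fun i => (u i : ℝ)) (S.card + L.length - 1) ∧
          extend (fun i => (u i : ℝ)) (S.card + L.length - 1) < t (k + 1) ∧ nthLargest S k < (v : WithBot ℝ) :=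
      fun u ⟨v, h, _⟩ => hv ⟨v, h⟩
    simp only [this]
    exact measurable_const

theorem measurableSet_stopTimes (t : ℕ → ℝ) (p : ℝ) (n : ℕ) (S : Finset ℝ) (L : List ℝ) :
    MeasurableSet (stopTimes t p n S L) :=
  (measurableSet_orderedTimes p n _).inter (measurableSet_setOfPred.2
    ((measurable_accepts t S L).and (Measurable.forall fun _ =>
      measurable_const.imp (measurable_accepts t S _).not)))

theorem sum_volume_stopTimes_le (t : ℕ → ℝ) (p : ℝ) (n : ℕ) (S : Finset ℝ) (s : ℕ) (x : ℕ → ℝ)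
    (j : ℕ) : ∑ i ∈ Finset.range j, volume.real (stopTimes t p n S (segment s (i + 1) x)) ≤
      volume.real (orderedTimes p n S.card) := by
  rw [← measureReal_biUnion_finset ?_ fun i _ => measurableSet_stopTimes t p n S _]
  · exact measureReal_mono (Set.iUnion₂_subset fun i _ u hu => hu.1)
  · have key : ∀ a b, a < b → ∀ u, u ∈ stopTimes t p n S (segment s (a + 1) x) →
        u ∉ stopTimes t p n S (segment s (b + 1) x) := fun a b hab u ha hb => by
      have := hb.2.2 a (by rw [length_segment]; omega)
      rw [take_segment (by omega)] at this
      exact this ha.2.1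
    intro a _ b _ hne
    refine Set.disjoint_left.2 fun u ha hb => ?_
    rcases lt_or_gt_of_ne hne with h | h
    · exact key a b h u ha hb
    · exact key b a h u hb ha

theorem prod_one_sub_div_mul {F : ℕ → ℝ} {D : ℝ} (hF : ∀ i, 0 ≤ F i)
    (hD : ∀ j, ∑ i ∈ Finset.range j, F i ≤ D) (j : ℕ) :
    (∏ i ∈ Finset.range j, (1 - F i / (D - ∑ l ∈ Finset.range i, F l))) * D =
      D - ∑ i ∈ Finset.range j, F i := by
  induction j with
  | zero => simp
  | succ j ih =>
    rw [Finset.prod_range_succ, mul_right_comm, ih, Finset.sum_range_succ]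
    have h1 := hD (j + 1)
    rw [Finset.sum_range_succ] at h1
    by_cases h : D - ∑ i ∈ Finset.range j, F i = 0
    · have := hF j
      rw [h]
      linarith
    · rw [mul_sub, mul_one, mul_div_cancel₀ _ h]; ring

theorem prod_one_sub_div_mul_div_mul {F : ℕ → ℝ} {D : ℝ} (hF : ∀ i, 0 ≤ F i)
    (hD : ∀ j, ∑ i ∈ Finset.range j, F i ≤ D) (j : ℕ) :
    (∏ i ∈ Finset.range j, (1 - F i / (D - ∑ l ∈ Finset.range i, F l))) *
      (F j / (D - ∑ l ∈ Finset.range j, F l)) * D = F j := by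
  rw [mul_right_comm, prod_one_sub_div_mul hF hD]
  have h1 := hD (j + 1)
  rw [Finset.sum_range_succ] at h1
  by_cases h : D - ∑ i ∈ Finset.range j, F i = 0
  · have := hF j
    rw [h]
    linarith
  · exact mul_div_cancel₀ _ h

theorem realization_segment (t : ℕ → ℝ) (p : ℝ) (n : ℕ) (S : Finset ℝ) (s : ℕ) (x : ℕ → ℝ)
    (j : ℕ) : (realization t p n S (segment s (j + 1) x) : ℝ) =
      volume.real (stopTimes t p n S (segment s (j + 1) x)) /
        (volume.real (orderedTimes p n S.card) -
          ∑ i ∈ Finset.range j, volume.real (stopTimes t p n S (segment s (i + 1) x))) := by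
  have h1 : ∑ i ∈ Finset.range ((segment s (j + 1) x).length - 1),
      volume.real (stopTimes t p n S ((segment s (j + 1) x).take (i + 1))) =
      ∑ i ∈ Finset.range j, volume.real (stopTimes t p n S (segment s (i + 1) x)) := by
    rw [length_segment, Nat.add_sub_cancel]
    refine Finset.sum_congr rfl fun i hi => ?_
    rw [take_segment]
    have := Finset.mem_range.1 hi
    omega
  rw [realization, h1, Set.coe_projIcc]
  have h2 := sum_volume_stopTimes_le t p n S s x (j + 1)
  rw [Finset.sum_range_succ] at h2
  have h3 : 0 ≤ volume.real (stopTimes t p n S (segment s (j + 1) x)) := measureReal_nonneg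
  rw [min_eq_right (div_le_one_of_le₀ (by linarith) (by linarith)),
    max_eq_right (div_nonneg h3 (by linarith))]

theorem winProbOnList_realization_mul (t : ℕ → ℝ) (p : ℝ) {n s : ℕ} (hs : s ≤ n) (β : Fin n ↪ ℝ) :
    winProbOnList (realization t p n ((Finset.range s).image (extend β)))
        (segment s (n - s) (extend β)) * volume.real (orderedTimes p n s) =
      volume.real {u | u ∈ orderedTimes p n s ∧ Wins t p β u} := by
  rcases hs.lt_or_eq with hlt | rfl
  · have hinj : Set.InjOn (extend β) (Set.Iio n) := fun i hi j hj h => by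
      rw [extend_of_lt _ hi, extend_of_lt _ hj] at h
      exact congrArg Fin.val (β.injective h)
    obtain ⟨M, l, hM⟩ := exists_isLastRecord hlt hinj
    rw [winProbOnList_segment_eq _ hM]
    simp only [realization_segment, card_image_extend hs]
    have hD := sum_volume_stopTimes_le t p n ((Finset.range s).image (extend β)) s (extend β)
    rw [card_image_extend hs] at hD
    rw [prod_one_sub_div_mul_div_mul (fun _ => measureReal_nonneg) hD]
    congr 1
    ext u
    constructor
    · intro hu
      have hu' := hu.1
      rw [card_image_extend hs] at hu'
      exact ⟨hu', (wins_iff_mem_stopTimes β hM hu').2 hu⟩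
    · rintro ⟨hu, hw⟩
      exact (wins_iff_mem_stopTimes β hM hu).1 hw
  · have h1 : segment s (s - s) (extend β) = [] := by simp [segment]
    rw [h1, winProbOnList, if_pos rfl, one_mul]
    congr 1
    ext u
    refine ⟨fun hu => ⟨hu, Or.inl fun i => (hu.2 i).2 i.2⟩, fun hu => hu.1⟩

theorem wins_comp_perm {t : ℕ → ℝ} {p : ℝ} {n : ℕ} (α : Fin n ↪ ℝ) (π : Equiv.Perm (Fin n))
    (u : Fin n → I) :
    Wins t p α (fun i => u (π.symm i)) ↔ Wins t p (π.toEmbedding.trans α) u := by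
  have hsample : sampleValues p α (fun i => u (π.symm i)) =
      sampleValues p (π.toEmbedding.trans α) u := by
    ext v
    simp only [sampleValues, Finset.mem_map, Finset.mem_filter, Finset.mem_univ, true_and]
    exact (Equiv.exists_congr_right π).symm.trans (exists_congr fun i => by simp)
  have hacc : ∀ k, Acceptable t p α (fun i => u (π.symm i)) (π k) ↔
      Acceptable t p (π.toEmbedding.trans α) u k := fun k => by
    unfold Acceptable
    refine and_congr (by simp) (and_congr ?_ (by simp [hsample]))
    exact (Equiv.forall_congr_right π).symm.trans (forall_congr' fun i => by simp)
  have hpicks : ∀ k, Picks t p α (fun i => u (π.symm i)) (π k) ↔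
      Picks t p (π.toEmbedding.trans α) u k := fun k => by
    refine and_congr (hacc k) ?_
    exact (Equiv.forall_congr_right π).symm.trans (forall_congr' fun i => by simp [hacc])
  refine or_congr ?_ ?_
  · exact (Equiv.forall_congr_right π).symm.trans (forall_congr' fun i => by simp)
  · refine (Equiv.exists_congr_right π).symm.trans (exists_congr fun i =>
      and_congr (hpicks i) ?_)
    exact (Equiv.forall_congr_right π).symm.trans (forall_congr' fun i => by simp)

theorem measurableSet_wins (t : ℕ → ℝ) (p : ℝ) {n : ℕ} (α : Fin n ↪ ℝ) :
    MeasurableSet {τ | Wins t p α τ} := by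
  classical
  have hlt : ∀ i j : Fin n, Measurable fun τ : Fin n → I => τ i < τ j := fun i j =>
    measurableSet_setOfPred.1 (measurableSet_lt (measurable_pi_apply i) (measurable_pi_apply j))
  have hsample : ∀ (i : Fin n) (k : ℕ), Measurable fun τ : Fin n → I =>
      nthLargest (sampleValues p α τ) k < (α i : WithBot ℝ) := fun i k => by
    have h : ∀ τ : Fin n → I, nthLargest (sampleValues p α τ) k < (α i : WithBot ℝ) ↔
        ∃ P : Finset (Fin n), (∀ i, (τ i : ℝ) < p ↔ i ∈ P) ∧
          nthLargest (P.map α) k < (α i : WithBot ℝ) := fun τ => by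
      constructor
      · intro h
        refine ⟨Finset.univ.filter (fun i => (τ i : ℝ) < p), fun i => by simp, ?_⟩
        convert h
        rw [sampleValues]
      · rintro ⟨P, hP, h⟩
        convert h
        rw [sampleValues]
        congr 1
        ext i
        simp [hP]
    simp only [h]
    exact Measurable.exists fun P => (Measurable.forall fun i =>
      (measurable_coe_apply_lt i p).iff measurable_const).and measurable_const
  have hacc : ∀ i, Measurable fun τ : Fin n → I => Acceptable t p α τ i := fun i =>
    (measurable_le_coe p i).and ((Measurable.forall fun j => (measurable_le_coe p j).imp
      ((hlt j i).imp measurable_const)).and (Measurable.exists fun k =>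
        (measurable_le_coe (t k) i).and ((measurable_coe_apply_lt i _).and (hsample i k))))
  exact measurableSet_setOfPred.2 (Measurable.or
    (Measurable.forall fun i => measurable_coe_apply_lt i p)
    (Measurable.exists fun i => ((hacc i).and (Measurable.forall fun j =>
      (hlt j i).imp (hacc j).not)).and (Measurable.forall fun j =>
        (measurable_le_coe p j).imp measurable_const)))

theorem winProb_realization (t : ℕ → ℝ) {p : ℝ} (hp0 : 0 ≤ p) (hp1 : p ≤ 1) {n : ℕ}
    (α : Fin n ↪ ℝ) : winProb p (realization t p) α = algWinProb t p α := by
  have h1 : ∀ π : Equiv.Perm (Fin n),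
      volume.real {u : Fin n → I | StrictMono u ∧ (fun i => u (π.symm i)) ∈ {τ | Wins t p α τ}} =
      ∑ s ∈ Finset.range (n + 1), volume.real
        {u | u ∈ orderedTimes p n s ∧ Wins t p (π.toEmbedding.trans α) u} := fun π => by
    rw [← measureReal_biUnion_finset]
    · congr 1
      ext u
      simp only [Set.mem_ofPred_eq, wins_comp_perm, Set.mem_iUnion, Finset.mem_range, exists_prop]
      constructor
      · rintro ⟨hu, hw⟩
        have hc : (Finset.univ.filter fun k => (u k : ℝ) < p).card ≤ n :=
          (Finset.card_le_univ _).trans_eq (Fintype.card_fin n)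
        exact ⟨_, Nat.lt_succ_of_le hc, (mem_orderedTimes_iff hc hu).2 rfl, hw⟩
      · rintro ⟨s, -, hu, hw⟩
        exact ⟨hu.1, hw⟩
    · intro a ha b hb hne
      refine Set.disjoint_left.2 fun u h h' => hne ?_
      have ha' := Nat.lt_succ_iff.1 (Finset.mem_range.1 ha)
      have hb' := Nat.lt_succ_iff.1 (Finset.mem_range.1 hb)
      rw [← (mem_orderedTimes_iff ha' h.1.1).1 h.1, (mem_orderedTimes_iff hb' h.1.1).1 h'.1]
    · exact fun s _ => (measurableSet_orderedTimes p n s).inter (measurableSet_wins t p _)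
  rw [algWinProb, volume_eq_sum_perm (measurableSet_wins t p α), winProb_eq_sum]
  simp only [h1]
  rw [Finset.sum_comm]
  refine Finset.sum_congr rfl fun s hs => ?_
  have hs' := Nat.lt_succ_iff.1 (Finset.mem_range.1 hs)
  rw [← mul_assoc, ← binomialWeight, ← factorial_mul_volume_orderedTimes hp0 hp1 hs',
    mul_comm (n.factorial : ℝ), mul_assoc, mul_div_cancel₀ _ (by positivity), Finset.mul_sum]
  refine Finset.sum_congr rfl fun π _ => ?_
  rw [← winProbOnList_realization_mul t p hs', mul_comm, onlineList_eq, sampleSet_eq _ hs']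
  rfl

end ROSp
namespace ROSp

/-! ### The guarantee of `ALG_t` for the optimal thresholds -/

theorem guarantee_realization (t : ℕ → ℝ) {p : ℝ} (hp0 : 0 ≤ p) (hp1 : p ≤ 1) :
    guarantee p (realization t p) = algGuarantee t p := by
  simp only [guarantee, algGuarantee, successProb, algSuccessProb, winProb_realization t hp0 hp1]

theorem le_algGuarantee {t : ℕ → ℝ} {p a : ℝ}
    (h : ∀ (n : ℕ) (α : Fin n ↪ ℝ), a ≤ algWinProb t p α) : a ≤ algGuarantee t p := by
  have : ∀ n : ℕ, Nonempty (Fin n ↪ ℝ) := fun n =>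
    ⟨⟨fun i => ((i : ℕ) : ℝ), fun i j hij => Fin.ext (Nat.cast_injective hij)⟩⟩
  exact le_ciInf fun n => le_ciInf fun α => h n α

theorem algGuarantee_threshold {p : ℝ} (hp0 : 0 ≤ p) (hp1 : p < 1) :
    algGuarantee threshold p = optValue p :=
  le_antisymm (guarantee_realization threshold hp0 hp1.le ▸ guarantee_le_optValue hp0 hp1 _)
    (le_algGuarantee fun _ α => optValue_le_algWinProb hp0 hp1 α)

theorem one_le_algGuarantee_threshold_one : 1 ≤ algGuarantee threshold 1 :=
  le_algGuarantee fun n α => by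
    simpa using le_algWinProb zero_le_one le_rfl α

theorem isGreatest_algGuarantee {p : ℝ} (hp0 : 0 ≤ p) (hp1 : p ≤ 1) :
    IsGreatest (Set.range (guarantee p)) (algGuarantee threshold p) := by
  refine ⟨⟨_, guarantee_realization threshold hp0 hp1⟩, ?_⟩
  rintro _ ⟨A, rfl⟩
  rcases hp1.lt_or_eq with h | rfl
  · rw [algGuarantee_threshold hp0 h]
    exact guarantee_le_optValue hp0 h A
  · exact (guarantee_le_one hp0 le_rfl A).trans one_le_algGuarantee_threshold_one

theorem tendsto_algGuarantee_threshold :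
    Filter.Tendsto (fun p : ℝ => algGuarantee threshold p) (nhdsWithin 1 (Set.Iio 1))
      (nhds fullInfoGuarantee) := by
  rw [fullInfoGuarantee_eq]
  refine tendsto_optValue.congr' ?_
  filter_upwards [self_mem_nhdsWithin, nhdsWithin_le_nhds (lt_mem_nhds (zero_lt_one (α := ℝ)))]
    with p hp1 hp0
  exact (algGuarantee_threshold hp0.le hp1).symm

end ROSp

theorem mainTheorem2 :
    ∃ t : ℕ → ℝ, ROSp.IsThresholdSeq t ∧
      (∀ p : ℝ, 0 ≤ p → p ≤ 1 →
        (∃ A : ROSp.Algorithm, ∀ (n : ℕ) (α : Fin n ↪ ℝ),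
          ROSp.winProb p A α = ROSp.algWinProb t p α) ∧
        IsGreatest (Set.range (ROSp.guarantee p)) (ROSp.algGuarantee t p)) ∧
      ROSp.algGuarantee t 0 = 1 / Real.exp 1 ∧
      Filter.Tendsto (fun p : ℝ => ROSp.algGuarantee t p) (nhdsWithin 1 (Set.Iio 1))
        (nhds ROSp.fullInfoGuarantee) ∧
      ∃ c : ℝ, 0 < c ∧ (∫ x in (0 : ℝ)..1, (Real.exp (c * x) - 1) / x) = 1 ∧
        ROSp.fullInfoGuarantee = ROSp.samuelsExpr c := by
  refine ⟨ROSp.threshold, ROSp.isThresholdSeq_threshold, fun p hp0 hp1 =>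
    ⟨⟨ROSp.realization ROSp.threshold p, fun n α => ROSp.winProb_realization _ hp0 hp1 α⟩,
      ROSp.isGreatest_algGuarantee hp0 hp1⟩, ?_, ROSp.tendsto_algGuarantee_threshold, ?_⟩
  · rw [ROSp.algGuarantee_threshold le_rfl zero_lt_one, ROSp.optValue_zero]
  · obtain ⟨c, hc0, -, hc⟩ := ROSp.exists_Ein_eq_one
    exact ⟨c, hc0, (ROSp.integral_exp_mul_sub_one_div c).trans hc,
      ROSp.fullInfoGuarantee_eq.trans (ROSp.limitValue_eq_samuelsExpr hc0 hc)⟩
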